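/- Work in the language of arithmetic in all finite types (type $0$ is the natural numbers, type $1$ is $\mathbb N\to\mathbb N$). Let $\mathsf{RCA}_0^\omega$ be Kohlenbach's base theory: the basic axioms for $0,1,+,\times,<$, the defining axioms of the combinators $\Pi,\Sigma$ (i.e. $\lambda$-abstraction) and of the type-$0$ recursor $R_0$, extensionality, induction for quantifier-free formulas, and choice $\forall x^1\exists y^0A(x,y)\to\exists Y^{1\to0}\forall x^1A(x,Y(x))$ for quantifier-free $A$. Let $\mathsf{ACA}_0^\omega$ be $\mathsf{RCA}_0^\omega$ plus $(\exists^2)$: there is $\varphi^{1\to 0}\le 1$ such that $\varphi(f)=0\leftrightarrow(\exists n)(f(n)=0)$ for all $f^1$. Let $\mathsf{IND}_0$ be the statement: if $Y^{1\to(0\to0)}$ is such that for each $n$ there is at most one $f\in2^{\mathbb N}$ with $Y(f,n)=0$, then for every $k$ there is a finite sequence $w_0,\dots,w_{l-1}$ of type-$1$ objects such that for all $m\le k$: $(\exists i<l)(w_i\in2^{\mathbb N}\wedge Y(w_i,m)=0)\leftrightarrow(\exists f\in2^{\mathbb N})(Y(f,m)=0)$. "Over a theory $T$" means: in every model of $T$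 (equivalently, by the completeness theorem, provably in $T$). Reals are represented by sequences $(q_n)$ of (codes of) rationals with $|q_n-q_{n+i}|\le2^{-n}$, with $(q_n)=_{\mathbb R}(r_n)$ iff $|q_n-r_n|\le 2^{-n+1}$ for all $n$; functions from $\mathbb R$ (or $[0,1]$) to $\mathbb R$ are represented by objects of type $1\to1$ that map representations of reals (in $[0,1]$) to representations of reals and respect $=_{\mathbb R}$; functions $[0,1]\to\mathbb N$ are objects of type $1\to0$ that respect $=_{\mathbb R}$ on $[0,1]$. An injection $[0,1]\to\mathbb Q$ is an injective function $[0,1]\to\mathbb R$ all of whose values are rational. Let $\mathsf{NIN}$ state that there is no injection from $[0,1]$ to $\mathbb N$. For a property $P$ of functions, let $\mathsf{NIN}_P$ state that there is no injection from $[0,1]$ to $\mathbb Q$ that has property $P$. Consider the following properties of $f$ on $[0,1]$: * bounded variation: there is $k\in\mathbb N$ with $\sum_{i<n}|f(x_i)-f(x_{i+1})|\le k$ for every partition $0=x_0<\dots<x_n=1$; * Riemann integrable: there is $I\in\mathbb R$ such that for every $\varepsilon>0$ there is $\delta>0$ such that every Riemann sum of a tagged partition of $[0,1]$ of mesh $<\delta$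 has distance $<\varepsilon$ from $I$; * Borel: for every $a\in\mathbb R$ the set $\{x\in[0,1]:f(x)>a\}$ is a Borel set, i.e. a member of a sequence of subsets of $[0,1]$ (given by characteristic functions), equipped with a well-founded relation on its indices, each member of which is a rational open interval (intersected with $[0,1]$), or the complement of an earlier member, or the union of a sequence of earlier members; * cliquish: for all $x\in[0,1]$, $\varepsilon>0$ and each neighbourhood $U$ of $x$ in $[0,1]$ there is a non-empty open ball $G\subseteq U$ of $[0,1]$ with $|f(y)-f(z)|<\varepsilon$ for all $y,z\in G$; * upper (lower) semi-continuous: for all $x\in[0,1]$ and $\varepsilon>0$ there is $\delta>0$ such that $f(y)<f(x)+\varepsilon$ (respectively $f(y)>f(x)-\varepsilon$) for all $y\in[0,1]$ with $|x-y|<\delta$. Then: 1. Over $\mathsf{ACA}_0^\omega$, $\mathsf{NIN}$ is equivalent to $\mathsf{NIN}_P$ for $P$ = bounded variation and for $P$ = Riemann integrable. 2. Let $Y$ be any property of functions expressed by a formula of the language (possibly with parameters) such that, over $\mathsf{RCA}_0^\omega$, every function $\mathbb R\to\mathbb R$ that has bounded variation on $[0,1]$ has property $Y$. Then over $\mathsf{ACA}_0^\omega$,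 $\mathsf{NIN}$ is equivalent to $\mathsf{NIN}_Y$. 3. Over $\mathsf{ACA}_0^\omega+\mathsf{IND}_0$, $\mathsf{NIN}$ is equivalent to $\mathsf{NIN}_P$ for $P$ = Borel, $P$ = cliquish, $P$ = upper semi-continuous, and $P$ = lower semi-continuous. -/

import Mathlib

/-!
Higher-order arithmetic: the language of all finite types, its structures, Kohlenbach's base theory
`RCA0ω`, the theory `ACA0ω`, the principle `IND0`, and the versions of the uncountability of the
real line that are compared over these theories.

Everything below the section on semantics is a formula of the formal language: all quantifiers of the
principles range over the objects of the structure in which they are interpreted.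
-/

namespace HigherOrderArith

/-! ### Finite types, terms, formulas -/

/-- The finite types. -/
inductive Ty : Type
  | nat : Ty
  | arr : Ty → Ty → Ty

infixr:60 " ⇒ " => Ty.arr

/-- The type `1` of number sequences. -/
abbrev Ty.seq : Ty := Ty.nat ⇒ Ty.nat

/-- The type of (representations of) functions from reals to reals. -/
abbrev Ty.fn : Ty := Ty.seq ⇒ Ty.seq

/-- The constants of the language: `0`, `1`, `+`, `×`, the combinators `Π` and `Σ` (also known as
`K` and `S`), and the recursor `R₀` for primitive recursion of type `0`. -/
inductive Const : Ty → Type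
  | zero : Const Ty.nat
  | one : Const Ty.nat
  | add : Const (Ty.nat ⇒ Ty.nat ⇒ Ty.nat)
  | mul : Const (Ty.nat ⇒ Ty.nat ⇒ Ty.nat)
  | K (σ τ : Ty) : Const (σ ⇒ τ ⇒ σ)
  | S (ρ σ τ : Ty) : Const ((ρ ⇒ σ ⇒ τ) ⇒ (ρ ⇒ σ) ⇒ ρ ⇒ τ)
  | R : Const ((Ty.nat ⇒ Ty.nat ⇒ Ty.nat) ⇒ Ty.nat ⇒ Ty.nat ⇒ Ty.nat)

/-- A context lists the types of the free variables (de Bruijn indices). -/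
abbrev Ctx : Type := List Ty

/-- `Var Γ σ`: the variables of type `σ` in the context `Γ`. -/
inductive Var : Ctx → Ty → Type
  | z {Γ : Ctx} {σ : Ty} : Var (σ :: Γ) σ
  | s {Γ : Ctx} {σ τ : Ty} (x : Var Γ σ) : Var (τ :: Γ) σ

/-- Terms with free variables in `Γ`. -/
inductive Tm (Γ : Ctx) : Ty → Type
  | var {σ : Ty} (x : Var Γ σ) : Tm Γ σ
  | con {σ : Ty} (c : Const σ) : Tm Γ σ
  | app {σ τ : Ty} (f : Tm Γ (σ ⇒ τ)) (a : Tm Γ σ) : Tm Γ τ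

infixl:90 " ⋄ " => Tm.app

/-- Formulas with free variables in `Γ`. -/
inductive Fm : Ctx → Type
  | falsum {Γ : Ctx} : Fm Γ
  | eq {Γ : Ctx} {σ : Ty} (s t : Tm Γ σ) : Fm Γ
  | lt {Γ : Ctx} (s t : Tm Γ Ty.nat) : Fm Γ
  | imp {Γ : Ctx} (φ ψ : Fm Γ) : Fm Γ
  | and {Γ : Ctx} (φ ψ : Fm Γ) : Fm Γ
  | or {Γ : Ctx} (φ ψ : Fm Γ) : Fm Γ
  | all {Γ : Ctx} (σ : Ty) (φ : Fm (σ :: Γ)) : Fm Γ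
  | ex {Γ : Ctx} (σ : Ty) (φ : Fm (σ :: Γ)) : Fm Γ

infix:50 " ≐ " => Fm.eq
infix:50 " ≺ " => Fm.lt
infixr:35 " ⩓ " => Fm.and
infixr:30 " ⩔ " => Fm.or
infixr:25 " ⇛ " => Fm.imp

def Fm.iff {Γ : Ctx} (φ ψ : Fm Γ) : Fm Γ := (φ ⇛ ψ) ⩓ (ψ ⇛ φ)

infix:20 " ⇚⇛ " => Fm.iff

def Fm.not {Γ : Ctx} (φ : Fm Γ) : Fm Γ := φ ⇛ Fm.falsum

/-- Quantifier-free formulas: Boolean combinations of atomic formulas of type `0` (the terms in them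
may contain subterms and parameters of any type). -/
def Fm.IsQF : {Γ : Ctx} → Fm Γ → Prop
  | _, .falsum => True
  | _, .eq (σ := σ) _ _ => σ = Ty.nat
  | _, .lt _ _ => True
  | _, .imp φ ψ => φ.IsQF ∧ ψ.IsQF
  | _, .and φ ψ => φ.IsQF ∧ ψ.IsQF
  | _, .or φ ψ => φ.IsQF ∧ ψ.IsQF
  | _, .all _ _ => False
  | _, .ex _ _ => False

/-- Simultaneous substitutions. -/
abbrev Subst (Γ Δ : Ctx) : Type := ∀ ⦃σ : Ty⦄, Var Γ σ → Tm Δ σ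

def Tm.subst {Γ Δ : Ctx} (s : Subst Γ Δ) : {σ : Ty} → Tm Γ σ → Tm Δ σ
  | _, .var x => s x
  | _, .con c => .con c
  | _, .app f a => .app (f.subst s) (a.subst s)

/-- Weakening by one additional variable, which becomes the variable with index `0`. -/
def Tm.wk {Γ : Ctx} {σ τ : Ty} (t : Tm Γ σ) : Tm (τ :: Γ) σ :=
  t.subst fun _ x => .var x.s

def Subst.lift {Γ Δ : Ctx} {σ : Ty} (s : Subst Γ Δ) : Subst (σ :: Γ) (σ :: Δ)
  | _, .z => .var .z
  | _, .s x => (s x).wk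

def Fm.subst : {Γ Δ : Ctx} → Subst Γ Δ → Fm Γ → Fm Δ
  | _, _, _, .falsum => .falsum
  | _, _, s, .eq a b => .eq (a.subst s) (b.subst s)
  | _, _, s, .lt a b => .lt (a.subst s) (b.subst s)
  | _, _, s, .imp φ ψ => .imp (φ.subst s) (ψ.subst s)
  | _, _, s, .and φ ψ => .and (φ.subst s) (ψ.subst s)
  | _, _, s, .or φ ψ => .or (φ.subst s) (ψ.subst s)
  | _, _, s, .all σ φ => .all σ (φ.subst s.lift)
  | _, _, s, .ex σ φ => .ex σ (φ.subst s.lift)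

/-- Lambda abstraction over the variable with index `0`, by the combinators. -/
def Tm.lam {Γ : Ctx} {σ : Ty} : {τ : Ty} → Tm (σ :: Γ) τ → Tm Γ (σ ⇒ τ)
  | _, .var .z => .con (.S σ (σ ⇒ σ) σ) ⋄ .con (.K σ (σ ⇒ σ)) ⋄ .con (.K σ σ)
  | τ, .var (.s x) => .con (.K τ σ) ⋄ .var x
  | τ, .con c => .con (.K τ σ) ⋄ .con c
  | τ, .app (σ := ρ) f a => .con (.S σ ρ τ) ⋄ f.lam ⋄ a.lam

/-! ### Semantics -/

universe u

/-- A structure for the language: a domain for each finite type (nonempty because of the constants),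
application, values of the constants, and the relation `<`. Equality is interpreted as identity at every type. -/
structure Model : Type (u + 1) where
  Dom : Ty → Type u
  app : {σ τ : Ty} → Dom (σ ⇒ τ) → Dom σ → Dom τ
  con : {σ : Ty} → Const σ → Dom σ
  lt : Dom Ty.nat → Dom Ty.nat → Prop

/-- Assignments of values to the variables in `Γ`. -/
abbrev Env (M : Model.{u}) (Γ : Ctx) : Type u := ∀ ⦃σ : Ty⦄, Var Γ σ → M.Dom σ

def Env.cons {M : Model.{u}} {Γ : Ctx} {σ : Ty} (d : M.Dom σ) (ρ : Env M Γ) : Env M (σ :: Γ)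
  | _, .z => d
  | _, .s x => ρ x

def Tm.eval (M : Model.{u}) {Γ : Ctx} (ρ : Env M Γ) : {σ : Ty} → Tm Γ σ → M.Dom σ
  | _, .var x => ρ x
  | _, .con c => M.con c
  | _, .app f a => M.app (f.eval M ρ) (a.eval M ρ)

/-- Tarski's truth definition. -/
def Fm.Holds (M : Model.{u}) : {Γ : Ctx} → Fm Γ → Env M Γ → Prop
  | _, .falsum, _ => False
  | _, .eq s t, ρ => s.eval M ρ = t.eval M ρ
  | _, .lt s t, ρ => M.lt (s.eval M ρ) (t.eval M ρ)
  | _, .imp φ ψ, ρ => φ.Holds M ρ → ψ.Holds M ρ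
  | _, .and φ ψ, ρ => φ.Holds M ρ ∧ ψ.Holds M ρ
  | _, .or φ ψ, ρ => φ.Holds M ρ ∨ ψ.Holds M ρ
  | _, .all σ φ, ρ => ∀ d : M.Dom σ, φ.Holds M (ρ.cons d)
  | _, .ex σ φ, ρ => ∃ d : M.Dom σ, φ.Holds M (ρ.cons d)

/-- A theory is a set of formulas; a formula with free variables stands for its universal closure. -/
abbrev Theory : Type := ∀ Γ : Ctx, Fm Γ → Prop

def Model.Satisfies (M : Model.{u}) (T : Theory) : Prop :=
  ∀ (Γ : Ctx) (φ : Fm Γ), T Γ φ → ∀ ρ : Env M Γ, φ.Holds M ρ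

/-- `Entails T φ`: the (universal closure of the) formula `φ` is a consequence of `T`, that is, it
holds in all models of `T`. -/
def Entails (T : Theory) {Γ : Ctx} (φ : Fm Γ) : Prop :=
  ∀ M : Model.{u}, M.Satisfies T → ∀ ρ : Env M Γ, φ.Holds M ρ

/-! ### Variables and arithmetical terms -/

section Terms

variable {Γ : Ctx}

abbrev v0 {σ : Ty} : Tm (σ :: Γ) σ := .var .z
abbrev v1 {σ τ₀ : Ty} : Tm (τ₀ :: σ :: Γ) σ := .var (.s .z)
abbrev v2 {σ τ₀ τ₁ : Ty} : Tm (τ₀ :: τ₁ :: σ :: Γ) σ := .var (.s (.s .z))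
abbrev v3 {σ τ₀ τ₁ τ₂ : Ty} : Tm (τ₀ :: τ₁ :: τ₂ :: σ :: Γ) σ := .var (.s (.s (.s .z)))

def zero : Tm Γ Ty.nat := .con .zero
def one : Tm Γ Ty.nat := .con .one
def add (s t : Tm Γ Ty.nat) : Tm Γ Ty.nat := .con .add ⋄ s ⋄ t
def mul (s t : Tm Γ Ty.nat) : Tm Γ Ty.nat := .con .mul ⋄ s ⋄ t
def succ (t : Tm Γ Ty.nat) : Tm Γ Ty.nat := add t one

/-- `s ≤ t` on numbers. -/
def le (s t : Tm Γ Ty.nat) : Fm Γ := s ≺ succ t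

end Terms

/-! ### The theories -/

/-- The substitution of `t` for the variable with index `0`, which may itself occur in `t`. -/
def Subst.replace {Γ : Ctx} {σ : Ty} (t : Tm (σ :: Γ) σ) : Subst (σ :: Γ) (σ :: Γ)
  | _, .z => t
  | _, .s x => .var x.s

/-- The substitution of `t` for the variable with index `0`. -/
def Subst.single {Γ : Ctx} {σ : Ty} (t : Tm Γ σ) : Subst (σ :: Γ) Γ
  | _, .z => t
  | _, .s x => .var x

/-- The substitution that turns `A(x, y)` into `A(x, Y(x))`. -/
def Subst.choice {Γ : Ctx} {σ τ : Ty} : Subst (τ :: σ :: Γ) (σ :: (σ ⇒ τ) :: Γ)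
  | _, .z => v1 ⋄ v0
  | _, .s .z => v0
  | _, .s (.s x) => .var x.s.s

/-- Kohlenbach's base theory: basic axioms of arithmetic, the defining axioms of the combinators and
of the recursor, extensionality, induction for quantifier-free formulas, and the axiom of choice for
quantifier-free formulas from type `1` to type `0`. -/
inductive RCA0ω : Theory
  | succ_ne_zero : RCA0ω [Ty.nat] (Fm.not (succ v0 ≐ zero))
  | succ_inj : RCA0ω [Ty.nat, Ty.nat] (succ v0 ≐ succ v1 ⇛ v0 ≐ v1)
  | add_zero : RCA0ω [Ty.nat] (add v0 zero ≐ v0)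
  | add_succ : RCA0ω [Ty.nat, Ty.nat] (add v0 (succ v1) ≐ succ (add v0 v1))
  | mul_zero : RCA0ω [Ty.nat] (mul v0 zero ≐ zero)
  | mul_succ : RCA0ω [Ty.nat, Ty.nat] (mul v0 (succ v1) ≐ add (mul v0 v1) v0)
  | not_lt_zero : RCA0ω [Ty.nat] (Fm.not (v0 ≺ zero))
  | lt_succ : RCA0ω [Ty.nat, Ty.nat] (v0 ≺ succ v1 ⇚⇛ v0 ≺ v1 ⩔ v0 ≐ v1)
  | zero_succ : RCA0ω [] (one ≐ succ zero)
  | K (σ τ : Ty) : RCA0ω [σ, τ] (.con (.K σ τ) ⋄ v0 ⋄ v1 ≐ v0)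
  | S (ρ σ τ : Ty) :
      RCA0ω [ρ ⇒ σ ⇒ τ, ρ ⇒ σ, ρ] (.con (.S ρ σ τ) ⋄ v0 ⋄ v1 ⋄ v2 ≐ v0 ⋄ v2 ⋄ (v1 ⋄ v2))
  | R_zero : RCA0ω [Ty.nat ⇒ Ty.nat ⇒ Ty.nat, Ty.nat] (.con .R ⋄ v0 ⋄ v1 ⋄ zero ≐ v1)
  | R_succ : RCA0ω [Ty.nat ⇒ Ty.nat ⇒ Ty.nat, Ty.nat, Ty.nat]
      (.con .R ⋄ v0 ⋄ v1 ⋄ succ v2 ≐ v0 ⋄ v2 ⋄ (.con .R ⋄ v0 ⋄ v1 ⋄ v2))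
  | extensionality (σ τ : Ty) :
      RCA0ω [σ ⇒ τ, σ ⇒ τ] (.all σ (v1 ⋄ v0 ≐ v2 ⋄ v0) ⇛ v0 ≐ v1)
  | induction {Γ : Ctx} (A : Fm (Ty.nat :: Γ)) (hA : A.IsQF) :
      RCA0ω Γ (A.subst (.single zero) ⩓ .all Ty.nat (A ⇛ A.subst (.replace (succ v0))) ⇛
        .all Ty.nat A)
  | qfAC {Γ : Ctx} (A : Fm (Ty.nat :: Ty.seq :: Γ)) (hA : A.IsQF) :
      RCA0ω Γ (.all Ty.seq (.ex Ty.nat A) ⇛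
        .ex (Ty.seq ⇒ Ty.nat) (.all Ty.seq (A.subst .choice)))

/-- Kleene's quantifier `∃²`: there is `φ ≤ 1` with `(∃ n) (f n = 0) ↔ φ f = 0` for all `f`. -/
def existsTwo : Fm [] :=
  .ex (Ty.seq ⇒ Ty.nat)
    (.all Ty.seq (le (v1 ⋄ v0) one) ⩓
      .all Ty.seq (.ex Ty.nat (v1 ⋄ v0 ≐ zero) ⇚⇛ v1 ⋄ v0 ≐ zero))

/-- `ACA0ω` is `RCA0ω` together with `∃²`. -/
inductive ACA0ω : Theory
  | base {Γ : Ctx} {φ : Fm Γ} (h : RCA0ω Γ φ) : ACA0ω Γ φ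
  | existsTwo : ACA0ω [] existsTwo

/-- `f` is an element of Cantor space. -/
def isBinary {Γ : Ctx} (f : Tm Γ Ty.seq) : Fm Γ := .all Ty.nat (le (f.wk ⋄ v0) one)

/-- `IND0`: if for every `n` there is at most one `f` in Cantor space with `Y f n = 0`, then for
every `k` there is a finite sequence `w 0, ..., w (l - 1)` such that for all `m ≤ k`, some binary
`w i` satisfies `Y (w i) m = 0` if and only if some binary `f` satisfies `Y f m = 0`. -/
def IND0 : Fm [] :=
  .all (Ty.seq ⇒ Ty.nat ⇒ Ty.nat)
    -- variables of the hypothesis: `g`, `f`, `n`, `Y`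
    (.all Ty.nat (.all Ty.seq (.all Ty.seq
        (isBinary v1 ⩓ isBinary v0 ⩓ v3 ⋄ v1 ⋄ v2 ≐ zero ⩓ v3 ⋄ v0 ⋄ v2 ≐ zero ⇛ v1 ≐ v0))) ⇛
      -- variables of the conclusion: `m`, `w`, `l`, `k`, `Y`
      .all Ty.nat (.ex Ty.nat (.ex (Ty.nat ⇒ Ty.seq) (.all Ty.nat
        (le v0 v3 ⇛
          (.ex Ty.nat (v0 ≺ v3 ⩓ isBinary (v2 ⋄ v0) ⩓
              .var (.s (.s (.s (.s (.s .z))))) ⋄ (v2 ⋄ v0) ⋄ v1 ≐ zero) ⇚⇛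
            .ex Ty.seq (isBinary v0 ⩓
              .var (.s (.s (.s (.s (.s .z))))) ⋄ v0 ⋄ v1 ≐ zero)))))))

/-- `ACA0ω + IND0`. -/
inductive ACA0ωIND0 : Theory
  | base {Γ : Ctx} {φ : Fm Γ} (h : ACA0ω Γ φ) : ACA0ωIND0 Γ φ
  | IND0 : ACA0ωIND0 [] IND0

/-! ### Primitive recursion, pairing, rational numbers -/

section Rationals

variable {Γ : Ctx}

/-- The value at `n` of the function given by `g 0 = base` and `g (k + 1) = step`, where in `step`
the variable `v0` stands for `g k` and `v1` for `k`. -/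
def natRec (step : Tm (Ty.nat :: Ty.nat :: Γ) Ty.nat) (base n : Tm Γ Ty.nat) : Tm Γ Ty.nat :=
  .con .R ⋄ step.lam.lam ⋄ base ⋄ n

def pred (n : Tm Γ Ty.nat) : Tm Γ Ty.nat := natRec v1 zero n

/-- Truncated subtraction. -/
def sub (m n : Tm Γ Ty.nat) : Tm Γ Ty.nat := natRec (pred v0) m n

/-- `a` if `c = 0`, and `b` otherwise. -/
def ifZero (c a b : Tm Γ Ty.nat) : Tm Γ Ty.nat := natRec b.wk.wk a c

def pow2 (n : Tm Γ Ty.nat) : Tm Γ Ty.nat := natRec (add v0 v0) one n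

/-- The integer part of the square root. -/
def isqrt (n : Tm Γ Ty.nat) : Tm Γ Ty.nat :=
  natRec (ifZero (sub (mul (succ v0) (succ v0)) (succ v1)) (succ v0) v0) zero n

/-- The pairing `(a + b)² + a`, followed by its two inverses. -/
def pair (a b : Tm Γ Ty.nat) : Tm Γ Ty.nat := add (mul (add a b) (add a b)) a
def fst (n : Tm Γ Ty.nat) : Tm Γ Ty.nat := sub n (mul (isqrt n) (isqrt n))
def snd (n : Tm Γ Ty.nat) : Tm Γ Ty.nat := sub (isqrt n) (fst n)

/-- The code of the rational number `(a - b) / (c + 1)`. Every number `p` is the code of a rational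
number, namely of `(qpos p - qneg p) / qden p`. -/
def mkRat (a b c : Tm Γ Ty.nat) : Tm Γ Ty.nat := pair a (pair b c)
def qpos (p : Tm Γ Ty.nat) : Tm Γ Ty.nat := fst p
def qneg (p : Tm Γ Ty.nat) : Tm Γ Ty.nat := fst (snd p)
def qden (p : Tm Γ Ty.nat) : Tm Γ Ty.nat := succ (snd (snd p))

def ratAdd (p q : Tm Γ Ty.nat) : Tm Γ Ty.nat :=
  mkRat (add (mul (qpos p) (qden q)) (mul (qpos q) (qden p)))
    (add (mul (qneg p) (qden q)) (mul (qneg q) (qden p)))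
    (pred (mul (qden p) (qden q)))

def ratSub (p q : Tm Γ Ty.nat) : Tm Γ Ty.nat :=
  mkRat (add (mul (qpos p) (qden q)) (mul (qneg q) (qden p)))
    (add (mul (qneg p) (qden q)) (mul (qpos q) (qden p)))
    (pred (mul (qden p) (qden q)))

def ratMul (p q : Tm Γ Ty.nat) : Tm Γ Ty.nat :=
  mkRat (add (mul (qpos p) (qpos q)) (mul (qneg p) (qneg q)))
    (add (mul (qpos p) (qneg q)) (mul (qneg p) (qpos q)))
    (pred (mul (qden p) (qden q)))

def ratAbs (p : Tm Γ Ty.nat) : Tm Γ Ty.nat :=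
  mkRat (add (sub (qpos p) (qneg p)) (sub (qneg p) (qpos p))) zero (pred (qden p))

/-- The rational number `a`, for a natural number `a`. -/
def ratOfNat (a : Tm Γ Ty.nat) : Tm Γ Ty.nat := mkRat a zero zero

/-- The rational number `a / 2 ^ n`. -/
def ratDyadic (a n : Tm Γ Ty.nat) : Tm Γ Ty.nat := mkRat a zero (pred (pow2 n))

/-- `p ≤ q` on rational numbers. -/
def ratLe (p q : Tm Γ Ty.nat) : Fm Γ :=
  le (add (mul (qpos p) (qden q)) (mul (qneg q) (qden p)))
    (add (mul (qpos q) (qden p)) (mul (qneg p) (qden q)))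

/-- The rational number `y 0 m + ... + y (n - 1) m`. -/
def ratSum (y : Tm Γ (Ty.nat ⇒ Ty.seq)) (n m : Tm Γ Ty.nat) : Tm Γ Ty.nat :=
  natRec (ratAdd v0 (y.wk.wk ⋄ v1 ⋄ m.wk.wk)) (ratOfNat zero) n

end Rationals

/-! ### Real numbers -/

section Reals

variable {Γ : Ctx}

/-- `x` represents a real number: `|x n - x (n + i)| ≤ 2 ^ (-n)` for all `n` and `i`. -/
def isReal (x : Tm Γ Ty.seq) : Fm Γ :=
  .all Ty.nat (.all Ty.nat
    (ratLe (ratAbs (ratSub (x.wk.wk ⋄ v1) (x.wk.wk ⋄ add v1 v0))) (ratDyadic one v1)))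

/-- Equality of reals: `|x n - y n| ≤ 2 ^ (-n + 1)` for all `n`. -/
def realEq (x y : Tm Γ Ty.seq) : Fm Γ :=
  .all Ty.nat (ratLe (ratAbs (ratSub (x.wk ⋄ v0) (y.wk ⋄ v0))) (ratDyadic (succ one) v0))

/-- `x ≤ y` on reals: `x n ≤ y n + 2 ^ (-n + 1)` for all `n`. -/
def realLe (x y : Tm Γ Ty.seq) : Fm Γ :=
  .all Ty.nat (ratLe (x.wk ⋄ v0) (ratAdd (y.wk ⋄ v0) (ratDyadic (succ one) v0)))

/-- `x < y` on reals. -/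
def realLt (x y : Tm Γ Ty.seq) : Fm Γ := Fm.not (realLe y x)

/-- The rational number with code `q`, as a real number. -/
def realOfRat (q : Tm Γ Ty.nat) : Tm Γ Ty.seq := .lam q.wk

def realZero : Tm Γ Ty.seq := realOfRat (ratOfNat zero)
def realOne : Tm Γ Ty.seq := realOfRat (ratOfNat one)

def realAdd (x y : Tm Γ Ty.seq) : Tm Γ Ty.seq :=
  .lam (ratAdd (x.wk ⋄ succ v0) (y.wk ⋄ succ v0))

def realSub (x y : Tm Γ Ty.seq) : Tm Γ Ty.seq :=
  .lam (ratSub (x.wk ⋄ succ v0) (y.wk ⋄ succ v0))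

/-- The distance `|x - y|`. -/
def realDist (x y : Tm Γ Ty.seq) : Tm Γ Ty.seq :=
  .lam (ratAbs (ratSub (x.wk ⋄ succ v0) (y.wk ⋄ succ v0)))

/-- A natural number `k` with `|x 0| + |y 0| + 2 ≤ k ≤ 2 ^ k`. -/
def realMulShift (x y : Tm Γ Ty.seq) : Tm Γ Ty.nat :=
  add (add (add (qpos (x ⋄ zero)) (qneg (x ⋄ zero)))
    (add (qpos (y ⋄ zero)) (qneg (y ⋄ zero)))) (succ one)

/-- The product: its `n`-th approximation is `x (n + k) * y (n + k)` with `k` as above. -/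
def realMul (x y : Tm Γ Ty.seq) : Tm Γ Ty.seq :=
  .lam (ratMul (x.wk ⋄ add v0 (realMulShift x y).wk) (y.wk ⋄ add v0 (realMulShift x y).wk))

/-- The finite sum `y 0 + ... + y (n - 1)` of reals: its `m`-th approximation is
`y 0 (m + n) + ... + y (n - 1) (m + n)`. -/
def realSum (y : Tm Γ (Ty.nat ⇒ Ty.seq)) (n : Tm Γ Ty.nat) : Tm Γ Ty.seq :=
  .lam (ratSum y.wk n.wk (add v0 n.wk))

/-- `x` represents a real number in the unit interval. -/
def inUnit (x : Tm Γ Ty.seq) : Fm Γ :=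
  isReal x ⩓ realLe realZero x ⩓ realLe x realOne

/-- `x` represents a positive real number. -/
def isPos (x : Tm Γ Ty.seq) : Fm Γ := isReal x ⩓ realLt realZero x

/-! ### Functions on the unit interval -/

/-- `f` represents a function from the reals to the reals: it maps reals to reals and equal reals to
equal reals. -/
def isRealFunction (f : Tm Γ Ty.fn) : Fm Γ :=
  .all Ty.seq (isReal v0 ⇛ isReal (f.wk ⋄ v0)) ⩓
  .all Ty.seq (.all Ty.seq (isReal v1 ⩓ isReal v0 ⩓ realEq v1 v0 ⇛
    realEq (f.wk.wk ⋄ v1) (f.wk.wk ⋄ v0)))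

/-- `f` represents a function from the unit interval to the reals. -/
def isUnitFunction (f : Tm Γ Ty.fn) : Fm Γ :=
  .all Ty.seq (inUnit v0 ⇛ isReal (f.wk ⋄ v0)) ⩓
  .all Ty.seq (.all Ty.seq (inUnit v1 ⩓ inUnit v0 ⩓ realEq v1 v0 ⇛
    realEq (f.wk.wk ⋄ v1) (f.wk.wk ⋄ v0)))

/-- `f` represents an injection from the unit interval to the rationals: a function from the unit
interval to the reals that has rational values and is injective. -/
def isRatInjection (f : Tm Γ Ty.fn) : Fm Γ :=
  isUnitFunction f ⩓
  .all Ty.seq (inUnit v0 ⇛ .ex Ty.nat (realEq (f.wk.wk ⋄ v1) (realOfRat v0))) ⩓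
  .all Ty.seq (.all Ty.seq (inUnit v1 ⩓ inUnit v0 ⩓ realEq (f.wk.wk ⋄ v1) (f.wk.wk ⋄ v0) ⇛
    realEq v1 v0))

/-- `0 = x 0 < x 1 < ... < x n = 1`, a partition of the unit interval. -/
def isPartition (x : Tm Γ (Ty.nat ⇒ Ty.seq)) (n : Tm Γ Ty.nat) : Fm Γ :=
  .all Ty.nat (le v0 n.wk ⇛ inUnit (x.wk ⋄ v0)) ⩓
  realEq (x ⋄ zero) realZero ⩓ realEq (x ⋄ n) realOne ⩓
  .all Ty.nat (v0 ≺ n.wk ⇛ realLt (x.wk ⋄ v0) (x.wk ⋄ succ v0))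

/-- Bounded variation on the unit interval: there is a natural number `k` such that the sum of the
`|f (x i) - f (x (i + 1))|` for `i < n` is at most `k`, for all partitions `x 0, ..., x n`. -/
def boundedVariation (f : Tm Γ Ty.fn) : Fm Γ :=
  -- variables: `x`, `n`, `k`
  .ex Ty.nat (.all Ty.nat (.all (Ty.nat ⇒ Ty.seq)
    (isPartition v0 v1 ⇛
      realLe
        (realSum
          (.lam (realDist (f.wk.wk.wk.wk ⋄ (v1 ⋄ v0)) (f.wk.wk.wk.wk ⋄ (v1 ⋄ succ v0)))) v1)
        (realOfRat (ratOfNat v2)))))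

/-- The Riemann sum of the `f (t i) * (x (i + 1) - x i)` for `i < n`. -/
def riemannSum (f : Tm Γ Ty.fn) (x t : Tm Γ (Ty.nat ⇒ Ty.seq)) (n : Tm Γ Ty.nat) : Tm Γ Ty.seq :=
  realSum (.lam (realMul (f.wk ⋄ (t.wk ⋄ v0)) (realSub (x.wk ⋄ succ v0) (x.wk ⋄ v0)))) n

/-- Riemann integrability on the unit interval: there is a real `I` such that for every `ε > 0` there
is `δ > 0` such that every Riemann sum over a tagged partition of mesh less than `δ` differs
from `I` by less than `ε`. -/
def riemannIntegrable (f : Tm Γ Ty.fn) : Fm Γ :=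
  .ex Ty.seq (isReal v0 ⩓
    .all Ty.seq (isPos v0 ⇛ .ex Ty.seq (isPos v0 ⩓
      -- variables: `t`, `x`, `n`, `δ`, `ε`, `I`
      .all Ty.nat (.all (Ty.nat ⇒ Ty.seq) (.all (Ty.nat ⇒ Ty.seq)
        (isPartition v1 v2 ⩓
          .all Ty.nat (v0 ≺ v3 ⇛
            realLt (realSub (v2 ⋄ succ v0) (v2 ⋄ v0)) (.var (.s (.s (.s (.s .z))))) ⩓
            inUnit (v1 ⋄ v0) ⩓ realLe (v2 ⋄ v0) (v1 ⋄ v0) ⩓ realLe (v1 ⋄ v0) (v2 ⋄ succ v0)) ⇛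
          realLt (realDist (riemannSum f.wk.wk.wk.wk.wk.wk v1 v0 v2)
            (.var (.s (.s (.s (.s (.s .z))))))) (.var (.s (.s (.s (.s .z)))))))))))

/-- `f` is cliquish at all points of the unit interval: for all `x`, all `ε > 0`, and every
neighbourhood of `x` (the points of the unit interval at distance less than `δ`), there is a
nonempty open ball of the unit interval, with centre `c` and radius `r > 0`, inside that
neighbourhood such that `|f y - f z| < ε` for all `y` and `z` in the ball. -/
def cliquish (f : Tm Γ Ty.fn) : Fm Γ :=
  .all Ty.seq (.all Ty.seq (.all Ty.seq (inUnit v2 ⩓ isPos v1 ⩓ isPos v0 ⇛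
    -- variables: `r`, `c`, `δ`, `ε`, `x`
    .ex Ty.seq (.ex Ty.seq (inUnit v1 ⩓ isPos v0 ⩓
      .all Ty.seq (inUnit v0 ⩓ realLt (realDist v0 v2) v1 ⇛
        realLt (realDist v0 (.var (.s (.s (.s (.s (.s .z))))))) v3) ⩓
      -- variables: `z`, `y`, `r`, `c`, `δ`, `ε`, `x`
      .all Ty.seq (.all Ty.seq
        (inUnit v1 ⩓ inUnit v0 ⩓ realLt (realDist v1 v3) v2 ⩓ realLt (realDist v0 v3) v2 ⇛
          realLt (realDist (f.wk.wk.wk.wk.wk.wk.wk ⋄ v1) (f.wk.wk.wk.wk.wk.wk.wk ⋄ v0))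
            (.var (.s (.s (.s (.s (.s .z)))))))))))))

/-- `f` is upper semi-continuous on the unit interval: for all `x` and `ε > 0` there is `δ > 0`
with `f y < f x + ε` for all `y` at distance less than `δ` from `x`. -/
def upperSemicontinuous (f : Tm Γ Ty.fn) : Fm Γ :=
  .all Ty.seq (.all Ty.seq (inUnit v1 ⩓ isPos v0 ⇛ .ex Ty.seq (isPos v0 ⩓
    -- variables: `y`, `δ`, `ε`, `x`
    .all Ty.seq (inUnit v0 ⩓ realLt (realDist v0 v3) v1 ⇛
      realLt (f.wk.wk.wk.wk ⋄ v0) (realAdd (f.wk.wk.wk.wk ⋄ v3) v2)))))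

/-- `f` is lower semi-continuous on the unit interval: for all `x` and `ε > 0` there is `δ > 0`
with `f x < f y + ε` for all `y` at distance less than `δ` from `x`. -/
def lowerSemicontinuous (f : Tm Γ Ty.fn) : Fm Γ :=
  .all Ty.seq (.all Ty.seq (inUnit v1 ⩓ isPos v0 ⇛ .ex Ty.seq (isPos v0 ⩓
    -- variables: `y`, `δ`, `ε`, `x`
    .all Ty.seq (inUnit v0 ⩓ realLt (realDist v0 v3) v1 ⇛
      realLt (f.wk.wk.wk.wk ⋄ v3) (realAdd (f.wk.wk.wk.wk ⋄ v0) v2)))))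

/-- `A` represents a subset of the unit interval by its characteristic function: it takes the
values `0` and `1` and respects equality of reals. -/
def isUnitSet (A : Tm Γ (Ty.seq ⇒ Ty.nat)) : Fm Γ :=
  .all Ty.seq (inUnit v0 ⇛ le (A.wk ⋄ v0) one) ⩓
  .all Ty.seq (.all Ty.seq (inUnit v1 ⩓ inUnit v0 ⩓ realEq v1 v0 ⇛ A.wk.wk ⋄ v1 ≐ A.wk.wk ⋄ v0))

/-- The relation `r i j = 0` on the natural numbers has no infinite descending sequence. -/
def isWellFounded (r : Tm Γ (Ty.nat ⇒ Ty.nat ⇒ Ty.nat)) : Fm Γ :=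
  Fm.not (.ex Ty.seq (.all Ty.nat (r.wk.wk ⋄ (v1 ⋄ succ v0) ⋄ (v1 ⋄ v0) ≐ zero)))

/-- `D 0, D 1, ...` are subsets of the unit interval, and along the well-founded relation `r`
each `D n` is a rational open interval, or the complement of an earlier set, or the union of a
sequence of earlier sets. -/
def isBorelConstruction (D : Tm Γ (Ty.nat ⇒ Ty.seq ⇒ Ty.nat))
    (r : Tm Γ (Ty.nat ⇒ Ty.nat ⇒ Ty.nat)) : Fm Γ :=
  isWellFounded r ⩓
  .all Ty.nat (isUnitSet (D.wk ⋄ v0) ⩓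
    -- `D n` is the set of all `x` with `a < x < b`; variables: `x`, `b`, `a`, `n`
    (.ex Ty.nat (.ex Ty.nat (.all Ty.seq (inUnit v0 ⇛
        (D.wk.wk.wk.wk ⋄ v3 ⋄ v0 ≐ one ⇚⇛
          realLt (realOfRat v2) v0 ⩓ realLt v0 (realOfRat v1))))) ⩔
      -- `D n` is the complement of `D m`; variables: `x`, `m`, `n`
      .ex Ty.nat (r.wk.wk ⋄ v0 ⋄ v1 ≐ zero ⩓ .all Ty.seq (inUnit v0 ⇛
        (D.wk.wk.wk ⋄ v2 ⋄ v0 ≐ one ⇚⇛ Fm.not (D.wk.wk.wk ⋄ v1 ⋄ v0 ≐ one)))) ⩔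
      -- `D n` is the union of the `D (s k)`; variables: `x`, `s`, `n`
      .ex Ty.seq (.all Ty.nat (r.wk.wk.wk ⋄ (v1 ⋄ v0) ⋄ v2 ≐ zero) ⩓ .all Ty.seq (inUnit v0 ⇛
        (D.wk.wk.wk ⋄ v2 ⋄ v0 ≐ one ⇚⇛
          .ex Ty.nat (D.wk.wk.wk.wk ⋄ (v2 ⋄ v0) ⋄ v1 ≐ one))))))

/-- `f` is a Borel function on the unit interval: for every real `a`, the set of all `x` in the unit
interval with `f x > a` is a Borel set, that is, it arises in some Borel construction. -/
def isBorelFunction (f : Tm Γ Ty.fn) : Fm Γ :=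
  .all Ty.seq (isReal v0 ⇛
    .ex (Ty.nat ⇒ Ty.seq ⇒ Ty.nat) (.ex (Ty.nat ⇒ Ty.nat ⇒ Ty.nat)
      (isBorelConstruction v1 v0 ⩓
        -- variables: `x`, `n`, `r`, `D`, `a`
        .ex Ty.nat (.all Ty.seq (inUnit v0 ⇛
          (realLt (.var (.s (.s (.s (.s .z))))) (f.wk.wk.wk.wk.wk ⋄ v0) ⇚⇛
            v3 ⋄ v1 ⋄ v0 ≐ one))))))

/-! ### The principles -/

/-- `NIN`: there is no injection from the unit interval to the natural numbers. -/
def NIN : Fm Γ :=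
  Fm.not (.ex (Ty.seq ⇒ Ty.nat)
    (.all Ty.seq (.all Ty.seq (inUnit v1 ⩓ inUnit v0 ⩓ realEq v1 v0 ⇛ v2 ⋄ v1 ≐ v2 ⋄ v0)) ⩓
      .all Ty.seq (.all Ty.seq (inUnit v1 ⩓ inUnit v0 ⩓ v2 ⋄ v1 ≐ v2 ⋄ v0 ⇛ realEq v1 v0))))

/-- There is no injection from the unit interval to the rationals that has the property `P`. -/
def NINwith (P : Fm (Ty.fn :: Γ)) : Fm Γ := Fm.not (.ex Ty.fn (isRatInjection v0 ⩓ P))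

end Reals

def NINbv : Fm [] := NINwith (boundedVariation v0)
def NINRiemann : Fm [] := NINwith (riemannIntegrable v0)
def NINBorel : Fm [] := NINwith (isBorelFunction v0)
def NINcliq : Fm [] := NINwith (cliquish v0)
def NINusc : Fm [] := NINwith (upperSemicontinuous v0)
def NINlsc : Fm [] := NINwith (lowerSemicontinuous v0)

end HigherOrderArith

open HigherOrderArith

universe u

/-!
All equivalences are proved in an arbitrary model `M` of `ACA0ω`. The implications from `NIN` are easy
(`IsRatInj.exists_isInj`): given an injection `f` of the unit interval into the rationals, let `Y x`
be a code of the value `f x`, selected by a choice functional (`nu`) from the set of all codes of that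
value, which depends on `x` as a real number only.

For the converse, an injection `Y` of the unit interval into the numbers is turned into the function
`f x = 2 ^ (-Y x)`, or `-2 ^ (-Y x)` in the case of lower semicontinuity (`powFn`). It is an injection
with rational values, and has all the properties in question:

* Distinct points have distinct values of `Y`, so the values of `f` at finitely many distinct points
  have a bounded sum. This bounds the variation. In a Riemann sum a point can be the tag of at most two
  intervals, so a sum over a partition of mesh `δ` is at most `4 * δ` and the integral is `0`. Both use
  `IsSum.le_four`, a bound for sums of nonstandard length proved by induction in the model.
* A function of bounded variation has every property `P` that follows from bounded variation in
  `RCA0ω`, since `M` is a model of `RCA0ω` as well.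
* With `IND0`, the points with `Y x ≤ k` can be listed (`IsInj.exists_list`), as soon as reals have
  canonical names in Cantor space: the lower cuts (`cut`), from which the real can be recovered
  (`uncut`). A finite list of reals is separated from any point outside it, so every point has a
  punctured neighbourhood on which `Y` is larger than `k` (`IsInj.exists_isolated`). Semicontinuity and
  cliquishness follow, and `{x | f x > a}` is the complement of a union of rational intervals.

The model may be nonstandard, so arithmetic has to be redone inside it. Three devices keep this short.
Functions and properties given by objects of the model are recognized by instance search (`Def`,
`DefP`, `DefQ`), so that induction, comprehension and finite sums are available for them; numerical
quantifiers are allowed because of `∃²`. The numbers of the model form an ordered semiring, and the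
rational numbers are computed with in its ordered field of fractions (`OrdFrac`, `QQ`). Finally, reals
of the model are given values in an ultrapower of this field (`RR`, `rv`), an ordered field in which
the relations `=` and `<` of reals are equality and order of the values.
-/

namespace HigherOrderArith

/-! ### Evaluation of terms and formulas -/

section Eval

variable {M : Model.{u}}

/-- The assignment for the empty context. -/
def Env.nil : Env M [] := fun _ x => nomatch x

@[simp] theorem Env.cons_z {Γ : Ctx} {σ : Ty} (d : M.Dom σ) (ρ : Env M Γ) :
    ρ.cons d (Var.z : Var (σ :: Γ) σ) = d := rfl

@[simp] theorem Env.cons_s {Γ : Ctx} {σ τ : Ty} (d : M.Dom σ) (ρ : Env M Γ) (x : Var Γ τ) :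
    ρ.cons d (Var.s x) = ρ x := rfl

@[simp] theorem Tm.eval_var {Γ : Ctx} (ρ : Env M Γ) {σ : Ty} (x : Var Γ σ) :
    (Tm.var x).eval M ρ = ρ x := rfl

@[simp] theorem Tm.eval_con {Γ : Ctx} (ρ : Env M Γ) {σ : Ty} (c : Const σ) :
    (Tm.con c : Tm Γ σ).eval M ρ = M.con c := rfl

@[simp] theorem Tm.eval_app {Γ : Ctx} (ρ : Env M Γ) {σ τ : Ty} (f : Tm Γ (σ ⇒ τ)) (a : Tm Γ σ) :
    (f ⋄ a).eval M ρ = M.app (f.eval M ρ) (a.eval M ρ) := rfl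

theorem Tm.eval_subst {Γ Δ : Ctx} (s : Subst Γ Δ) (ρ : Env M Δ) {σ : Ty} (t : Tm Γ σ) :
    (t.subst s).eval M ρ = t.eval M (fun _ x => (s x).eval M ρ) := by
  induction t with
  | var x => rfl
  | con c => rfl
  | app f a hf ha => simp [Tm.subst, hf, ha]

@[simp] theorem Tm.eval_wk {Γ : Ctx} {σ τ : Ty} (t : Tm Γ σ) (d : M.Dom τ) (ρ : Env M Γ) :
    t.wk.eval M (ρ.cons d) = t.eval M ρ := by
  simp only [Tm.wk, Tm.eval_subst]; rfl

theorem Fm.holds_subst {Γ Δ : Ctx} (s : Subst Γ Δ) (ρ : Env M Δ) (φ : Fm Γ) :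
    (φ.subst s).Holds M ρ ↔ φ.Holds M (fun _ x => (s x).eval M ρ) := by
  induction φ generalizing Δ with
  | falsum => rfl
  | eq a b => simp [Fm.subst, Fm.Holds, Tm.eval_subst]
  | lt a b => simp [Fm.subst, Fm.Holds, Tm.eval_subst]
  | imp φ ψ h1 h2 => simp [Fm.subst, Fm.Holds, h1, h2]
  | and φ ψ h1 h2 => simp [Fm.subst, Fm.Holds, h1, h2]
  | or φ ψ h1 h2 => simp [Fm.subst, Fm.Holds, h1, h2]
  | all σ φ h =>
    simp only [Fm.subst, Fm.Holds, h]
    refine forall_congr' fun d => iff_of_eq ?_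
    congr 1
    funext τ x
    cases x with
    | z => rfl
    | s x => exact Tm.eval_wk _ _ _
  | ex σ φ h =>
    simp only [Fm.subst, Fm.Holds, h]
    refine exists_congr fun d => iff_of_eq ?_
    congr 1
    funext τ x
    cases x with
    | z => rfl
    | s x => exact Tm.eval_wk _ _ _

@[simp] theorem Fm.holds_falsum {Γ : Ctx} (ρ : Env M Γ) : (Fm.falsum : Fm Γ).Holds M ρ ↔ False :=
  Iff.rfl
@[simp] theorem Fm.holds_eq {Γ : Ctx} (ρ : Env M Γ) {σ : Ty} (s t : Tm Γ σ) :
    (s ≐ t).Holds M ρ ↔ s.eval M ρ = t.eval M ρ := Iff.rfl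
@[simp] theorem Fm.holds_imp {Γ : Ctx} (ρ : Env M Γ) (φ ψ : Fm Γ) :
    (φ ⇛ ψ).Holds M ρ ↔ (φ.Holds M ρ → ψ.Holds M ρ) := Iff.rfl
@[simp] theorem Fm.holds_and {Γ : Ctx} (ρ : Env M Γ) (φ ψ : Fm Γ) :
    (φ ⩓ ψ).Holds M ρ ↔ (φ.Holds M ρ ∧ ψ.Holds M ρ) := Iff.rfl
@[simp] theorem Fm.holds_or {Γ : Ctx} (ρ : Env M Γ) (φ ψ : Fm Γ) :
    (φ ⩔ ψ).Holds M ρ ↔ (φ.Holds M ρ ∨ ψ.Holds M ρ) := Iff.rfl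
@[simp] theorem Fm.holds_not {Γ : Ctx} (ρ : Env M Γ) (φ : Fm Γ) :
    φ.not.Holds M ρ ↔ ¬ φ.Holds M ρ := Iff.rfl
@[simp] theorem Fm.holds_iff {Γ : Ctx} (ρ : Env M Γ) (φ ψ : Fm Γ) :
    (φ ⇚⇛ ψ).Holds M ρ ↔ (φ.Holds M ρ ↔ ψ.Holds M ρ) := iff_iff_implies_and_implies.symm
@[simp] theorem Fm.holds_all {Γ : Ctx} (ρ : Env M Γ) {σ : Ty} (φ : Fm (σ :: Γ)) :
    (Fm.all σ φ).Holds M ρ ↔ ∀ d : M.Dom σ, φ.Holds M (ρ.cons d) := Iff.rfl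
@[simp] theorem Fm.holds_ex {Γ : Ctx} (ρ : Env M Γ) {σ : Ty} (φ : Fm (σ :: Γ)) :
    (Fm.ex σ φ).Holds M ρ ↔ ∃ d : M.Dom σ, φ.Holds M (ρ.cons d) := Iff.rfl

end Eval

/-- `M` is a model of `ACA0ω`. -/
class IsACA (M : Model.{u}) : Prop where
  sat : M.Satisfies ACA0ω

section Arith

variable {M : Model.{u}}

/-! The numbers of the model carry the usual notation. -/

instance : Zero (M.Dom Ty.nat) := ⟨M.con .zero⟩
instance : One (M.Dom Ty.nat) := ⟨M.con .one⟩
instance : Add (M.Dom Ty.nat) := ⟨fun a b => M.app (M.app (M.con .add) a) b⟩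
instance : Mul (M.Dom Ty.nat) := ⟨fun a b => M.app (M.app (M.con .mul) a) b⟩
instance : LT (M.Dom Ty.nat) := ⟨M.lt⟩

@[simp] theorem eval_zero {Γ : Ctx} (ρ : Env M Γ) : (zero : Tm Γ Ty.nat).eval M ρ = 0 := rfl
@[simp] theorem eval_one {Γ : Ctx} (ρ : Env M Γ) : (one : Tm Γ Ty.nat).eval M ρ = 1 := rfl
@[simp] theorem eval_add {Γ : Ctx} (ρ : Env M Γ) (s t : Tm Γ Ty.nat) :
    (add s t).eval M ρ = s.eval M ρ + t.eval M ρ := rfl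
@[simp] theorem eval_mul {Γ : Ctx} (ρ : Env M Γ) (s t : Tm Γ Ty.nat) :
    (mul s t).eval M ρ = s.eval M ρ * t.eval M ρ := rfl
@[simp] theorem eval_succ {Γ : Ctx} (ρ : Env M Γ) (t : Tm Γ Ty.nat) :
    (succ t).eval M ρ = t.eval M ρ + 1 := rfl
@[simp] theorem Fm.holds_lt {Γ : Ctx} (ρ : Env M Γ) (s t : Tm Γ Ty.nat) :
    (s ≺ t).Holds M ρ ↔ s.eval M ρ < t.eval M ρ := Iff.rfl

variable [IsACA M]

theorem holds_of_RCA {Γ : Ctx} {φ : Fm Γ} (h : RCA0ω Γ φ) (ρ : Env M Γ) : φ.Holds M ρ :=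
  IsACA.sat Γ φ (.base h) ρ

@[simp] theorem app_K {σ τ : Ty} (a : M.Dom σ) (b : M.Dom τ) :
    M.app (M.app (M.con (.K σ τ)) a) b = a :=
  holds_of_RCA (.K σ τ) ((Env.nil.cons b).cons a)

@[simp] theorem app_S {ρ σ τ : Ty} (a : M.Dom (ρ ⇒ σ ⇒ τ)) (b : M.Dom (ρ ⇒ σ)) (c : M.Dom ρ) :
    M.app (M.app (M.app (M.con (.S ρ σ τ)) a) b) c = M.app (M.app a c) (M.app b c) :=
  holds_of_RCA (.S ρ σ τ) (((Env.nil.cons c).cons b).cons a)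

theorem app_ext {σ τ : Ty} {f g : M.Dom (σ ⇒ τ)} (h : ∀ d, M.app f d = M.app g d) : f = g :=
  holds_of_RCA (.extensionality σ τ) ((Env.nil.cons g).cons f) h

/-- Combinatory completeness: the terms `Tm.lam t` behave as abstractions. -/
@[simp] theorem Tm.eval_lam {Γ : Ctx} (ρ : Env M Γ) {σ τ : Ty} (t : Tm (σ :: Γ) τ) (d : M.Dom σ) :
    M.app (t.lam.eval M ρ) d = t.eval M (ρ.cons d) := by
  -- the context is an index of the type of `t` and has to be a variable for the induction
  suffices H : ∀ (Δ : Ctx) (τ : Ty) (t : Tm Δ τ) (h : Δ = σ :: Γ),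
      M.app ((h ▸ t : Tm (σ :: Γ) τ).lam.eval M ρ) d = (h ▸ t : Tm (σ :: Γ) τ).eval M (ρ.cons d) from
    H _ _ t rfl
  clear t
  intro Δ τ t
  induction t with
  | var x =>
    rintro rfl
    cases x with
    | z => simp [Tm.lam]
    | s x => simp [Tm.lam]
  | con c => rintro rfl; simp [Tm.lam]
  | app f a hf ha =>
    rintro rfl
    have h1 := hf rfl
    have h2 := ha rfl
    simp only at h1 h2
    simp [Tm.lam, h1, h2]

theorem holds_induction {Γ : Ctx} (A : Fm (Ty.nat :: Γ)) (hA : A.IsQF) (ρ : Env M Γ)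
    (h0 : A.Holds M (ρ.cons (0 : M.Dom Ty.nat)))
    (hs : ∀ n : M.Dom Ty.nat, A.Holds M (ρ.cons n) → A.Holds M (ρ.cons (n + 1)))
    (n : M.Dom Ty.nat) : A.Holds M (ρ.cons n) := by
  refine holds_of_RCA (.induction A hA) ρ ⟨?_, fun m hm => ?_⟩ n
  · rw [Fm.holds_subst]
    convert h0 using 2
    funext x
    cases x <;> rfl
  · rw [Fm.holds_subst]
    convert hs m hm using 2
    funext x
    cases x <;> rfl

end Arith

/-! ### The semiring of numbers -/

section Semiring

variable {M : Model.{u}} [IsACA M]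

namespace Num

theorem add_zero (a : M.Dom Ty.nat) : a + 0 = a := holds_of_RCA .add_zero (Env.nil.cons a)

theorem add_succ (a b : M.Dom Ty.nat) : a + (b + 1) = a + b + 1 :=
  holds_of_RCA .add_succ ((Env.nil.cons b).cons a)

theorem mul_zero (a : M.Dom Ty.nat) : a * 0 = 0 := holds_of_RCA .mul_zero (Env.nil.cons a)

theorem mul_succ (a b : M.Dom Ty.nat) : a * (b + 1) = a * b + a :=
  holds_of_RCA .mul_succ ((Env.nil.cons b).cons a)

theorem one_eq : (1 : M.Dom Ty.nat) = 0 + 1 := holds_of_RCA .zero_succ Env.nil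

theorem succ_ne_zero (a : M.Dom Ty.nat) : a + 1 ≠ 0 :=
  holds_of_RCA .succ_ne_zero (Env.nil.cons a)

theorem succ_inj {a b : M.Dom Ty.nat} (h : a + 1 = b + 1) : a = b :=
  holds_of_RCA .succ_inj ((Env.nil.cons b).cons a) h

theorem not_lt_zero (a : M.Dom Ty.nat) : ¬ a < 0 := holds_of_RCA .not_lt_zero (Env.nil.cons a)

theorem lt_succ {a b : M.Dom Ty.nat} : a < b + 1 ↔ a < b ∨ a = b :=
  (Fm.holds_iff _ _ _).1 (holds_of_RCA .lt_succ ((Env.nil.cons b).cons a))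

theorem add_assoc (a b c : M.Dom Ty.nat) : a + b + c = a + (b + c) := by
  refine holds_induction (add (add v1 v2) v0 ≐ add v1 (add v2 v0)) (by simp [Fm.IsQF])
    ((Env.nil.cons b).cons a) ?_ (fun n h => ?_) c
  · simp [add_zero]
  · simp only [Fm.holds_eq, eval_add, Tm.eval_var, Env.cons_z, Env.cons_s] at h ⊢
    rw [add_succ, add_succ, add_succ, h]

theorem zero_add (a : M.Dom Ty.nat) : 0 + a = a := by
  refine holds_induction (add zero v0 ≐ v0) (by simp [Fm.IsQF]) Env.nil ?_ (fun n h => ?_) a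
  · simp [add_zero]
  · simp only [Fm.holds_eq, eval_add, Tm.eval_var, Env.cons_z, eval_zero] at h ⊢
    rw [add_succ, h]

theorem succ_add (a b : M.Dom Ty.nat) : a + 1 + b = a + b + 1 := by
  refine holds_induction (add (succ v1) v0 ≐ succ (add v1 v0)) (by simp [Fm.IsQF]) (Env.nil.cons a) ?_
    (fun n h => ?_) b
  · simp [add_zero]
  · simp only [Fm.holds_eq, eval_add, eval_succ, Tm.eval_var, Env.cons_z, Env.cons_s] at h ⊢
    rw [add_succ, h, add_succ]

theorem add_comm (a b : M.Dom Ty.nat) : a + b = b + a := by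
  refine holds_induction (add v1 v0 ≐ add v0 v1) (by simp [Fm.IsQF]) (Env.nil.cons a) ?_
    (fun n h => ?_) b
  · simp [add_zero, zero_add]
  · simp only [Fm.holds_eq, eval_add, Tm.eval_var, Env.cons_z, Env.cons_s] at h ⊢
    rw [add_succ, h, succ_add]

theorem zero_mul (a : M.Dom Ty.nat) : 0 * a = 0 := by
  refine holds_induction (mul zero v0 ≐ zero) (by simp [Fm.IsQF]) Env.nil ?_ (fun n h => ?_) a
  · simp [mul_zero]
  · simp only [Fm.holds_eq, eval_mul, Tm.eval_var, Env.cons_z, eval_zero] at h ⊢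
    rw [mul_succ, h, add_zero]

theorem succ_mul (a b : M.Dom Ty.nat) : (a + 1) * b = a * b + b := by
  refine holds_induction (mul (succ v1) v0 ≐ add (mul v1 v0) v0) (by simp [Fm.IsQF]) (Env.nil.cons a) ?_
    (fun n h => ?_) b
  · simp [add_zero, mul_zero]
  · simp only [Fm.holds_eq, eval_add, eval_succ, eval_mul, Tm.eval_var, Env.cons_z,
      Env.cons_s] at h ⊢
    rw [mul_succ, h, mul_succ, add_succ, add_succ, add_assoc (a * n) n a, add_comm n a,
      ← add_assoc]

theorem mul_comm (a b : M.Dom Ty.nat) : a * b = b * a := by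
  refine holds_induction (mul v1 v0 ≐ mul v0 v1) (by simp [Fm.IsQF]) (Env.nil.cons a) ?_
    (fun n h => ?_) b
  · simp [mul_zero, zero_mul]
  · simp only [Fm.holds_eq, eval_mul, Tm.eval_var, Env.cons_z, Env.cons_s] at h ⊢
    rw [mul_succ, h, succ_mul]

theorem mul_add (a b c : M.Dom Ty.nat) : a * (b + c) = a * b + a * c := by
  refine holds_induction (mul v1 (add v2 v0) ≐ add (mul v1 v2) (mul v1 v0)) (by simp [Fm.IsQF])
    ((Env.nil.cons b).cons a) ?_ (fun n h => ?_) c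
  · simp [add_zero, mul_zero]
  · simp only [Fm.holds_eq, eval_add, eval_mul, Tm.eval_var, Env.cons_z, Env.cons_s] at h ⊢
    rw [add_succ, mul_succ, mul_succ, h, add_assoc]

theorem mul_assoc (a b c : M.Dom Ty.nat) : a * b * c = a * (b * c) := by
  refine holds_induction (mul (mul v1 v2) v0 ≐ mul v1 (mul v2 v0)) (by simp [Fm.IsQF])
    ((Env.nil.cons b).cons a) ?_ (fun n h => ?_) c
  · simp [mul_zero]
  · simp only [Fm.holds_eq, eval_mul, Tm.eval_var, Env.cons_z, Env.cons_s] at h ⊢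
    rw [mul_succ, mul_succ, h, mul_add]

theorem mul_one (a : M.Dom Ty.nat) : a * 1 = a := by
  rw [one_eq, mul_succ, mul_zero, zero_add]

instance : CommSemiring (M.Dom Ty.nat) where
  add_assoc := add_assoc
  zero_add := zero_add
  add_zero := add_zero
  add_comm := add_comm
  mul_assoc := mul_assoc
  one_mul a := by rw [mul_comm, mul_one]
  mul_one := mul_one
  mul_comm := mul_comm
  left_distrib := mul_add
  right_distrib a b c := by rw [mul_comm, mul_add, mul_comm c a, mul_comm c b]
  zero_mul := zero_mul
  mul_zero := mul_zero
  nsmul := nsmulRec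

end Num

end Semiring

/-! ### Definability

Functions between domains that are given by objects of the model. The class of these functions is
closed under explicit definition, primitive recursion and, thanks to `∃²`, numerical quantification.
Instance search finds the definability of a given expression. -/

section Definability

variable {M : Model.{u}}

/-- A product of domains of `M`, with the class of functions on it that are given by objects of
the model. Products are nested to the left and begin with `PUnit`, the empty product: they play the
role of contexts, and definability is always stated with reference to such a product. -/
class Cx (M : Model.{u}) (X : Type u) where
  /-- The class of functions. -/
  D : ∀ {τ : Ty}, (X → M.Dom τ) → Prop
  const : ∀ {τ : Ty} (d : M.Dom τ), D fun _ => d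
  app : ∀ {σ τ : Ty} {F : X → M.Dom (σ ⇒ τ)} {G : X → M.Dom σ}, D F → D G →
    D fun x => M.app (F x) (G x)

/-- `F` is given by an object of the model. -/
class Def {X : Type u} [Cx M X] {τ : Ty} (F : X → M.Dom τ) : Prop where
  out : Cx.D F

open Classical in
/-- The truth value of `p`; the number `0` stands for truth. -/
noncomputable def chi (M : Model.{u}) (p : Prop) : M.Dom Ty.nat := if p then 0 else 1

/-- `P` has a characteristic function in the model. -/
class DefP (M : Model.{u}) {X : Type u} [Cx M X] (P : X → Prop) : Prop where
  out : Def fun x => chi M (P x)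

section

variable {X : Type u} [Cx M X]

instance def_const {τ : Ty} (d : M.Dom τ) : Def fun _ : X => d := ⟨Cx.const d⟩

instance def_app {σ τ : Ty} (F : X → M.Dom (σ ⇒ τ)) (G : X → M.Dom σ) [hF : Def F] [hG : Def G] :
    Def fun x => M.app (F x) (G x) := ⟨Cx.app hF.out hG.out⟩

instance defP_const (p : Prop) : DefP M fun _ : X => p := ⟨inferInstance⟩

instance def_chi (P : X → Prop) [h : DefP M P] : Def fun x => chi M (P x) := h.out

/-- Terms with definable values of their variables are definable. -/
theorem def_eval {Γ : Ctx} (ρ : X → Env M Γ)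
    (hρ : ∀ σ (v : Var Γ σ), Def fun x => ρ x v) {σ : Ty} (t : Tm Γ σ) :
    Def fun x => t.eval M (ρ x) := by
  induction t with
  | var v => exact hρ _ v
  | con c => exact def_const _
  | app f a hf ha => exact def_app _ _

end

variable [IsACA M]

instance def_add {X : Type u} [Cx M X] (a b : X → M.Dom Ty.nat) [Def a] [Def b] :
    Def fun x => a x + b x :=
  inferInstanceAs (Def fun x => M.app (M.app (M.con .add) (a x)) (b x))

instance def_mul {X : Type u} [Cx M X] (a b : X → M.Dom Ty.nat) [Def a] [Def b] :
    Def fun x => a x * b x :=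
  inferInstanceAs (Def fun x => M.app (M.app (M.con .mul) (a x)) (b x))

instance : Cx M PUnit where
  D _ := True
  const _ := trivial
  app _ _ := trivial

/-- A function of `(x, d)` is definable if it is obtained by application to `d` from
a definable function of `x`. -/
instance (X : Type u) [Cx M X] (σ : Ty) : Cx M (X × M.Dom σ) where
  D {τ} F := ∃ G : X → M.Dom (σ ⇒ τ), Def G ∧ ∀ x d, M.app (G x) d = F (x, d)
  const d := ⟨fun _ => M.app (M.con (.K _ _)) d, inferInstance, by simp⟩
  app := by
    rintro σ τ F G ⟨f, hf, hf'⟩ ⟨g, hg, hg'⟩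
    exact ⟨fun x => M.app (M.app (M.con (.S _ _ _)) (f x)) (g x), inferInstance, by simp [hf', hg']⟩

/-- The domains are nonempty because of the constants. -/
theorem nonempty_dom (M : Model.{u}) : ∀ σ : Ty, Nonempty (M.Dom σ)
  | .nat => ⟨M.con .zero⟩
  | .arr σ τ => let ⟨d⟩ := nonempty_dom M τ; ⟨M.app (M.con (.K τ σ)) d⟩

instance (M : Model.{u}) (σ : Ty) : Nonempty (M.Dom σ) := nonempty_dom M σ

section

variable {X : Type u} [Cx M X]

theorem def_comp_fst {σ τ : Ty} (F : X → M.Dom τ) [Def F] : Def fun p : X × M.Dom σ => F p.1 :=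
  ⟨fun x => M.app (M.con (.K _ _)) (F x), inferInstance, by simp⟩

instance def_snd {σ : Ty} : Def fun p : X × M.Dom σ => p.2 :=
  ⟨fun _ => M.app (M.app (M.con (.S _ _ _)) (M.con (.K _ _))) (M.con (.K σ σ)), inferInstance,
    by simp⟩

instance def_fst_snd {σ τ : Ty} : Def fun p : (X × M.Dom σ) × M.Dom τ => p.1.2 :=
  def_comp_fst fun x : X × M.Dom σ => x.2

instance def_fst_fst_snd {ρ σ τ : Ty} :
    Def fun p : ((X × M.Dom ρ) × M.Dom σ) × M.Dom τ => p.1.1.2 :=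
  def_comp_fst fun p : (X × M.Dom ρ) × M.Dom σ => p.1.2

instance def_fst_fst_fst_snd {ρ σ τ υ : Ty} :
    Def fun p : (((X × M.Dom υ) × M.Dom ρ) × M.Dom σ) × M.Dom τ => p.1.1.1.2 :=
  def_comp_fst fun p : ((X × M.Dom υ) × M.Dom ρ) × M.Dom σ => p.1.1.2

theorem Def.exists_app {σ τ : Ty} {F : M.Dom σ → M.Dom τ}
    (h : Def fun p : PUnit.{u+1} × M.Dom σ => F p.2) : ∃ g, ∀ d, M.app g d = F d :=
  let ⟨G, _, hG⟩ := h.out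
  ⟨G ⟨⟩, hG ⟨⟩⟩

/-- Parameters of a definable function can be fixed. -/
theorem Def.section {σ τ : Ty} {F : X → M.Dom σ → M.Dom τ}
    (h : Def fun p : X × M.Dom σ => F p.1 p.2) (x : X) :
    Def fun p : PUnit.{u+1} × M.Dom σ => F x p.2 := by
  obtain ⟨G, -, hG⟩ := h.out
  exact ⟨fun _ => G x, inferInstance, fun _ => hG x⟩

theorem Def.comp {σ τ : Ty} {F : M.Dom σ → M.Dom τ}
    (hF : Def fun p : PUnit.{u+1} × M.Dom σ => F p.2)
    (G : X → M.Dom σ) [Def G] : Def fun x => F (G x) := by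
  obtain ⟨g, hg⟩ := hF.exists_app
  simp only [← hg]
  infer_instance

theorem DefP.section {σ : Ty} {P : X → M.Dom σ → Prop}
    (h : DefP M fun p : X × M.Dom σ => P p.1 p.2) (x : X) :
    DefP M fun p : PUnit.{u+1} × M.Dom σ => P x p.2 :=
  ⟨Def.section (F := fun x d => chi M (P x d)) h.out x⟩

theorem DefP.comp {σ : Ty} {P : M.Dom σ → Prop}
    (hP : DefP M fun p : PUnit.{u+1} × M.Dom σ => P p.2)
    (G : X → M.Dom σ) [Def G] : DefP M fun x => P (G x) :=
  ⟨Def.comp (F := fun d => chi M (P d)) hP.out G⟩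

end

/-- The object of the model that represents `F`, if there is one. -/
noncomputable def mlam {σ τ : Ty} (F : M.Dom σ → M.Dom τ) : M.Dom (σ ⇒ τ) :=
  Classical.epsilon fun g => ∀ d, M.app g d = F d

@[simp] theorem app_mlam {σ τ : Ty} (F : M.Dom σ → M.Dom τ)
    [hF : Def fun p : PUnit.{u+1} × M.Dom σ => F p.2] (d : M.Dom σ) : M.app (mlam F) d = F d :=
  Classical.epsilon_spec (p := fun g => ∀ d, M.app g d = F d) hF.exists_app d

theorem eq_mlam {σ τ : Ty} {F : M.Dom σ → M.Dom τ} {g : M.Dom (σ ⇒ τ)} (h : ∀ d, M.app g d = F d) :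
    g = mlam F :=
  app_ext fun d => by
    rw [h, mlam, Classical.epsilon_spec (p := fun g => ∀ d, M.app g d = F d) ⟨g, h⟩ d]

instance def_mlam {X : Type u} [Cx M X] {σ τ : Ty} (F : X → M.Dom σ → M.Dom τ)
    [h : Def fun p : X × M.Dom σ => F p.1 p.2] : Def fun x => mlam (F x) := by
  obtain ⟨G, hG, hG'⟩ := h.out
  convert hG using 2 with x
  exact (eq_mlam (hG' x)).symm

/-! ### Primitive recursion -/

/-- The function given by `b` at `0` and by `s n r` at `n + 1`, where `r` is the value at `n`. -/
noncomputable def mrec (b : M.Dom Ty.nat) (s : M.Dom Ty.nat → M.Dom Ty.nat → M.Dom Ty.nat)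
    (n : M.Dom Ty.nat) : M.Dom Ty.nat :=
  M.app (M.app (M.app (M.con .R) (mlam fun k => mlam fun r => s k r)) b) n

@[simp] theorem mrec_zero (b : M.Dom Ty.nat) (s : M.Dom Ty.nat → M.Dom Ty.nat → M.Dom Ty.nat) :
    mrec b s 0 = b :=
  holds_of_RCA .R_zero ((Env.nil.cons b).cons _)

theorem mrec_succ (b : M.Dom Ty.nat) (s : M.Dom Ty.nat → M.Dom Ty.nat → M.Dom Ty.nat)
    [hs : Def fun p : (PUnit.{u+1} × M.Dom Ty.nat) × M.Dom Ty.nat => s p.1.2 p.2] (n : M.Dom Ty.nat) :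
    mrec b s (n + 1) = s n (mrec b s n) := by
  refine (holds_of_RCA .R_succ
    (((Env.nil.cons n).cons b).cons (mlam fun k => mlam fun r => s k r))).trans ?_
  have := Def.section (F := fun (q : PUnit.{u+1} × M.Dom Ty.nat) r => s q.2 r) hs (⟨⟩, n)
  simp only [Tm.eval_app, Tm.eval_var, Env.cons_z, Env.cons_s, app_mlam]
  rfl

instance def_mrec {X : Type u} [Cx M X] (b n : X → M.Dom Ty.nat)
    (s : X → M.Dom Ty.nat → M.Dom Ty.nat → M.Dom Ty.nat) [Def b]
    [Def fun p : (X × M.Dom Ty.nat) × M.Dom Ty.nat => s p.1.1 p.1.2 p.2] [Def n] :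
    Def fun x => mrec (b x) (s x) (n x) := by
  unfold mrec
  infer_instance

@[simp] theorem eval_natRec {Γ : Ctx} (ρ : Env M Γ) (step : Tm (Ty.nat :: Ty.nat :: Γ) Ty.nat)
    (b n : Tm Γ Ty.nat) :
    (natRec step b n).eval M ρ =
      mrec (b.eval M ρ) (fun k r => step.eval M ((ρ.cons k).cons r)) (n.eval M ρ) := by
  simp only [natRec, mrec, Tm.eval_app, Tm.eval_con]
  congr 3
  refine eq_mlam fun k => eq_mlam fun r => ?_
  simp

theorem eq_zero_or_succ (n : M.Dom Ty.nat) : n = 0 ∨ ∃ m, n = m + 1 := by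
  have h := holds_induction (v0 ≐ zero ⩔ v0 ≐ succ (pred v0)) (by simp [Fm.IsQF])
    (Env.nil (M := M)) (by simp) (fun n _ => by simp [pred, mrec_succ]) n
  exact h.imp id fun h => ⟨_, h⟩

/-- The predecessor of `n`, and `0` if `n` is `0`. -/
noncomputable def mpred (n : M.Dom Ty.nat) : M.Dom Ty.nat := mrec 0 (fun k _ => k) n

@[simp] theorem mpred_zero : mpred (0 : M.Dom Ty.nat) = 0 := mrec_zero _ _
@[simp] theorem mpred_succ (n : M.Dom Ty.nat) : mpred (n + 1) = n := mrec_succ _ _ n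
instance def_mpred {X : Type u} [Cx M X] (n : X → M.Dom Ty.nat) [Def n] :
    Def fun x => mpred (n x) := by unfold mpred; infer_instance
@[simp] theorem eval_pred {Γ : Ctx} (ρ : Env M Γ) (t : Tm Γ Ty.nat) :
    (pred t).eval M ρ = mpred (t.eval M ρ) := by simp [pred, mpred]

/-- Truncated subtraction in the model. -/
noncomputable def msub (m n : M.Dom Ty.nat) : M.Dom Ty.nat := mrec m (fun _ r => mpred r) n

@[simp] theorem msub_zero (m : M.Dom Ty.nat) : msub m 0 = m := mrec_zero _ _
theorem msub_succ (m n : M.Dom Ty.nat) : msub m (n + 1) = mpred (msub m n) := mrec_succ _ _ n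
instance def_msub {X : Type u} [Cx M X] (m n : X → M.Dom Ty.nat) [Def m] [Def n] :
    Def fun x => msub (m x) (n x) := by unfold msub; infer_instance
@[simp] theorem eval_sub {Γ : Ctx} (ρ : Env M Γ) (s t : Tm Γ Ty.nat) :
    (sub s t).eval M ρ = msub (s.eval M ρ) (t.eval M ρ) := by simp [sub, msub]

/-- `a` if `c = 0`, and `b` otherwise. -/
noncomputable def mifz (c a b : M.Dom Ty.nat) : M.Dom Ty.nat := mrec a (fun _ _ => b) c

theorem mifz_zero (a b : M.Dom Ty.nat) : mifz 0 a b = a := mrec_zero _ _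
theorem mifz_succ (c a b : M.Dom Ty.nat) : mifz (c + 1) a b = b := mrec_succ _ _ c
theorem mifz_of_ne {c : M.Dom Ty.nat} (h : c ≠ 0) (a b : M.Dom Ty.nat) : mifz c a b = b := by
  obtain rfl | ⟨m, rfl⟩ := eq_zero_or_succ c
  · exact absurd rfl h
  · exact mifz_succ _ _ _
open Classical in
theorem mifz_eq (c a b : M.Dom Ty.nat) : mifz c a b = if c = 0 then a else b := by
  split_ifs with h
  · rw [h, mifz_zero]
  · exact mifz_of_ne h a b
instance def_mifz {X : Type u} [Cx M X] (c a b : X → M.Dom Ty.nat) [Def c] [Def a] [Def b] :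
    Def fun x => mifz (c x) (a x) (b x) := by
  have h1 : Def fun p : X × M.Dom Ty.nat => b p.1 := def_comp_fst b
  have h2 : Def fun p : (X × M.Dom Ty.nat) × M.Dom Ty.nat => b p.1.1 :=
    def_comp_fst fun p : X × M.Dom Ty.nat => b p.1
  unfold mifz
  infer_instance
@[simp] theorem eval_ifZero {Γ : Ctx} (ρ : Env M Γ) (c a b : Tm Γ Ty.nat) :
    (ifZero c a b).eval M ρ = mifz (c.eval M ρ) (a.eval M ρ) (b.eval M ρ) := by
  simp [ifZero, mifz]

/-! ### Definable properties -/

theorem num_zero_ne_one : (0 : M.Dom Ty.nat) ≠ 1 := by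
  rw [Num.one_eq]; exact (Num.succ_ne_zero 0).symm

@[simp] theorem chi_eq_zero {p : Prop} : chi M p = 0 ↔ p := by
  unfold chi
  split_ifs with h
  · simp [h]
  · simp [h, num_zero_ne_one.symm]

section

variable {X : Type u} [Cx M X]

theorem defP_of_eq_zero {P : X → Prop} (F : X → M.Dom Ty.nat) [Def F]
    (h : ∀ x, F x = 0 ↔ P x) : DefP M P := by
  have e : (fun x => chi M (P x)) = fun x => mifz (F x) 0 1 := by
    funext x
    by_cases hx : P x
    · rw [(h x).2 hx, mifz_zero, chi, if_pos hx]
    · rw [mifz_of_ne fun h' => hx ((h x).1 h'), chi, if_neg hx]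
  refine ⟨?_⟩
  rw [e]
  infer_instance

instance defP_and (P Q : X → Prop) [DefP M P] [DefP M Q] : DefP M fun x => P x ∧ Q x := by
  refine defP_of_eq_zero (fun x => mifz (chi M (P x)) (chi M (Q x)) 1) fun x => ?_
  by_cases hx : P x <;> simp [hx, mifz_eq, num_zero_ne_one.symm]

instance defP_or (P Q : X → Prop) [DefP M P] [DefP M Q] : DefP M fun x => P x ∨ Q x := by
  refine defP_of_eq_zero (fun x => mifz (chi M (P x)) 0 (chi M (Q x))) fun x => ?_
  by_cases hx : P x <;> simp [hx, mifz_eq]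

instance defP_imp (P Q : X → Prop) [DefP M P] [DefP M Q] : DefP M fun x => P x → Q x := by
  refine defP_of_eq_zero (fun x => mifz (chi M (P x)) (chi M (Q x)) 0) fun x => ?_
  by_cases hx : P x <;> simp [hx, mifz_eq]

/-- Numerical quantification, by Kleene's functional. -/
instance defP_ex (P : X → M.Dom Ty.nat → Prop)
    [h : DefP M fun p : X × M.Dom Ty.nat => P p.1 p.2] : DefP M fun x => ∃ n, P x n := by
  obtain ⟨φ, -, hφ⟩ := IsACA.sat (M := M) _ _ .existsTwo Env.nil
  refine defP_of_eq_zero (fun x => M.app φ (mlam fun n => chi M (P x n))) fun x => ?_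
  have := h.section x
  have := (Fm.holds_iff _ _ _).1 (hφ (mlam fun n => chi M (P x n)))
  simp at this
  exact this.symm

instance defP_all (P : X → M.Dom Ty.nat → Prop)
    [h : DefP M fun p : X × M.Dom Ty.nat => P p.1 p.2] : DefP M fun x => ∀ n, P x n := by
  have : DefP M fun x => ¬ ∃ n, ¬ P x n := inferInstance
  simpa using this

instance def_ite (P : X → Prop) [∀ x, Decidable (P x)] (F G : X → M.Dom Ty.nat) [DefP M P] [Def F]
    [Def G] : Def fun x => if P x then F x else G x := by
  have : Def fun x => mifz (chi M (P x)) (F x) (G x) := inferInstance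
  convert this using 2 with x
  by_cases hx : P x <;> simp [hx, mifz_eq]

end

theorem induction_defP (P : M.Dom Ty.nat → Prop)
    [DefP M fun p : PUnit.{u+1} × M.Dom Ty.nat => P p.2] (h0 : P 0)
    (hs : ∀ n, P n → P (n + 1)) (n : M.Dom Ty.nat) : P n := by
  have := holds_induction (v1 ⋄ v0 ≐ zero) (by simp [Fm.IsQF])
    (Env.nil.cons (mlam fun n => chi M (P n)))
  simp only [Fm.holds_eq, Tm.eval_app, Tm.eval_var, Env.cons_z, Env.cons_s, eval_zero,
    app_mlam, chi_eq_zero] at this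
  exact this h0 hs n

end Definability

/-! ### The order of the numbers -/

section Order

variable {M : Model.{u}} [IsACA M]

namespace Num

/-- The truth value of `a < b` is computed by truncated subtraction. This is proved by induction for a
quantifier-free formula, since it is needed for the definability of `<`; successors serve to
distinguish `a < b` from `a = b`. -/
theorem lt_or_msub (a b : M.Dom Ty.nat) :
    (a < b ∧ msub (a + 1) b = 0) ∨ (¬ a < b ∧ msub (a + 1) b + b = a + 1) := by
  have := holds_induction ((v1 ≺ v0 ⩓ sub (succ v1) v0 ≐ zero) ⩔
    (Fm.not (v1 ≺ v0) ⩓ add (sub (succ v1) v0) v0 ≐ succ v1)) (by simp [Fm.IsQF, Fm.not])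
    (Env.nil.cons a) (by simp [not_lt_zero]) (fun n => ?_) b
  · simpa using this
  · simp only [Fm.holds_or, Fm.holds_and, Fm.holds_not, Fm.holds_lt, Fm.holds_eq, eval_sub,
      eval_succ, eval_add, eval_zero, Tm.eval_var, Env.cons_z, Env.cons_s, lt_succ, msub_succ]
    rintro (⟨h, h'⟩ | ⟨h, h'⟩)
    · exact .inl ⟨.inl h, by rw [h', mpred_zero]⟩
    · obtain h0 | ⟨c, hc⟩ := eq_zero_or_succ (msub (a + 1) n)
      · rw [h0, zero_add] at h'
        exact absurd (h' ▸ lt_succ.2 (.inr rfl)) h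
      · rw [hc, mpred_succ]
        rw [hc, succ_add] at h'
        by_cases h2 : a = n
        · refine .inl ⟨.inr h2, ?_⟩
          obtain rfl | ⟨d, rfl⟩ := eq_zero_or_succ c
          · rfl
          · exfalso
            rw [h2, succ_add] at h'
            have key : ∀ m : M.Dom Ty.nat, d + m + 1 ≠ m := fun m =>
              holds_induction (Fm.not (succ (add v1 v0) ≐ v0)) (by simp [Fm.IsQF, Fm.not])
                (Env.nil.cons d) (by simpa using succ_ne_zero d)
                (fun n hn h => hn (by
                  simp only [Fm.holds_eq, eval_succ, eval_add, Tm.eval_var, Env.cons_z,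
                    Env.cons_s] at h ⊢
                  rw [add_succ] at h
                  exact succ_inj h)) m
            exact key n (succ_inj h')
        · refine .inr ⟨by tauto, ?_⟩
          rw [add_succ]; exact h'

theorem lt_iff_msub (a b : M.Dom Ty.nat) : msub (a + 1) b = 0 ↔ a < b := by
  rcases lt_or_msub a b with ⟨h, h'⟩ | ⟨h, h'⟩
  · exact iff_of_true h' h
  · refine iff_of_false (fun h0 => h ?_) h
    rw [h0, zero_add] at h'
    exact h' ▸ lt_succ.2 (.inr rfl)

instance _root_.HigherOrderArith.defP_lt {X : Type u} [Cx M X] (a b : X → M.Dom Ty.nat)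
    [Def a] [Def b] : DefP M fun x => a x < b x :=
  defP_of_eq_zero (fun x => msub (a x + 1) (b x)) fun _ => lt_iff_msub _ _

theorem succ_lt_or_eq {a b : M.Dom Ty.nat} (h : a < b) : a + 1 < b ∨ a + 1 = b := by
  rw [← lt_succ]
  revert h
  refine induction_defP (fun b => a < b → a + 1 < b + 1) (fun h => ?_)
    (fun n hn h => ?_) b
  · exact absurd h (not_lt_zero _)
  · rcases lt_succ.1 h with h | rfl
    · exact lt_succ.2 (.inl (hn h))
    · exact lt_succ.2 (.inr rfl)

theorem zero_lt_succ (b : M.Dom Ty.nat) : 0 < b + 1 :=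
  induction_defP (fun b => 0 < b + 1) (lt_succ.2 (.inr rfl))
    (fun _ h => lt_succ.2 (.inl h)) b

theorem trichotomy (a b : M.Dom Ty.nat) : a < b ∨ a = b ∨ b < a := by
  have : a < b + 1 ∨ b < a := by
    refine induction_defP (fun a => a < b + 1 ∨ b < a) (.inl (zero_lt_succ b))
      (fun n => ?_) a
    rintro (h | h)
    · rcases lt_succ.1 h with h | rfl
      · exact .inl (lt_succ.2 (succ_lt_or_eq h))
      · exact .inr (lt_succ.2 (.inr rfl))
    · exact .inr (lt_succ.2 (.inl h))
  rw [lt_succ] at this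
  tauto

theorem lt_trans {a b c : M.Dom Ty.nat} (h : a < b) (h' : b < c) : a < c := by
  revert h'
  refine induction_defP (fun c => b < c → a < c) (fun h => ?_) (fun n hn h' => ?_) c
  · exact absurd h (not_lt_zero _)
  · rcases lt_succ.1 h' with h' | rfl
    · exact lt_succ.2 (.inl (hn h'))
    · exact lt_succ.2 (.inl h)

theorem lt_irrefl (a : M.Dom Ty.nat) : ¬ a < a := by
  refine induction_defP (fun a => ¬ a < a) (not_lt_zero _) (fun n hn h => ?_) a
  rcases lt_succ.1 h with h | h
  · exact hn (lt_trans (lt_succ.2 (.inr rfl)) h)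
  · exact hn (by nth_rw 2 [← h]; exact lt_succ.2 (.inr rfl))

instance : LE (M.Dom Ty.nat) := ⟨fun a b => a < b ∨ a = b⟩

noncomputable instance : LinearOrder (M.Dom Ty.nat) where
  le_refl a := .inr rfl
  le_trans a b c := by
    rintro (h | rfl) (h' | rfl)
    · exact .inl (lt_trans h h')
    · exact .inl h
    · exact .inl h'
    · exact .inr rfl
  lt_iff_le_not_ge a b := by
    refine ⟨fun h => ⟨.inl h, ?_⟩, ?_⟩
    · rintro (h' | rfl)
      · exact lt_irrefl _ (lt_trans h h')
      · exact lt_irrefl _ h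
    · rintro ⟨h | rfl, h'⟩
      · exact h
      · exact absurd (.inr rfl) h'
  le_antisymm a b := by
    rintro (h | rfl) (h' | h')
    · exact absurd (lt_trans h h') (lt_irrefl _)
    · exact h'.symm
    · rfl
    · rfl
  le_total a b := by
    rcases trichotomy a b with h | h | h
    · exact .inl (.inl h)
    · exact .inl (.inr h)
    · exact .inr (.inl h)
  toDecidableLE := Classical.decRel _

theorem lt_succ_iff {a b : M.Dom Ty.nat} : a < b + 1 ↔ a ≤ b := lt_succ

theorem succ_le_of_lt {a b : M.Dom Ty.nat} (h : a < b) : a + 1 ≤ b :=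
  (succ_lt_or_eq h).elim le_of_lt le_of_eq

theorem add_lt_add_right {a b : M.Dom Ty.nat} (h : a < b) (c : M.Dom Ty.nat) : a + c < b + c := by
  refine induction_defP (fun c => a + c < b + c) ?_ (fun n hn => ?_) c
  · simpa only [add_zero] using h
  · rw [add_succ, add_succ]
    exact lt_succ.2 (succ_lt_or_eq hn)

theorem exists_add_of_le {a b : M.Dom Ty.nat} (h : a ≤ b) : ∃ c, b = a + c := by
  rcases lt_or_msub b a with ⟨h', -⟩ | ⟨-, h'⟩
  · exact absurd h h'.not_ge
  · obtain h0 | ⟨c, hc⟩ := eq_zero_or_succ (msub (b + 1) a)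
    · rw [h0, zero_add] at h'
      exact absurd h (by rw [h']; exact (lt_succ.2 (.inr rfl)).not_ge)
    · rw [hc, succ_add] at h'
      exact ⟨c, by rw [add_comm]; exact (succ_inj h').symm⟩

theorem zero_le (a : M.Dom Ty.nat) : 0 ≤ a := not_lt.1 (not_lt_zero a)

theorem mul_pos {a b : M.Dom Ty.nat} (ha : 0 < a) (hb : 0 < b) : 0 < a * b := by
  obtain rfl | ⟨c, rfl⟩ := eq_zero_or_succ a
  · exact absurd ha (lt_irrefl _)
  obtain rfl | ⟨d, rfl⟩ := eq_zero_or_succ b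
  · exact absurd hb (lt_irrefl _)
  rw [mul_succ, add_succ]
  exact zero_lt_succ _

theorem mul_lt_mul_left {a b c : M.Dom Ty.nat} (h : a < b) (hc : 0 < c) : c * a < c * b := by
  obtain ⟨d, rfl⟩ := exists_add_of_le h.le
  have hd : 0 < d := (zero_le d).lt_of_ne fun h0 => lt_irrefl a (by simp [← h0] at h)
  have := add_lt_add_right (mul_pos hc hd) (c * a)
  rwa [zero_add, add_comm, ← mul_add] at this

instance : IsStrictOrderedRing (M.Dom Ty.nat) where
  add_le_add_left a b h c := by
    rcases h.lt_or_eq with h | rfl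
    · exact (add_lt_add_right h c).le
    · exact le_rfl
  le_of_add_le_add_left a b c h := by
    by_contra! h'
    have := add_lt_add_right h' a
    rw [add_comm c, add_comm b] at this
    exact this.not_ge h
  zero_le_one := zero_le 1
  exists_pair_ne := ⟨0, 1, num_zero_ne_one⟩
  mul_lt_mul_of_pos_left a ha b c h := mul_lt_mul_left h ha
  mul_lt_mul_of_pos_right a ha b c h := by
    rw [mul_comm b, mul_comm c]; exact mul_lt_mul_left h ha

instance : CanonicallyOrderedAdd (M.Dom Ty.nat) where
  exists_add_of_le := exists_add_of_le
  le_self_add a b := by simpa using zero_le b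
  le_add_self a b := by simpa using zero_le b

end Num

instance defP_le {X : Type u} [Cx M X] (a b : X → M.Dom Ty.nat) [Def a] [Def b] :
    DefP M fun x => a x ≤ b x := by
  simp only [← Num.lt_succ_iff]
  infer_instance

instance defP_eq {X : Type u} [Cx M X] (a b : X → M.Dom Ty.nat) [Def a] [Def b] :
    DefP M fun x => a x = b x := by
  simp only [le_antisymm_iff]
  infer_instance

@[simp] theorem holds_le {Γ : Ctx} (ρ : Env M Γ) (s t : Tm Γ Ty.nat) :
    (le s t).Holds M ρ ↔ s.eval M ρ ≤ t.eval M ρ := Num.lt_succ_iff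

theorem msub_eq_zero_or (a b : M.Dom Ty.nat) :
    (a ≤ b ∧ msub a b = 0) ∨ (b ≤ a ∧ msub a b + b = a) := by
  refine induction_defP
    (fun b => (a ≤ b ∧ msub a b = 0) ∨ (b ≤ a ∧ msub a b + b = a)) ?_ ?_ b
  · exact .inr ⟨Num.zero_le _, by simp⟩
  · intro n h
    rw [msub_succ]
    rcases h with ⟨h, h'⟩ | ⟨h, h'⟩
    · exact .inl ⟨h.trans le_self_add, by rw [h', mpred_zero]⟩
    · obtain h0 | ⟨c, hc⟩ := eq_zero_or_succ (msub a n)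
      · rw [h0, zero_add] at h'
        exact .inl ⟨h' ▸ le_self_add, by rw [h0, mpred_zero]⟩
      · rw [hc] at h'
        rw [hc, mpred_succ]
        have : c + (n + 1) = a := by rw [← h']; ring
        exact .inr ⟨this ▸ le_add_self, this⟩

@[simp] theorem msub_eq_zero {a b : M.Dom Ty.nat} : msub a b = 0 ↔ a ≤ b := by
  rcases msub_eq_zero_or a b with ⟨h, h'⟩ | ⟨h, h'⟩
  · exact iff_of_true h' h
  · refine ⟨fun h0 => ?_, fun h0 => ?_⟩
    · rw [h0, zero_add] at h'; exact h'.ge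
    · rw [le_antisymm h h0, add_eq_right] at h'; rw [le_antisymm h h0, h']

theorem msub_add_cancel {a b : M.Dom Ty.nat} (h : b ≤ a) : msub a b + b = a := by
  rcases msub_eq_zero_or a b with ⟨h1, h'⟩ | ⟨-, h'⟩
  · rw [h', zero_add]; exact le_antisymm h h1
  · exact h'

@[simp] theorem msub_add_self (a b : M.Dom Ty.nat) : msub (a + b) b = a :=
  add_right_cancel (msub_add_cancel le_add_self)

/-- Least number principle. -/
theorem exists_least (P : M.Dom Ty.nat → Prop)
    [hP : DefP M fun p : PUnit.{u+1} × M.Dom Ty.nat => P p.2] (h : ∃ n, P n) :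
    ∃ n, P n ∧ ∀ m, m < n → ¬ P m := by
  by_contra! H
  have : ∀ n m, m < n → ¬ P m := by
    have := hP.comp fun p : (PUnit.{u+1} × M.Dom Ty.nat) × M.Dom Ty.nat => p.2
    refine induction_defP (fun n => ∀ m, m < n → ¬ P m) ?_ ?_
    · intro m hm
      exact absurd hm (Num.not_lt_zero m)
    · intro n hn m hm hPm
      rcases Num.lt_succ.1 hm with hm | rfl
      · exact hn m hm hPm
      · obtain ⟨k, hk, hk'⟩ := H m hPm
        exact hn k hk hk'
  obtain ⟨n, hn⟩ := h
  exact this (n + 1) n (Num.lt_succ.2 (.inr rfl)) hn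

end Order

/-! ### The ordered field of fractions of an ordered semiring -/

section DiffRing

open Algebra

variable (N : Type u) [CommSemiring N]

/-- The ring of differences of elements of a cancellative semiring. -/
def DiffRing : Type u := GrothendieckAddGroup N

namespace DiffRing

noncomputable instance : AddCommGroup (DiffRing N) :=
  inferInstanceAs (AddCommGroup (GrothendieckAddGroup N))

variable {N}

/-- The inclusion of the semiring. -/
noncomputable def of : N →+ DiffRing N := GrothendieckAddGroup.of

theorem exists_of_sub_of (x : DiffRing N) : ∃ a b : N, x = of a - of b := by
  induction x using AddLocalization.ind with | _ p
  refine ⟨p.1, p.2, ?_⟩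
  have h (a : N) : (GrothendieckAddGroup.of a : GrothendieckAddGroup N) = AddLocalization.mk a 0 :=
    (AddLocalization.mk_zero_eq_addMonoidOf_mk a).symm
  change (AddLocalization.mk p.1 p.2 : GrothendieckAddGroup N) =
    GrothendieckAddGroup.of p.1 - GrothendieckAddGroup.of (p.2 : N)
  rw [h, h, GrothendieckAddGroup.mk_sub_mk]
  congr 1
  · simp
  · ext; simp

/-- The extension of an additive map to the differences. -/
noncomputable def lift {G : Type u} [AddCommGroup G] (f : N →+ G) : DiffRing N →+ G :=
  GrothendieckAddGroup.lift f

@[simp] theorem lift_of {G : Type u} [AddCommGroup G] (f : N →+ G) (a : N) :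
    lift f (of a) = f a :=
  DFunLike.congr_fun (GrothendieckAddGroup.lift.symm_apply_apply f) a

/-- Multiplication as a biadditive map. -/
noncomputable def mulHom : DiffRing N →+ DiffRing N →+ DiffRing N :=
  have h (f g : N →+ DiffRing N) : lift (f + g) = lift f + lift g := by
    refine DFunLike.ext _ _ fun x => ?_
    obtain ⟨a, b, rfl⟩ := exists_of_sub_of x
    simp only [map_sub, lift_of, AddMonoidHom.add_apply]
  lift ((AddMonoidHom.mk' (fun f : N →+ DiffRing N => lift f) h).comp
    ((AddMonoidHom.compHom of).comp AddMonoidHom.mul))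

noncomputable instance : Mul (DiffRing N) := ⟨fun x y => mulHom x y⟩
noncomputable instance : One (DiffRing N) := ⟨of 1⟩

theorem of_mul (a b : N) : of (a * b) = of a * of b := by
  change _ = mulHom _ _
  simp [mulHom]

theorem of_injective [IsCancelAdd N] : Function.Injective (of (N := N)) :=
  GrothendieckAddGroup.of_injective

variable [LinearOrder N] [IsStrictOrderedRing N] [CanonicallyOrderedAdd N]

omit [IsStrictOrderedRing N] in
/-- Every difference is an element of the semiring up to sign. -/
theorem eq_of_or_neg (x : DiffRing N) : ∃ a : N, x = of a ∨ x = -of a := by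
  obtain ⟨a, b, rfl⟩ := exists_of_sub_of x
  rcases le_total a b with h | h
  · obtain ⟨c, rfl⟩ := exists_add_of_le h
    exact ⟨c, .inr (by simp)⟩
  · obtain ⟨c, rfl⟩ := exists_add_of_le h
    exact ⟨c, .inl (by simp)⟩

noncomputable instance : CommRing (DiffRing N) :=
  have hl (x y z : DiffRing N) : x * (y + z) = x * y + x * z := map_add (mulHom x) y z
  have hc (x y : DiffRing N) : x * y = y * x := by
    obtain ⟨a, b, rfl⟩ := exists_of_sub_of x
    obtain ⟨c, d, rfl⟩ := exists_of_sub_of y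
    change mulHom _ _ = mulHom _ _
    simp only [map_sub, AddMonoidHom.sub_apply]
    change of a * of c - of b * of c - (of a * of d - of b * of d) =
      of c * of a - of d * of a - (of c * of b - of d * of b)
    simp only [← of_mul, mul_comm]
    abel
  { (inferInstance : AddCommGroup (DiffRing N)) with
    left_distrib := hl
    right_distrib x y z := by rw [hc, hl, hc z, hc z]
    zero_mul x := by rw [hc]; exact map_zero (mulHom x)
    mul_zero x := map_zero (mulHom x)
    mul_comm := hc
    one_mul x := by
      obtain ⟨a, b, rfl⟩ := exists_of_sub_of x
      refine (map_sub (mulHom 1) _ _).trans ?_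
      change of 1 * of a - of 1 * of b = _
      rw [← of_mul, ← of_mul, one_mul, one_mul]
    mul_one x := by
      obtain ⟨a, b, rfl⟩ := exists_of_sub_of x
      rw [hc]
      refine (map_sub (mulHom 1) _ _).trans ?_
      change of 1 * of a - of 1 * of b = _
      rw [← of_mul, ← of_mul, one_mul, one_mul]
    mul_assoc x y z := by
      have hn (x y : DiffRing N) : x * -y = -(x * y) := map_neg (mulHom x) y
      have hn' (x y : DiffRing N) : -x * y = -(x * y) := by rw [hc, hn, hc]
      obtain ⟨a, rfl | rfl⟩ := eq_of_or_neg x <;> obtain ⟨b, rfl | rfl⟩ := eq_of_or_neg y <;>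
        obtain ⟨c, rfl | rfl⟩ := eq_of_or_neg z <;>
        simp only [hn, hn', ← of_mul, mul_assoc] }

instance : Nontrivial (DiffRing N) :=
  ⟨0, 1, fun h => zero_ne_one (of_injective (N := N) (by rw [map_zero]; exact h))⟩

instance : NoZeroDivisors (DiffRing N) where
  eq_zero_or_eq_zero_of_mul_eq_zero {x y} h := by
    have key (a b : N) (h : (of a * of b : DiffRing N) = 0) :
        (of a : DiffRing N) = 0 ∨ (of b : DiffRing N) = 0 := by
      rw [← of_mul, ← map_zero (of (N := N))] at h
      rcases mul_eq_zero.1 (of_injective h) with rfl | rfl <;> simp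
    obtain ⟨a, rfl | rfl⟩ := eq_of_or_neg x <;> obtain ⟨b, rfl | rfl⟩ := eq_of_or_neg y <;>
      simpa using key a b (by simpa using h)

instance : IsDomain (DiffRing N) := NoZeroDivisors.to_isDomain _

end DiffRing

variable [LinearOrder N] [IsStrictOrderedRing N] [CanonicallyOrderedAdd N]

/-- The field of fractions of an ordered semiring. -/
def OrdFrac : Type u := FractionRing (DiffRing N)

namespace OrdFrac

noncomputable instance : Field (OrdFrac N) := inferInstanceAs (Field (FractionRing (DiffRing N)))

variable {N}

/-- The inclusion of the ring of differences. -/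
noncomputable def ofDiff : DiffRing N →+* OrdFrac N :=
  algebraMap (DiffRing N) (FractionRing (DiffRing N))

/-- The inclusion of the semiring. -/
noncomputable def of : N →+* OrdFrac N :=
  ofDiff.comp
    { toFun := DiffRing.of
      map_one' := rfl
      map_mul' := DiffRing.of_mul
      map_zero' := map_zero _
      map_add' := map_add _ }

theorem of_injective : Function.Injective (of (N := N)) :=
  (IsFractionRing.injective (DiffRing N) (FractionRing (DiffRing N))).comp DiffRing.of_injective

theorem of_ne_zero {a : N} (h : 0 < a) : (of a : OrdFrac N) ≠ 0 := fun h' =>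
  h.ne' (of_injective (by rw [h', map_zero]))

theorem exists_eq_div (x : OrdFrac N) :
    ∃ a b : N, 0 < b ∧ (x = of a / of b ∨ x = -(of a / of b)) := by
  obtain ⟨p, q, hq, rfl⟩ : ∃ p q : DiffRing N, q ≠ 0 ∧ ofDiff p / ofDiff q = x := by
    obtain ⟨p, q, hq, h⟩ := IsFractionRing.div_surjective (A := DiffRing N)
      (K := FractionRing (DiffRing N)) x
    exact ⟨p, q, nonZeroDivisors.ne_zero hq, h⟩
  obtain ⟨a, ha⟩ := DiffRing.eq_of_or_neg p
  obtain ⟨b, hb⟩ := DiffRing.eq_of_or_neg q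
  have hb0 : 0 < b := pos_iff_ne_zero.2 fun h => hq (by rcases hb with rfl | rfl <;> simp [h])
  refine ⟨a, b, hb0, ?_⟩
  change ofDiff p / ofDiff q = ofDiff (DiffRing.of a) / ofDiff (DiffRing.of b) ∨
    ofDiff p / ofDiff q = -(ofDiff (DiffRing.of a) / ofDiff (DiffRing.of b))
  rcases ha with rfl | rfl <;> rcases hb with rfl | rfl <;> simp [neg_div, div_neg]

/-- The fractions of elements of the semiring, as the cone of nonnegative elements. -/
noncomputable def cone (N : Type u) [CommSemiring N] [LinearOrder N] [IsStrictOrderedRing N]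
    [CanonicallyOrderedAdd N] : RingCone (OrdFrac N) where
  carrier := {x | ∃ a b : N, 0 < b ∧ x = of a / of b}
  mul_mem' := by
    rintro _ _ ⟨a, b, hb, rfl⟩ ⟨c, d, hd, rfl⟩
    exact ⟨a * c, b * d, mul_pos hb hd, by rw [map_mul, map_mul, div_mul_div_comm]⟩
  one_mem' := ⟨1, 1, one_pos, by simp⟩
  add_mem' := by
    rintro _ _ ⟨a, b, hb, rfl⟩ ⟨c, d, hd, rfl⟩
    refine ⟨a * d + b * c, b * d, mul_pos hb hd, ?_⟩
    rw [div_add_div _ _ (of_ne_zero hb) (of_ne_zero hd)]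
    simp
  zero_mem' := ⟨0, 1, one_pos, by simp⟩
  eq_zero_of_mem_of_neg_mem' := by
    rintro x ⟨a, b, hb, rfl⟩ ⟨c, d, hd, h⟩
    have h1 := of_ne_zero hb
    have h2 := of_ne_zero hd
    have h3 : (of (a * d + c * b) : OrdFrac N) = of 0 := by
      rw [← neg_div, div_eq_div_iff h1 h2] at h
      simp only [map_add, map_mul, map_zero]
      linear_combination -h
    have h4 : a * d = 0 := (add_eq_zero.1 (of_injective h3)).1
    rcases mul_eq_zero.1 h4 with rfl | h
    · simp
    · exact absurd h hd.ne'

instance : HasMemOrNegMem (cone N) where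
  mem_or_neg_mem x := by
    obtain ⟨a, b, hb, h | h⟩ := exists_eq_div x
    · exact .inl ⟨a, b, hb, h⟩
    · exact .inr ⟨a, b, hb, by rw [h, neg_neg]⟩

open Classical in
/-- The order with nonnegative cone `cone N`. It is kept apart from the instance below so that
`simp` does not unfold inequalities to membership in the cone. -/
noncomputable def linearOrder : LinearOrder (OrdFrac N) := .mkOfAddGroupCone (cone N)

noncomputable instance : LinearOrder (OrdFrac N) := linearOrder

instance : IsOrderedRing (OrdFrac N) := .mkOfCone (cone N)

instance : IsStrictOrderedRing (OrdFrac N) := IsOrderedRing.toIsStrictOrderedRing _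

theorem of_nonneg (a : N) : (0 : OrdFrac N) ≤ of a :=
  show of a - 0 ∈ cone N from ⟨a, 1, one_pos, by simp⟩

theorem of_strictMono : StrictMono (of (N := N)) := by
  refine Monotone.strictMono_of_injective (fun a b h => ?_) of_injective
  obtain ⟨c, rfl⟩ := exists_add_of_le h
  rw [map_add]
  exact le_add_of_nonneg_right (of_nonneg c)

end OrdFrac

end DiffRing

/-! ### Codes of rational numbers -/

section Codes

variable {M : Model.{u}} [IsACA M]

/-- The ordered field of the rational numbers of the model. -/
abbrev QQ (M : Model.{u}) [IsACA M] : Type u := OrdFrac (M.Dom Ty.nat)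

/-- The inclusion of the numbers into the rational numbers. -/
noncomputable abbrev ofN : M.Dom Ty.nat →+* QQ M := OrdFrac.of

theorem ofN_le {a b : M.Dom Ty.nat} : ofN a ≤ ofN b ↔ a ≤ b := OrdFrac.of_strictMono.le_iff_le

theorem ofN_lt {a b : M.Dom Ty.nat} : ofN a < ofN b ↔ a < b := OrdFrac.of_strictMono.lt_iff_lt

theorem ofN_nonneg (a : M.Dom Ty.nat) : 0 ≤ ofN a := OrdFrac.of_nonneg a

theorem ofN_pos {a : M.Dom Ty.nat} : 0 < ofN a ↔ 0 < a := by
  rw [← map_zero ofN, ofN_lt]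

/-- Powers of two in the model. -/
noncomputable def mpow2 (n : M.Dom Ty.nat) : M.Dom Ty.nat := mrec 1 (fun _ r => r + r) n

@[simp] theorem eval_pow2 {Γ : Ctx} (ρ : Env M Γ) (t : Tm Γ Ty.nat) :
    (pow2 t).eval M ρ = mpow2 (t.eval M ρ) := by simp [pow2, mpow2]

instance def_mpow2 {X : Type u} [Cx M X] (n : X → M.Dom Ty.nat) [Def n] :
    Def fun x => mpow2 (n x) := by unfold mpow2; infer_instance

@[simp] theorem mpow2_zero : mpow2 (0 : M.Dom Ty.nat) = 1 := mrec_zero _ _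

theorem mpow2_succ (n : M.Dom Ty.nat) : mpow2 (n + 1) = 2 * mpow2 n := by
  rw [mpow2, mrec_succ, ← mpow2, two_mul]

theorem lt_mpow2 (n : M.Dom Ty.nat) : n < mpow2 n := by
  refine induction_defP (fun n => n < mpow2 n) ?_ (fun n hn => ?_) n
  · rw [mpow2_zero]; exact zero_lt_one
  · rw [mpow2_succ]
    exact (Num.succ_le_of_lt hn).trans_lt
      (lt_mul_of_one_lt_left ((Num.zero_le n).trans_lt hn) one_lt_two)

theorem mpow2_pos (n : M.Dom Ty.nat) : 0 < mpow2 n := (Num.zero_le n).trans_lt (lt_mpow2 n)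

/-- The integer part of the square root in the model. -/
noncomputable def misqrt (n : M.Dom Ty.nat) : M.Dom Ty.nat :=
  mrec 0 (fun k r => mifz (msub ((r + 1) * (r + 1)) (k + 1)) (r + 1) r) n

@[simp] theorem eval_isqrt {Γ : Ctx} (ρ : Env M Γ) (t : Tm Γ Ty.nat) :
    (isqrt t).eval M ρ = misqrt (t.eval M ρ) := by simp [isqrt, misqrt]

instance def_misqrt {X : Type u} [Cx M X] (n : X → M.Dom Ty.nat) [Def n] :
    Def fun x => misqrt (n x) := by unfold misqrt; infer_instance

theorem misqrt_spec (n : M.Dom Ty.nat) :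
    misqrt n * misqrt n ≤ n ∧ n < (misqrt n + 1) * (misqrt n + 1) := by
  refine induction_defP
    (fun n => misqrt n * misqrt n ≤ n ∧ n < (misqrt n + 1) * (misqrt n + 1)) ?_ (fun n hn => ?_) n
  · simp [misqrt]
  · have e : misqrt (n + 1) =
        mifz (msub ((misqrt n + 1) * (misqrt n + 1)) (n + 1)) (misqrt n + 1) (misqrt n) := by
      rw [misqrt, mrec_succ, ← misqrt]
    rw [mifz_eq] at e
    generalize misqrt (n + 1) = s at *
    generalize misqrt n = r at *
    split_ifs at e with h <;> subst e <;> rw [msub_eq_zero] at h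
    · refine ⟨h, ?_⟩
      have h1 := ofN_lt.2 hn.2
      have h2 := ofN_nonneg r
      rw [← ofN_lt]
      simp only [map_add, map_mul, map_one] at h1 h2 ⊢
      nlinarith
    · have : n ≤ n + 1 := le_self_add
      exact ⟨hn.1.trans this, not_le.1 h⟩

theorem misqrt_eq {n s : M.Dom Ty.nat} (h : s * s ≤ n) (h' : n < (s + 1) * (s + 1)) :
    misqrt n = s := by
  obtain ⟨h1, h2⟩ := misqrt_spec n
  refine le_antisymm (Num.lt_succ_iff.1 ?_) (Num.lt_succ_iff.1 ?_)
  · exact lt_of_mul_self_lt_mul_self₀ (Num.zero_le _) (h1.trans_lt h')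
  · exact lt_of_mul_self_lt_mul_self₀ (Num.zero_le _) (h.trans_lt h2)

/-- The pairing of numbers in the model. -/
noncomputable def mpair (a b : M.Dom Ty.nat) : M.Dom Ty.nat := (a + b) * (a + b) + a
/-- The first inverse of the pairing. -/
noncomputable def mfst (n : M.Dom Ty.nat) : M.Dom Ty.nat := msub n (misqrt n * misqrt n)
/-- The second inverse of the pairing. -/
noncomputable def msnd (n : M.Dom Ty.nat) : M.Dom Ty.nat := msub (misqrt n) (mfst n)

@[simp] theorem eval_pair {Γ : Ctx} (ρ : Env M Γ) (s t : Tm Γ Ty.nat) :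
    (pair s t).eval M ρ = mpair (s.eval M ρ) (t.eval M ρ) := rfl
@[simp] theorem eval_fst {Γ : Ctx} (ρ : Env M Γ) (t : Tm Γ Ty.nat) :
    (fst t).eval M ρ = mfst (t.eval M ρ) := by simp [fst, mfst]
@[simp] theorem eval_snd {Γ : Ctx} (ρ : Env M Γ) (t : Tm Γ Ty.nat) :
    (snd t).eval M ρ = msnd (t.eval M ρ) := by simp [snd, msnd]

theorem misqrt_mpair (a b : M.Dom Ty.nat) : misqrt (mpair a b) = a + b := by
  refine misqrt_eq le_self_add ?_
  have h1 := ofN_nonneg a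
  have h2 := ofN_nonneg b
  rw [← ofN_lt]
  simp only [mpair, map_add, map_mul, map_one] at h1 h2 ⊢
  nlinarith

@[simp] theorem mfst_mpair (a b : M.Dom Ty.nat) : mfst (mpair a b) = a := by
  rw [mfst, misqrt_mpair, mpair, add_comm, msub_add_self]

@[simp] theorem msnd_mpair (a b : M.Dom Ty.nat) : msnd (mpair a b) = b := by
  rw [msnd, misqrt_mpair, mfst_mpair, add_comm, msub_add_self]

instance def_mfst {X : Type u} [Cx M X] (n : X → M.Dom Ty.nat) [Def n] :
    Def fun x => mfst (n x) := by unfold mfst; infer_instance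
instance def_msnd {X : Type u} [Cx M X] (n : X → M.Dom Ty.nat) [Def n] :
    Def fun x => msnd (n x) := by unfold msnd; infer_instance
instance def_mpair {X : Type u} [Cx M X] (a b : X → M.Dom Ty.nat) [Def a] [Def b] :
    Def fun x => mpair (a x) (b x) := by unfold mpair; infer_instance

/-- The rational number with code `p`. -/
noncomputable def val (p : M.Dom Ty.nat) : QQ M :=
  (ofN (mfst p) - ofN (mfst (msnd p))) / ofN (msnd (msnd p) + 1)

theorem val_mpair (a b c : M.Dom Ty.nat) :
    val (mpair a (mpair b c)) = (ofN a - ofN b) / ofN (c + 1) := by simp [val]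

theorem mpred_add_one {n : M.Dom Ty.nat} (h : 0 < n) : mpred n + 1 = n := by
  obtain rfl | ⟨m, rfl⟩ := eq_zero_or_succ n
  · exact absurd h (lt_irrefl 0)
  · rw [mpred_succ]

theorem ofN_mpred_add_one {n : M.Dom Ty.nat} (h : 0 < n) : ofN (mpred n) + 1 = ofN n := by
  rw [← map_one ofN, ← map_add, mpred_add_one h]

theorem ofN_succ_ne (n : M.Dom Ty.nat) : ofN n + 1 ≠ 0 := by
  have := OrdFrac.of_ne_zero (Num.zero_lt_succ n)
  simpa using this

theorem ofN_mpred_mul_add_one (n m : M.Dom Ty.nat) :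
    ofN (mpred ((n + 1) * (m + 1))) + 1 = (ofN n + 1) * (ofN m + 1) := by
  have := congrArg ofN (mpred_add_one (Num.mul_pos (Num.zero_lt_succ n) (Num.zero_lt_succ m)))
  simpa using this

theorem val_ratAdd {Γ : Ctx} (ρ : Env M Γ) (s t : Tm Γ Ty.nat) :
    val ((ratAdd s t).eval M ρ) = val (s.eval M ρ) + val (t.eval M ρ) := by
  simp only [ratAdd, mkRat, qpos, qneg, qden, eval_pair, eval_add, eval_mul, eval_succ, eval_fst,
    eval_snd, eval_pred, val_mpair, map_add, map_mul, ofN_mpred_mul_add_one, map_one]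
  simp only [val, map_add, map_one]
  rw [div_add_div _ _ (ofN_succ_ne _) (ofN_succ_ne _)]
  congr 1
  ring

theorem val_ratSub {Γ : Ctx} (ρ : Env M Γ) (s t : Tm Γ Ty.nat) :
    val ((ratSub s t).eval M ρ) = val (s.eval M ρ) - val (t.eval M ρ) := by
  simp only [ratSub, mkRat, qpos, qneg, qden, eval_pair, eval_add, eval_mul, eval_succ, eval_fst,
    eval_snd, eval_pred, val_mpair, map_add, map_mul, ofN_mpred_mul_add_one, map_one]
  simp only [val, map_add, map_one]
  rw [div_sub_div _ _ (ofN_succ_ne _) (ofN_succ_ne _)]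
  congr 1
  ring

theorem val_ratMul {Γ : Ctx} (ρ : Env M Γ) (s t : Tm Γ Ty.nat) :
    val ((ratMul s t).eval M ρ) = val (s.eval M ρ) * val (t.eval M ρ) := by
  simp only [ratMul, mkRat, qpos, qneg, qden, eval_pair, eval_add, eval_mul, eval_succ, eval_fst,
    eval_snd, eval_pred, val_mpair, map_add, map_mul, ofN_mpred_mul_add_one, map_one]
  simp only [val, map_add, map_one]
  rw [div_mul_div_comm]
  congr 1
  ring

theorem ofN_msub {a b : M.Dom Ty.nat} (h : b ≤ a) : ofN (msub a b) = ofN a - ofN b := by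
  have := congrArg ofN (msub_add_cancel h)
  rw [map_add] at this
  exact eq_sub_of_add_eq this

theorem val_ratAbs {Γ : Ctx} (ρ : Env M Γ) (t : Tm Γ Ty.nat) :
    val ((ratAbs t).eval M ρ) = |val (t.eval M ρ)| := by
  simp only [ratAbs, mkRat, qpos, qneg, qden, eval_pair, eval_add, eval_succ, eval_fst,
    eval_snd, eval_pred, eval_sub, eval_zero, val_mpair, mpred_succ]
  rw [val, abs_div, abs_of_pos (ofN_pos.2 (Num.zero_lt_succ _)), map_zero, sub_zero, map_add]
  congr 1
  rcases le_total (mfst (t.eval M ρ)) (mfst (msnd (t.eval M ρ))) with h | h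
  · rw [msub_eq_zero.2 h, ofN_msub h, map_zero, abs_of_nonpos (sub_nonpos.2 (ofN_le.2 h))]
    ring
  · rw [msub_eq_zero.2 h, ofN_msub h, map_zero, abs_of_nonneg (sub_nonneg.2 (ofN_le.2 h))]
    ring

@[simp] theorem val_ratOfNat {Γ : Ctx} (ρ : Env M Γ) (t : Tm Γ Ty.nat) :
    val ((ratOfNat t).eval M ρ) = ofN (t.eval M ρ) := by
  simp [ratOfNat, mkRat, val_mpair]

/-- The dyadic number `2 ^ (-n)`. -/
noncomputable def hh (n : M.Dom Ty.nat) : QQ M := (ofN (mpow2 n))⁻¹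

@[simp] theorem val_ratDyadic {Γ : Ctx} (ρ : Env M Γ) (s t : Tm Γ Ty.nat) :
    val ((ratDyadic s t).eval M ρ) = ofN (s.eval M ρ) * hh (t.eval M ρ) := by
  simp [ratDyadic, mkRat, val_mpair, hh, ofN_mpred_add_one (mpow2_pos _), div_eq_mul_inv]

@[simp] theorem holds_ratLe {Γ : Ctx} (ρ : Env M Γ) (s t : Tm Γ Ty.nat) :
    (ratLe s t).Holds M ρ ↔ val (s.eval M ρ) ≤ val (t.eval M ρ) := by
  simp only [ratLe, qpos, qneg, qden, holds_le, eval_add, eval_mul, eval_succ, eval_fst, eval_snd,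
    val]
  rw [div_le_div_iff₀ (ofN_pos.2 (Num.zero_lt_succ _)) (ofN_pos.2 (Num.zero_lt_succ _)), ← ofN_le]
  simp only [map_add, map_mul, map_one]
  constructor <;> intro h <;> linarith

theorem hh_pos (n : M.Dom Ty.nat) : 0 < hh n := inv_pos.2 (ofN_pos.2 (mpow2_pos n))

@[simp] theorem hh_zero : hh (0 : M.Dom Ty.nat) = 1 := by simp [hh]

theorem hh_succ (n : M.Dom Ty.nat) : hh (n + 1) = hh n / 2 := by
  rw [hh, hh, mpow2_succ, map_mul, mul_inv, map_ofNat]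
  ring

/-- Every positive rational number of the model is larger than some `2 ^ (-n)`. -/
theorem exists_hh_lt {x : QQ M} (hx : 0 < x) : ∃ n, hh n < x := by
  obtain ⟨a, b, hb, h⟩ := OrdFrac.exists_eq_div x
  have hb' := ofN_pos.2 hb
  have ha : 0 < a := by
    refine pos_iff_ne_zero.2 fun h0 => hx.ne' ?_
    rcases h with rfl | rfl <;> simp [h0]
  have ha' := ofN_pos.2 ha
  have hx' : x = ofN a / ofN b := by
    rcases h with h | h
    · exact h
    · have := div_pos ha' hb'
      linarith
  refine ⟨b, ?_⟩
  have h1 : ofN b < ofN (mpow2 b) := OrdFrac.of_strictMono (lt_mpow2 b)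
  have h2 : (1 : QQ M) ≤ ofN a := by
    rw [← map_one ofN, ofN_le]
    simpa using Num.succ_le_of_lt ha
  rw [hx', hh, ← one_div]
  exact (one_div_lt_one_div_of_lt hb' h1).trans_le (div_le_div_of_nonneg_right h2 hb'.le)

/-! ### Definable rational-valued functions -/

/-- `F` is given by a definable function with values in the codes of rational numbers. -/
class DefQ {X : Type u} [Cx M X] (F : X → QQ M) : Prop where
  out : ∃ c : X → M.Dom Ty.nat, Def c ∧ ∀ x, val (c x) = F x

section

variable {X : Type u} [Cx M X]

instance defQ_val (c : X → M.Dom Ty.nat) [h : Def c] : DefQ fun x => val (c x) :=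
  ⟨c, h, fun _ => rfl⟩

theorem exists_val_eq (x : QQ M) : ∃ c, val c = x := by
  obtain ⟨a, b, hb, rfl | rfl⟩ := OrdFrac.exists_eq_div x
  · exact ⟨mpair a (mpair 0 (mpred b)), by rw [val_mpair, mpred_add_one hb]; simp⟩
  · exact ⟨mpair 0 (mpair a (mpred b)), by rw [val_mpair, mpred_add_one hb]; simp [neg_div]⟩

instance defQ_const (q : QQ M) : DefQ fun _ : X => q := by
  obtain ⟨c, rfl⟩ := exists_val_eq q
  infer_instance

/-- Operations on codes that are given by terms preserve definability. -/
theorem defQ_eval₂ {F G : X → QQ M} [hF : DefQ F] [hG : DefQ G] {op : QQ M → QQ M → QQ M}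
    (t : Tm [Ty.nat, Ty.nat] Ty.nat)
    (ht : ∀ a b, val (t.eval M ((Env.nil.cons b).cons a)) = op (val a) (val b)) :
    DefQ fun x => op (F x) (G x) := by
  obtain ⟨c, hc, hc'⟩ := hF.out
  obtain ⟨d, hd, hd'⟩ := hG.out
  refine ⟨fun x => t.eval M ((Env.nil.cons (d x)).cons (c x)), def_eval _ (fun σ v => ?_) t,
    fun x => by rw [ht, hc', hd']⟩
  match v with
  | .z => exact hc
  | .s .z => exact hd

instance defQ_add (F G : X → QQ M) [DefQ F] [DefQ G] : DefQ fun x => F x + G x :=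
  defQ_eval₂ (ratAdd v0 v1) fun _ _ => val_ratAdd _ _ _
instance defQ_sub (F G : X → QQ M) [DefQ F] [DefQ G] : DefQ fun x => F x - G x :=
  defQ_eval₂ (ratSub v0 v1) fun _ _ => val_ratSub _ _ _
instance defQ_mul (F G : X → QQ M) [DefQ F] [DefQ G] : DefQ fun x => F x * G x :=
  defQ_eval₂ (ratMul v0 v1) fun _ _ => val_ratMul _ _ _
instance defQ_abs (F : X → QQ M) [DefQ F] : DefQ fun x => |F x| :=
  defQ_eval₂ (F := F) (G := F) (op := fun a _ => |a|) (ratAbs v0) fun _ _ => val_ratAbs _ _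
theorem val_mpair_mpow2 (a n : M.Dom Ty.nat) :
    val (mpair a (mpair 0 (mpred (mpow2 n)))) = ofN a * hh n := by
  simp [val_mpair, hh, ofN_mpred_add_one (mpow2_pos _), div_eq_mul_inv]

instance defQ_hh (n : X → M.Dom Ty.nat) [Def n] : DefQ fun x => hh (n x) :=
  ⟨fun x => mpair 1 (mpair 0 (mpred (mpow2 (n x)))), inferInstance, fun x => by
    rw [val_mpair_mpow2]; simp⟩

instance defQ_ite (P : X → Prop) [∀ x, Decidable (P x)] (F G : X → QQ M) [DefP M P] [hF : DefQ F]
    [hG : DefQ G] : DefQ fun x => if P x then F x else G x := by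
  obtain ⟨c, hc, hc'⟩ := hF.out
  obtain ⟨d, hd, hd'⟩ := hG.out
  exact ⟨fun x => if P x then c x else d x, inferInstance, fun x => by
    by_cases hx : P x <;> simp [hx, hc', hd']⟩

instance defP_le_QQ (F G : X → QQ M) [hF : DefQ F] [hG : DefQ G] : DefP M fun x => F x ≤ G x := by
  obtain ⟨c, hc, hc'⟩ := hF.out
  obtain ⟨d, hd, hd'⟩ := hG.out
  have : ∀ x, F x ≤ G x ↔ mfst (c x) * (msnd (msnd (d x)) + 1) +
      mfst (msnd (d x)) * (msnd (msnd (c x)) + 1) ≤ mfst (d x) * (msnd (msnd (c x)) + 1) +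
      mfst (msnd (c x)) * (msnd (msnd (d x)) + 1) := fun x => by
    rw [← hc', ← hd']
    have := holds_ratLe ((Env.nil.cons (d x)).cons (c x)) v0 v1
    simp only [ratLe, qpos, qneg, qden, holds_le, eval_add, eval_mul, eval_succ, eval_fst, eval_snd,
      Tm.eval_var, Env.cons_z, Env.cons_s] at this
    exact this.symm
  simp only [this]
  infer_instance

instance defP_eq_QQ (F G : X → QQ M) [DefQ F] [DefQ G] : DefP M fun x => F x = G x := by
  simp only [le_antisymm_iff]
  infer_instance

end

theorem hh_antitone {m n : M.Dom Ty.nat} (h : m ≤ n) : hh n ≤ hh m := by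
  obtain ⟨c, rfl⟩ := exists_add_of_le h
  refine induction_defP (fun c => hh (m + c) ≤ hh m) (by simp) (fun c hc => ?_) c
  rw [← add_assoc, hh_succ]
  have := hh_pos (m + c)
  linarith

theorem hh_injective : Function.Injective (hh (M := M)) := by
  have key (m n : M.Dom Ty.nat) (h : m < n) : hh n < hh m := by
    have h2 := hh_antitone (Num.succ_le_of_lt h)
    have h3 := hh_pos m
    rw [hh_succ] at h2
    linarith
  intro m n h
  rcases lt_trichotomy m n with h' | h' | h'
  · exact absurd h (key _ _ h').ne'
  · exact h'
  · exact absurd h (key _ _ h').ne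

/-- A rational number of the model that is at most a fixed multiple of all `2 ^ (-n)` is at most
`0`. -/
theorem nonpos_of_forall_le_hh {x c : QQ M} (hc : 0 < c) (h : ∀ n, x ≤ c * hh n) : x ≤ 0 := by
  by_contra! hx
  obtain ⟨n, hn⟩ := exists_hh_lt (div_pos hx hc)
  have := h n
  rw [lt_div_iff₀ hc] at hn
  linarith

end Codes

/-! ### Real numbers in the model -/

section Reals

variable {M : Model.{u}} [IsACA M]

/-- The `n`-th approximation of `x`. -/
noncomputable def V (x : M.Dom Ty.seq) (n : M.Dom Ty.nat) : QQ M := val (M.app x n)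

/-- `x` represents a real number. -/
def MReal (x : M.Dom Ty.seq) : Prop := ∀ n i, |V x n - V x (n + i)| ≤ hh n

/-- `x` and `y` represent the same real number. -/
def MEq (x y : M.Dom Ty.seq) : Prop := ∀ n, |V x n - V y n| ≤ 2 * hh n

/-- The order of represented reals. -/
def MLe (x y : M.Dom Ty.seq) : Prop := ∀ n, V x n ≤ V y n + 2 * hh n

/-- `x` represents an element of the unit interval. -/
def MUnit (x : M.Dom Ty.seq) : Prop :=
  MReal x ∧ (∀ n, 0 ≤ V x n + 2 * hh n) ∧ ∀ n, V x n ≤ 1 + 2 * hh n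

section

variable {Γ : Ctx} (ρ : Env M Γ) (s t : Tm Γ Ty.seq)

@[simp] theorem holds_isReal : (isReal t).Holds M ρ ↔ MReal (t.eval M ρ) := by
  simp [isReal, MReal, V, val_ratAbs, val_ratSub]

theorem ofN_two : ofN (2 : M.Dom Ty.nat) = 2 := map_ofNat ofN 2

@[simp] theorem holds_realEq : (realEq s t).Holds M ρ ↔ MEq (s.eval M ρ) (t.eval M ρ) := by
  simp [realEq, MEq, V, val_ratAbs, val_ratSub, one_add_one_eq_two, ofN_two]

@[simp] theorem holds_realLe : (realLe s t).Holds M ρ ↔ MLe (s.eval M ρ) (t.eval M ρ) := by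
  simp [realLe, MLe, V, val_ratAdd, one_add_one_eq_two, ofN_two]

@[simp] theorem holds_realLt : (realLt s t).Holds M ρ ↔ ¬ MLe (t.eval M ρ) (s.eval M ρ) := by
  simp [realLt]

@[simp] theorem V_realOfRat (q : Tm Γ Ty.nat) (n : M.Dom Ty.nat) :
    V ((realOfRat q).eval M ρ) n = val (q.eval M ρ) := by simp [V, realOfRat]

@[simp] theorem V_realZero (n : M.Dom Ty.nat) : V ((realZero : Tm Γ Ty.seq).eval M ρ) n = 0 := by
  simp [realZero]

@[simp] theorem V_realOne (n : M.Dom Ty.nat) : V ((realOne : Tm Γ Ty.seq).eval M ρ) n = 1 := by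
  simp [realOne]

/-- The sum of `x` and `y`. -/
noncomputable def madd (x y : M.Dom Ty.seq) : M.Dom Ty.seq :=
  (realAdd v0 v1).eval M ((Env.nil.cons y).cons x)

/-- The difference of `x` and `y`. -/
noncomputable def mdiff (x y : M.Dom Ty.seq) : M.Dom Ty.seq :=
  (realSub v0 v1).eval M ((Env.nil.cons y).cons x)

/-- The distance of `x` and `y`. -/
noncomputable def mdist (x y : M.Dom Ty.seq) : M.Dom Ty.seq :=
  (realDist v0 v1).eval M ((Env.nil.cons y).cons x)

@[simp] theorem eval_realAdd :
    (realAdd s t).eval M ρ = madd (s.eval M ρ) (t.eval M ρ) :=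
  app_ext fun n => by simp [madd, realAdd, ratAdd, mkRat, qpos, qneg, qden]

@[simp] theorem eval_realSub :
    (realSub s t).eval M ρ = mdiff (s.eval M ρ) (t.eval M ρ) :=
  app_ext fun n => by simp [mdiff, realSub, ratSub, mkRat, qpos, qneg, qden]

@[simp] theorem eval_realDist :
    (realDist s t).eval M ρ = mdist (s.eval M ρ) (t.eval M ρ) :=
  app_ext fun n => by simp [mdist, realDist, ratAbs, ratSub, mkRat, qpos, qneg, qden]

@[simp] theorem V_madd (x y : M.Dom Ty.seq) (n : M.Dom Ty.nat) :
    V (madd x y) n = V x (n + 1) + V y (n + 1) := by simp [V, madd, realAdd, val_ratAdd]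

@[simp] theorem V_mdiff (x y : M.Dom Ty.seq) (n : M.Dom Ty.nat) :
    V (mdiff x y) n = V x (n + 1) - V y (n + 1) := by simp [V, mdiff, realSub, val_ratSub]

@[simp] theorem V_mdist (x y : M.Dom Ty.seq) (n : M.Dom Ty.nat) :
    V (mdist x y) n = |V x (n + 1) - V y (n + 1)| := by
  simp [V, mdist, realDist, val_ratSub, val_ratAbs]

@[simp] theorem holds_inUnit : (inUnit t).Holds M ρ ↔ MUnit (t.eval M ρ) := by
  simp [inUnit, MUnit, MLe]

end

/-! Definability of these notions. -/

section

variable {X : Type u} [Cx M X]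

theorem Def.comp₂ {σ τ υ : Ty} {F : M.Dom σ → M.Dom τ → M.Dom υ}
    (hF : Def fun p : (PUnit.{u+1} × M.Dom σ) × M.Dom τ => F p.1.2 p.2)
    (G : X → M.Dom σ) (H : X → M.Dom τ) [Def G] [Def H] : Def fun x => F (G x) (H x) := by
  obtain ⟨f, hf, hf'⟩ := hF.out
  obtain ⟨g, hg⟩ := Def.exists_app (F := fun a => f (⟨⟩, a)) hf
  have : ∀ a b, M.app (M.app g a) b = F a b := fun a b => by rw [hg, hf']
  simp only [← this]
  infer_instance

theorem DefP.comp₂ {σ τ : Ty} {P : M.Dom σ → M.Dom τ → Prop}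
    (hP : DefP M fun p : (PUnit.{u+1} × M.Dom σ) × M.Dom τ => P p.1.2 p.2)
    (G : X → M.Dom σ) (H : X → M.Dom τ) [Def G] [Def H] : DefP M fun x => P (G x) (H x) :=
  ⟨Def.comp₂ (F := fun a b => chi M (P a b)) hP.out G H⟩

instance defQ_V (F : X → M.Dom Ty.seq) (n : X → M.Dom Ty.nat) [Def F] [Def n] :
    DefQ fun x => V (F x) (n x) := by
  unfold V
  infer_instance

instance defP_MReal (F : X → M.Dom Ty.seq) [Def F] : DefP M fun x => MReal (F x) := by
  refine DefP.comp (P := MReal) ?_ F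
  unfold MReal
  infer_instance

instance defP_MEq (F G : X → M.Dom Ty.seq) [Def F] [Def G] : DefP M fun x => MEq (F x) (G x) := by
  refine DefP.comp₂ (P := MEq) ?_ F G
  unfold MEq
  infer_instance

instance defP_MLe (F G : X → M.Dom Ty.seq) [Def F] [Def G] : DefP M fun x => MLe (F x) (G x) := by
  refine DefP.comp₂ (P := MLe) ?_ F G
  unfold MLe
  infer_instance

instance defP_MUnit (F : X → M.Dom Ty.seq) [Def F] : DefP M fun x => MUnit (F x) := by
  refine DefP.comp (P := MUnit) ?_ F
  unfold MUnit
  infer_instance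

end

end Reals

/-! ### Values of real numbers in an ordered field -/

section Values

variable {M : Model.{u}} [IsACA M]

theorem exists_hh_le {x : QQ M} (hx : 0 < x) : ∃ n, hh n ≤ x :=
  (exists_hh_lt hx).imp fun _ => le_of_lt

theorem hh_add_le (m n : M.Dom Ty.nat) : hh (m + n) ≤ hh n :=
  hh_antitone (le_add_of_nonneg_left (Num.zero_le m))

theorem le_of_forall_le_add_hh {x y c : QQ M} (hc : 0 < c) (h : ∀ n, x ≤ y + c * hh n) : x ≤ y :=
  sub_nonpos.1 (nonpos_of_forall_le_hh hc fun n => sub_le_iff_le_add'.2 (h n))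

theorem MReal.dist_le {x : M.Dom Ty.seq} (hx : MReal x) {m n : M.Dom Ty.nat} (h : m ≤ n) :
    |V x m - V x n| ≤ hh m := by
  obtain ⟨i, rfl⟩ := exists_add_of_le h
  exact hx m i

/-- An error of the order of `2 ^ (-n)` in the `n`-th approximations is enough for `x ≤ y`. -/
theorem MReal.le_of_forall {x y : M.Dom Ty.seq} (hx : MReal x) (hy : MReal y) {c : QQ M}
    (hc : 0 < c) (h : ∀ n, V x n ≤ V y n + c * hh n) : MLe x y := fun n =>
  le_of_forall_le_add_hh hc fun m => by
    have h1 := abs_le.1 (hx n m)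
    have h2 := abs_le.1 (hy n m)
    have h3 := h (n + m)
    have h4 := mul_le_mul_of_nonneg_left (hh_add_le n m) hc.le
    linarith

theorem MEq_iff {x y : M.Dom Ty.seq} : MEq x y ↔ MLe x y ∧ MLe y x := by
  simp only [MEq, MLe, ← forall_and, abs_le]
  exact forall_congr' fun n =>
    ⟨fun h => ⟨by linarith, by linarith⟩, fun h => ⟨by linarith, by linarith⟩⟩

theorem MLe.trans {x y z : M.Dom Ty.seq} (hx : MReal x) (hz : MReal z)
    (h1 : MLe x y) (h2 : MLe y z) : MLe x z :=
  hx.le_of_forall hz (c := 4) (by norm_num) fun n => by linarith [h1 n, h2 n]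

theorem MLe.refl (x : M.Dom Ty.seq) : MLe x x := fun n => by linarith [hh_pos n]

theorem MEq.refl (x : M.Dom Ty.seq) : MEq x x := MEq_iff.2 ⟨.refl x, .refl x⟩

theorem MEq.symm {x y : M.Dom Ty.seq} (h : MEq x y) : MEq y x := MEq_iff.2 (MEq_iff.1 h).symm

/-- If `x < y`, then a positive power of `2` fits between all late approximations. -/
theorem MReal.exists_of_not_le {x y : M.Dom Ty.seq} (hx : MReal x) (hy : MReal y)
    (h : ¬ MLe y x) : ∃ e, ∀ m, e ≤ m → V x m + hh e ≤ V y m := by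
  simp only [MLe, not_forall, not_le] at h
  obtain ⟨n, hn⟩ := h
  obtain ⟨k, hk⟩ := exists_hh_le (sub_pos.2 hn)
  refine ⟨n + k, fun m hm => ?_⟩
  have h1 := abs_le.1 (hx.dist_le (le_trans (le_add_of_nonneg_right (Num.zero_le k)) hm))
  have h2 := abs_le.1 (hy.dist_le (le_trans (le_add_of_nonneg_right (Num.zero_le k)) hm))
  have h3 := hh_add_le n k
  linarith

variable (M) in
/-- An ultrafilter on the numbers of the model that contains all final segments. -/
noncomputable def ultra : Ultrafilter (M.Dom Ty.nat) := Ultrafilter.of Filter.atTop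

variable (M) in
/-- An ordered field in which the reals of the model have values: an ultrapower of the field of
rational numbers. Values are determined up to infinitesimals only; a choice of representatives
makes them respect equality. -/
abbrev RR : Type u := Filter.Germ (ultra M : Filter (M.Dom Ty.nat)) (QQ M)

/-- The inclusion of the rational numbers in `RR M`. -/
noncomputable def tr : QQ M →+* RR M :=
  (Filter.Germ.coeRingHom _).comp (Pi.constRingHom _ _)

@[simp] theorem tr_le {a b : QQ M} : tr a ≤ tr b ↔ a ≤ b := Filter.Germ.const_le_iff

@[simp] theorem tr_lt {a b : QQ M} : tr a < tr b ↔ a < b := by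
  rw [← not_le, tr_le, not_le]

theorem tr_abs (a : QQ M) : tr |a| = |tr a| := Filter.Germ.const_abs a

/-- The value of the real number `x`. It depends on the real number only, since it is the germ of
the approximations of a chosen representative. -/
noncomputable def rv (x : M.Dom Ty.seq) : RR M :=
  ((fun n => V (Classical.epsilon fun y => MReal y ∧ MEq x y) n : M.Dom Ty.nat → QQ M) : RR M)

theorem MReal.abs_rv_sub_le' {x : M.Dom Ty.seq} (hx : MReal x) (n k : M.Dom Ty.nat) :
    |rv x - tr (V x n)| ≤ tr (hh n + 2 * hh k) := by
  obtain ⟨hy, hxy⟩ : MReal _ ∧ MEq x _ :=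
    Classical.epsilon_spec (p := fun y => MReal y ∧ MEq x y) ⟨x, hx, .refl x⟩
  have key : ∀ m, n + k ≤ m →
      |V (Classical.epsilon fun y => MReal y ∧ MEq x y) m - V x n| ≤ hh n + 2 * hh k := by
    intro m hm
    have h1 := abs_le.1 (hx.dist_le (le_trans (le_add_of_nonneg_right (Num.zero_le k)) hm))
    have h2 := abs_le.1 (hxy m)
    have h3 := hh_antitone (le_trans (le_add_of_nonneg_left (Num.zero_le n)) hm)
    rw [abs_le]
    constructor <;> linarith
  have ev : ∀ᶠ m in (ultra M : Filter (M.Dom Ty.nat)), n + k ≤ m :=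
    Ultrafilter.of_le _ (Filter.eventually_ge_atTop (n + k))
  rw [abs_le]
  constructor
  · rw [neg_le_sub_iff_le_add, ← sub_le_iff_le_add, ← map_sub]
    refine Filter.Germ.coe_le.2 (ev.mono fun m hm => ?_)
    have := (abs_le.1 (key m hm)).1
    change V x n - (hh n + 2 * hh k) ≤ _
    linarith
  · rw [sub_le_iff_le_add, ← map_add]
    refine Filter.Germ.coe_le.2 (ev.mono fun m hm => ?_)
    have := (abs_le.1 (key m hm)).2
    change _ ≤ hh n + 2 * hh k + V x n
    linarith

theorem MReal.abs_rv_sub_le {x : M.Dom Ty.seq} (hx : MReal x) (n : M.Dom Ty.nat) :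
    |rv x - tr (V x n)| ≤ 2 * tr (hh n) := by
  have := hx.abs_rv_sub_le' n (n + 1)
  rwa [hh_succ, mul_div_cancel₀ _ two_ne_zero, map_add, ← two_mul] at this

/-- If `x < y`, then the values differ by at least a power of `2`. -/
theorem MReal.exists_rv_add_le {x y : M.Dom Ty.seq} (hx : MReal x) (hy : MReal y)
    (h : ¬ MLe y x) : ∃ k, rv x + tr (hh k) ≤ rv y := by
  obtain ⟨e, he⟩ := hx.exists_of_not_le hy h
  refine ⟨e + 1, ?_⟩
  have h1 := he (e + 1 + 1 + 1 + 1) (by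
    simp only [add_assoc]; exact le_add_of_nonneg_right (Num.zero_le _))
  have h2 := abs_le.1 (hx.abs_rv_sub_le (e + 1 + 1 + 1 + 1))
  have h3 := abs_le.1 (hy.abs_rv_sub_le (e + 1 + 1 + 1 + 1))
  rw [← tr_le, map_add] at h1
  simp only [hh_succ, map_div₀, map_ofNat] at *
  have h4 := tr_lt.2 (hh_pos e)
  rw [map_zero] at h4
  linarith

theorem rv_congr {x y : M.Dom Ty.seq} (hx : MReal x) (hy : MReal y) (h : MEq x y) :
    rv x = rv y := by
  have : (fun z => MReal z ∧ MEq x z) = fun z => MReal z ∧ MEq y z := by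
    funext z
    refine propext (and_congr_right fun hz => ?_)
    rw [MEq_iff] at h
    rw [MEq_iff, MEq_iff]
    exact ⟨fun h' => ⟨h.2.trans hy hz h'.1, h'.2.trans hz hy h.1⟩,
      fun h' => ⟨h.1.trans hx hz h'.1, h'.2.trans hz hx h.2⟩⟩
  simp only [rv, this]

theorem MLe_iff {x y : M.Dom Ty.seq} (hx : MReal x) (hy : MReal y) : MLe x y ↔ rv x ≤ rv y := by
  constructor
  · intro h
    by_cases h' : MLe y x
    · exact (rv_congr hx hy (MEq_iff.2 ⟨h, h'⟩)).le
    · obtain ⟨k, hk⟩ := hx.exists_rv_add_le hy h'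
      have := tr_lt.2 (hh_pos k)
      rw [map_zero] at this
      linarith
  · intro h
    refine hx.le_of_forall hy (c := 4) (by norm_num) fun n => ?_
    rw [← tr_le, map_add, map_mul, map_ofNat]
    have h2 := abs_le.1 (hx.abs_rv_sub_le n)
    have h3 := abs_le.1 (hy.abs_rv_sub_le n)
    linarith

theorem not_MLe_iff {x y : M.Dom Ty.seq} (hx : MReal x) (hy : MReal y) :
    ¬ MLe y x ↔ rv x < rv y := by rw [MLe_iff hy hx, not_le]

theorem MEq_iff_rv {x y : M.Dom Ty.seq} (hx : MReal x) (hy : MReal y) : MEq x y ↔ rv x = rv y := by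
  rw [MEq_iff, MLe_iff hx hy, MLe_iff hy hx, le_antisymm_iff]

theorem tr_hh_pos (n : M.Dom Ty.nat) : 0 < tr (hh n) := by
  rw [← map_zero tr, tr_lt]
  exact hh_pos n

theorem MReal.sub {x y : M.Dom Ty.seq} (hx : MReal x) (hy : MReal y) : MReal (mdiff x y) :=
  fun n i => by
    rw [V_mdiff, V_mdiff]
    have h1 := abs_le.1 (hx (n + 1) i)
    have h2 := abs_le.1 (hy (n + 1) i)
    rw [hh_succ, add_right_comm] at h1 h2
    refine abs_le.2 ⟨?_, ?_⟩ <;> linarith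

theorem MReal.dist {x y : M.Dom Ty.seq} (hx : MReal x) (hy : MReal y) : MReal (mdist x y) :=
  fun n i => by
    have := hx.sub hy n i
    rw [V_mdiff, V_mdiff] at this
    rw [V_mdist, V_mdist]
    exact (abs_abs_sub_abs_le _ _).trans this

theorem MReal.abs_rv_dist_le {x y : M.Dom Ty.seq} (hx : MReal x) (hy : MReal y)
    (n : M.Dom Ty.nat) : |rv (mdist x y) - (|rv x - rv y|)| ≤ 4 * tr (hh n) := by
  have h0 := (hx.dist hy).abs_rv_sub_le n
  have h1 := abs_le.1 (hx.abs_rv_sub_le (n + 1))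
  have h2 := abs_le.1 (hy.abs_rv_sub_le (n + 1))
  rw [hh_succ, map_div₀, map_ofNat] at h1 h2
  rw [V_mdist, tr_abs, map_sub] at h0
  have h3 := abs_abs_sub_abs_le (tr (V x (n + 1)) - tr (V y (n + 1))) (rv x - rv y)
  have h4 : |tr (V x (n + 1)) - tr (V y (n + 1)) - (rv x - rv y)| ≤ 2 * tr (hh n) :=
    abs_le.2 ⟨by linarith, by linarith⟩
  have := abs_sub_le (rv (mdist x y)) (|tr (V x (n + 1)) - tr (V y (n + 1))|) (|rv x - rv y|)
  linarith

/-- The meaning of `|x - y| < r` in terms of values. -/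
theorem dist_lt_iff {x y r : M.Dom Ty.seq} (hx : MReal x) (hy : MReal y) (hr : MReal r) :
    ¬ MLe r (mdist x y) ↔ ∃ k, |rv x - rv y| + tr (hh k) ≤ rv r := by
  constructor
  · intro h
    obtain ⟨k, hk⟩ := (hx.dist hy).exists_rv_add_le hr h
    refine ⟨k + 1, ?_⟩
    have := abs_le.1 (hx.abs_rv_dist_le hy (k + 1 + 1 + 1))
    simp only [hh_succ, map_div₀, map_ofNat] at *
    linarith
  · rintro ⟨k, hk⟩
    rw [not_MLe_iff (hx.dist hy) hr]
    have := abs_le.1 (hx.abs_rv_dist_le hy (k + 1 + 1 + 1))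
    have := tr_hh_pos k
    simp only [hh_succ, map_div₀, map_ofNat] at *
    linarith

end Values

/-! ### Injections into the natural and the rational numbers -/

section Injections

variable {M : Model.{u}} [IsACA M]

theorem exists_choice (M : Model.{u}) [IsACA M] : ∃ ν : M.Dom (Ty.seq ⇒ Ty.nat),
    ∀ f n, M.app f n = 0 → M.app f (M.app ν f) = 0 := by
  have h := holds_of_RCA (M := M) (.qfAC (Γ := [Ty.seq ⇒ Ty.nat])
    (v2 ⋄ v1 ≐ zero ⇛ v1 ⋄ v0 ≐ zero) (by simp [Fm.IsQF]))
    (Env.nil.cons (mlam fun f => chi M (∃ n, M.app f n = 0)))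
  simp only [Fm.holds_imp, Fm.holds_all, Fm.holds_ex, Fm.holds_subst] at h
  obtain ⟨ν, hν⟩ := h fun f => by
    by_cases hf : ∃ n, M.app f n = 0
    · obtain ⟨n, hn⟩ := hf
      exact ⟨n, by simp [hn]⟩
    · exact ⟨0, by simp [hf]⟩
  refine ⟨ν, fun f n hn => ?_⟩
  have := hν f
  simp [Subst.choice] at this
  exact this n hn

/-- A number with the property `P`, if there is one. -/
noncomputable def nu (P : M.Dom Ty.nat → Prop) : M.Dom Ty.nat :=
  M.app (exists_choice M).choose (mlam fun n => chi M (P n))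

theorem nu_spec {P : M.Dom Ty.nat → Prop} [DefP M fun p : PUnit.{u+1} × M.Dom Ty.nat => P p.2]
    (h : ∃ n, P n) : P (nu P) := by
  obtain ⟨n, hn⟩ := h
  have := (exists_choice M).choose_spec (mlam fun n => chi M (P n)) n (by simpa using hn)
  rwa [app_mlam, chi_eq_zero] at this

instance def_nu {X : Type u} [Cx M X] (P : X → M.Dom Ty.nat → Prop)
    [DefP M fun p : X × M.Dom Ty.nat => P p.1 p.2] : Def fun x => nu (P x) := by
  unfold nu
  infer_instance

/-- The rational number with code `q`, as a real number. -/
noncomputable def mconst (q : M.Dom Ty.nat) : M.Dom Ty.seq := mlam fun _ => q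

@[simp] theorem V_mconst (q n : M.Dom Ty.nat) : V (mconst q) n = val q := by
  rw [V, mconst, app_mlam]

theorem MReal_mconst (q : M.Dom Ty.nat) : MReal (mconst q) := fun n i => by
  simpa using (hh_pos n).le

instance def_mconst {X : Type u} [Cx M X] (q : X → M.Dom Ty.nat) [Def q] :
    Def fun x => mconst (q x) := by
  have : Def fun p : X × M.Dom Ty.nat => q p.1 := def_comp_fst q
  unfold mconst
  infer_instance

/-- `Y` is an injection from the unit interval to the natural numbers. -/
structure IsInj (Y : M.Dom (Ty.seq ⇒ Ty.nat)) : Prop where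
  congr : ∀ x y, MUnit x → MUnit y → MEq x y → M.app Y x = M.app Y y
  inj : ∀ x y, MUnit x → MUnit y → M.app Y x = M.app Y y → MEq x y

/-- `f` is an injection from the unit interval to the rational numbers. -/
structure IsRatInj (f : M.Dom Ty.fn) : Prop where
  real : ∀ x, MUnit x → MReal (M.app f x)
  congr : ∀ x y, MUnit x → MUnit y → MEq x y → MEq (M.app f x) (M.app f y)
  rat : ∀ x, MUnit x → ∃ q, ∀ n, |V (M.app f x) n - val q| ≤ 2 * hh n
  inj : ∀ x y, MUnit x → MUnit y → MEq (M.app f x) (M.app f y) → MEq x y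

variable {Γ : Ctx} (ρ : Env M Γ)

theorem holds_NIN : (NIN : Fm Γ).Holds M ρ ↔ ¬ ∃ Y : M.Dom (Ty.seq ⇒ Ty.nat), IsInj Y := by
  simp only [NIN, Fm.holds_not, Fm.holds_ex, Fm.holds_and, Fm.holds_all, Fm.holds_imp, Fm.holds_eq,
    holds_inUnit, holds_realEq, Tm.eval_app, Tm.eval_var, Env.cons_z, Env.cons_s, and_imp]
  exact not_congr (exists_congr fun Y => ⟨fun h => ⟨h.1, h.2⟩, fun h => ⟨h.1, h.2⟩⟩)

theorem holds_isRatInjection (f : Tm Γ Ty.fn) :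
    (isRatInjection f).Holds M ρ ↔ IsRatInj (f.eval M ρ) := by
  simp only [isRatInjection, isUnitFunction, Fm.holds_ex, Fm.holds_and, Fm.holds_all, Fm.holds_imp,
    holds_inUnit, holds_isReal, holds_realEq, Tm.eval_app, Tm.eval_var, Tm.eval_wk, Env.cons_z,
    Env.cons_s, and_imp, MEq, V_realOfRat]
  exact ⟨fun h => ⟨h.1.1, h.1.2, h.2.1, h.2.2⟩, fun h => ⟨⟨h.1, h.2⟩, h.3, h.4⟩⟩

theorem holds_NINwith (P : Fm (Ty.fn :: Γ)) : (NINwith P).Holds M ρ ↔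
    ¬ ∃ f : M.Dom Ty.fn, IsRatInj f ∧ P.Holds M (ρ.cons f) := by
  simp [NINwith, holds_isRatInjection]

/-- An injection into the rational numbers gives an injection into the natural numbers: a code of
the value is chosen, depending only on the set of all codes. -/
theorem IsRatInj.exists_isInj {f : M.Dom Ty.fn} (hf : IsRatInj f) :
    ∃ Y : M.Dom (Ty.seq ⇒ Ty.nat), IsInj Y := by
  have key : ∀ x, MUnit x → MEq (M.app f x) (mconst (nu fun q => MEq (M.app f x) (mconst q))) :=
    fun x hx => nu_spec (P := fun q => MEq (M.app f x) (mconst q)) <| by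
      simpa only [MEq, V_mconst] using hf.rat x hx
  refine ⟨mlam fun x => nu fun q => MEq (M.app f x) (mconst q), ?_, ?_⟩
  · intro x y hx hy h
    rw [app_mlam, app_mlam]
    congr 1
    funext q
    have h1 := hf.congr x y hx hy h
    have hq := MReal_mconst q
    rw [MEq_iff_rv (hf.real x hx) (hf.real y hy)] at h1
    rw [MEq_iff_rv (hf.real x hx) hq, MEq_iff_rv (hf.real y hy) hq, h1]
  · intro x y hx hy h
    rw [app_mlam, app_mlam] at h
    have h1 := key x hx
    have h2 := key y hy
    rw [h] at h1
    refine hf.inj x y hx hy ?_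
    rw [MEq_iff_rv (hf.real x hx) (MReal_mconst _)] at h1
    rw [MEq_iff_rv (hf.real y hy) (MReal_mconst _)] at h2
    rw [MEq_iff_rv (hf.real x hx) (hf.real y hy), h1, h2]

theorem holds_NINwith_of_NIN (P : Fm (Ty.fn :: Γ)) (h : (NIN : Fm Γ).Holds M ρ) :
    (NINwith P).Holds M ρ := by
  rw [holds_NIN] at h
  rw [holds_NINwith]
  exact fun ⟨f, hf, _⟩ => h hf.exists_isInj

end Injections

/-! ### Finite sums -/

section Sums

variable {M : Model.{u}} [IsACA M]

/-- `S n` is the sum of the `F i` for `i < n`. -/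
structure IsSum (S F : M.Dom Ty.nat → QQ M) : Prop where
  defQ : DefQ fun p : PUnit.{u+1} × M.Dom Ty.nat => S p.2
  zero : S 0 = 0
  succ : ∀ n, S (n + 1) = S n + F n

/-- Definable functions have definable finite sums, uniformly in a parameter. -/
theorem exists_isSum {X : Type u} [Cx M X] (F : X × M.Dom Ty.nat → QQ M) [hF : DefQ F] :
    ∃ S : X × M.Dom Ty.nat → QQ M, DefQ S ∧
      ∀ x, IsSum (fun n => S (x, n)) fun n => F (x, n) := by
  obtain ⟨c, hc, hc'⟩ := hF.out
  let t (r d : M.Dom Ty.nat) := (ratAdd v0 v1).eval M ((Env.nil.cons d).cons r)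
  have ht {Z : Type u} [Cx M Z] (r d : Z → M.Dom Ty.nat) [Def r] [Def d] :
      Def fun z => t (r z) (d z) := by
    refine def_eval _ (fun σ v => ?_) _
    match v with
    | .z => exact ‹Def r›
    | .s .z => exact ‹Def d›
  obtain ⟨g, hg, hg'⟩ := hc.out
  have h2 (x : X) (n : M.Dom Ty.nat) :
      mrec (mpair 0 (mpair 0 0)) (fun k r => t r (M.app (g x) k)) (n + 1) =
        t (mrec (mpair 0 (mpair 0 0)) (fun k r => t r (M.app (g x) k)) n) (M.app (g x) n) := by
    have := ht (fun p : (PUnit.{u+1} × M.Dom Ty.nat) × M.Dom Ty.nat => p.2)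
      fun p => M.app (g x) p.1.2
    rw [mrec_succ]
  have h4 : Def fun p : X × M.Dom Ty.nat =>
      mrec (mpair 0 (mpair 0 0)) (fun k r => t r (M.app (g p.1) k)) p.2 := by
    have h5 : Def fun p : X × M.Dom Ty.nat => g p.1 := def_comp_fst g
    have h6 : Def fun p : (X × M.Dom Ty.nat) × M.Dom Ty.nat => g p.1.1 :=
      def_comp_fst fun p : X × M.Dom Ty.nat => g p.1
    have h7 : Def fun p : ((X × M.Dom Ty.nat) × M.Dom Ty.nat) × M.Dom Ty.nat => g p.1.1.1 :=
      def_comp_fst fun p : (X × M.Dom Ty.nat) × M.Dom Ty.nat => g p.1.1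
    have := ht (fun p : ((X × M.Dom Ty.nat) × M.Dom Ty.nat) × M.Dom Ty.nat => p.2)
      fun p => M.app (g p.1.1.1) p.1.2
    infer_instance
  refine ⟨fun p => val (mrec (mpair 0 (mpair 0 0)) (fun k r => t r (M.app (g p.1) k)) p.2),
    inferInstance, fun x => ⟨?_, ?_, fun n => ?_⟩⟩
  · have := Def.section
      (F := fun x n => mrec (mpair 0 (mpair 0 0)) (fun k r => t r (M.app (g x) k)) n) h4 x
    infer_instance
  · simp [val_mpair]
  · simp only [h2, t]
    rw [val_ratAdd]
    simp [hc', hg']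

theorem DefQ.comp₂ {X : Type u} [Cx M X] {σ τ : Ty} {F : M.Dom σ → M.Dom τ → QQ M}
    (hF : DefQ fun p : (PUnit.{u+1} × M.Dom σ) × M.Dom τ => F p.1.2 p.2)
    (G : X → M.Dom σ) (H : X → M.Dom τ) [Def G] [Def H] : DefQ fun x => F (G x) (H x) := by
  obtain ⟨c, hc, hc'⟩ := hF.out
  exact ⟨fun x => c ((⟨⟩, G x), H x), Def.comp₂ (F := fun a b => c ((⟨⟩, a), b)) hc G H,
    fun x => hc' _⟩

theorem IsSum.eq {S S' F F' : M.Dom Ty.nat → QQ M} (hS : IsSum S F) (hS' : IsSum S' F')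
    (n : M.Dom Ty.nat) (h : ∀ i, i < n → F i = F' i) : S n = S' n := by
  have := hS.defQ
  have := hS'.defQ
  refine induction_defP (fun k => k ≤ n → S k = S' k) (fun _ => by rw [hS.zero, hS'.zero])
    (fun k hk hn => ?_) n le_rfl
  have hlt : k < n := lt_of_lt_of_le (Num.lt_succ_iff.2 le_rfl) hn
  rw [hS.succ, hS'.succ, hk hlt.le, h k hlt]

theorem exists_isSum_ratSum {Γ : Ctx} (ρ : Env M Γ) (y : Tm Γ (Ty.nat ⇒ Ty.seq))
    (n m : Tm Γ Ty.nat) : ∃ S, IsSum S (fun k => V (M.app (y.eval M ρ) k) (m.eval M ρ)) ∧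
      val ((ratSum y n m).eval M ρ) = S (n.eval M ρ) := by
  have hd {X : Type u} [Cx M X] : Def fun p : (X × M.Dom Ty.nat) × M.Dom Ty.nat =>
      (ratAdd v0 (y.wk.wk ⋄ v1 ⋄ m.wk.wk)).eval M ((ρ.cons p.1.2).cons p.2) := by
    refine def_eval _ (fun σ v => ?_) _
    match v with
    | .z => exact def_snd
    | .s .z => exact def_fst_snd
    | .s (.s v) => exact def_const _
  refine ⟨fun n => val (mrec ((ratOfNat zero : Tm Γ Ty.nat).eval M ρ) (fun k r =>
    (ratAdd v0 (y.wk.wk ⋄ v1 ⋄ m.wk.wk)).eval M ((ρ.cons k).cons r)) n),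
    ⟨inferInstance, by simp, fun k => ?_⟩, by rw [ratSum, eval_natRec]⟩
  simp only [mrec_succ]
  rw [val_ratAdd]
  simp [V]

theorem exists_isSum_realSum {Γ : Ctx} (ρ : Env M Γ) (y : Tm Γ (Ty.nat ⇒ Ty.seq))
    (n : Tm Γ Ty.nat) (m : M.Dom Ty.nat) :
    ∃ S, IsSum S (fun k => V (M.app (y.eval M ρ) k) (m + n.eval M ρ)) ∧
      V ((realSum y n).eval M ρ) m = S (n.eval M ρ) := by
  obtain ⟨S, hS, h⟩ := exists_isSum_ratSum (ρ.cons m) y.wk n.wk (add v0 n.wk)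
  refine ⟨S, by simpa using hS, ?_⟩
  simpa [V, realSum] using h

/-- If the numbers `y i` for `i < n` are distinct, except that neighbours may coincide, then the
powers `2 ^ (-y i)` have sum at most `4`. -/
theorem IsSum.le_four {y : M.Dom Ty.seq} {S : M.Dom Ty.nat → QQ M}
    (hS : IsSum S fun i => hh (M.app y i))
    (n : M.Dom Ty.nat) (hy : ∀ i j, i < j → j < n → M.app y i = M.app y j → j = i + 1) :
    S n ≤ 4 := by
  classical
  obtain ⟨T, hT, hT'⟩ := exists_isSum
    (fun p : (PUnit.{u+1} × M.Dom Ty.nat) × M.Dom Ty.nat =>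
      if M.app y p.2 < p.1.2 then hh (M.app y p.2) else 0)
  have hdS := hS.defQ
  have hTm (m) := (hT' (⟨⟩, m)).defQ
  -- at most two indices contribute to the difference
  have step (m) : T ((⟨⟩, m + 1), n) ≤ T ((⟨⟩, m), n) + 2 * hh m := by
    have h1 : ∃ i₀, ∀ i, i < n → M.app y i = m → i = i₀ ∨ i = i₀ + 1 := by
      by_cases h : ∃ i, i < n ∧ M.app y i = m
      · obtain ⟨i₀, ⟨h1, h2⟩, h3⟩ := exists_least (fun i => i < n ∧ M.app y i = m) h
        refine ⟨i₀, fun i hi hm => ?_⟩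
        rcases lt_trichotomy i i₀ with h' | h' | h'
        · exact absurd ⟨hi, hm⟩ (h3 i h')
        · exact .inl h'
        · exact .inr (hy i₀ i h' hi (h2.trans hm.symm))
      · exact ⟨0, fun i hi hm => absurd ⟨i, hi, hm⟩ h⟩
    obtain ⟨i₀, h1⟩ := h1
    have := hh_pos m
    have := hTm m
    have := hTm (m + 1)
    have key := induction_defP (fun k => k ≤ n → T ((⟨⟩, m + 1), k) ≤ T ((⟨⟩, m), k) +
        ((if i₀ < k then hh m else 0) + if i₀ + 1 < k then hh m else 0)) (fun _ => by
          rw [(hT' _).zero, (hT' _).zero]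
          simp) (fun k hk hn => ?_) n le_rfl
    · refine key.trans ?_
      split_ifs <;> linarith
    · have hlt : k < n := lt_of_lt_of_le (Num.lt_succ_iff.2 le_rfl) hn
      have hk := hk hlt.le
      have e1 := (hT' (⟨⟩, m + 1)).succ k
      have e2 := (hT' (⟨⟩, m)).succ k
      simp only at e1 e2
      rw [e1, e2]
      by_cases hm : M.app y k = m
      · rw [hm, if_pos (Num.lt_succ_iff.2 le_rfl), if_neg (lt_irrefl _)]
        rcases h1 k hlt hm with rfl | rfl
        · rw [if_neg (lt_irrefl _), if_neg (not_lt.2 (Num.lt_succ_iff.2 le_rfl).le)] at hk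
          rw [if_pos (Num.lt_succ_iff.2 le_rfl), if_neg (lt_irrefl _)]
          linarith
        · rw [if_pos (Num.lt_succ_iff.2 le_rfl), if_neg (lt_irrefl _)] at hk
          rw [if_pos (Num.lt_succ_iff.2 (Num.lt_succ_iff.2 le_rfl).le),
            if_pos (Num.lt_succ_iff.2 le_rfl)]
          linarith
      · have : (M.app y k < m + 1) = (M.app y k < m) := by
          rw [Num.lt_succ_iff, le_iff_lt_or_eq]
          simp [hm]
        simp only [this]
        have mono (j : M.Dom Ty.nat) :
            (if j < k then hh m else 0) ≤ if j < k + 1 then hh m else 0 := by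
          by_cases h : j < k
          · rw [if_pos h, if_pos (h.trans (Num.lt_succ_iff.2 le_rfl))]
          · rw [if_neg h]
            split_ifs <;> linarith
        linarith [mono i₀, mono (i₀ + 1)]
  have h4 (m) : T ((⟨⟩, m), n) ≤ 4 - 4 * hh m := by
    have : DefQ fun p : PUnit.{u+1} × M.Dom Ty.nat => T ((⟨⟩, p.2), n) :=
      DefQ.comp₂ (F := fun a b => T ((⟨⟩, a), b)) hT
        (fun p : PUnit.{u+1} × M.Dom Ty.nat => p.2) fun _ => n
    refine induction_defP (fun m => T ((⟨⟩, m), n) ≤ 4 - 4 * hh m) ?_ (fun m hm => ?_) m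
    · have := (hT' (⟨⟩, 0)).eq (F' := fun _ => 0) (S' := fun _ => 0) ⟨inferInstance, rfl, by simp⟩ n
        (fun i _ => if_neg (Num.not_lt_zero _))
      rw [this]
      simp
    · have := step m
      rw [hh_succ]
      linarith
  obtain ⟨m, hm⟩ : ∃ m, ∀ i, i < n → M.app y i < m := by
    refine induction_defP (fun n => ∃ m, ∀ i, i < n → M.app y i < m)
      ⟨0, fun i hi => absurd hi (Num.not_lt_zero _)⟩
      (fun k ⟨m, hm⟩ => ?_) n
    refine ⟨m + M.app y k + 1, fun i hi => ?_⟩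
    rw [Num.lt_succ_iff] at hi ⊢
    rcases hi.lt_or_eq with h | rfl
    · exact (hm i h).le.trans (le_add_of_nonneg_right (Num.zero_le _))
    · exact le_add_of_nonneg_left (Num.zero_le _)
  rw [hS.eq (hT' (⟨⟩, m)) n fun i hi => (if_pos (hm i hi)).symm]
  linarith [h4 m, hh_pos m]

end Sums

/-! ### Powers of two with exponents given by an injection, and bounded variation -/

section PowFn

variable {M : Model.{u}} [IsACA M]

variable (M) in
/-- The real number `0`. -/
noncomputable def rzero : M.Dom Ty.seq := mconst (mpair 0 (mpair 0 0))

variable (M) in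
/-- The real number `1`. -/
noncomputable def rone : M.Dom Ty.seq := mconst (mpair 1 (mpair 0 0))

@[simp] theorem V_rzero (n : M.Dom Ty.nat) : V (rzero M) n = 0 := by simp [rzero, val_mpair]
@[simp] theorem V_rone (n : M.Dom Ty.nat) : V (rone M) n = 1 := by simp [rone, val_mpair]

theorem MUnit_iff {x : M.Dom Ty.seq} : MUnit x ↔ MReal x ∧ MLe (rzero M) x ∧ MLe x (rone M) := by
  simp [MUnit, MLe]

theorem MUnit.real {x : M.Dom Ty.seq} (hx : MUnit x) : MReal x := hx.1

theorem MUnit.of_eq {x y : M.Dom Ty.seq} (hx : MUnit x) (hy : MReal y) (h : MEq x y) : MUnit y := by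
  rw [MUnit_iff] at *
  rw [MEq_iff] at h
  exact ⟨hy, hx.2.1.trans (MReal_mconst _) hy h.1, h.2.trans hy (MReal_mconst _) hx.2.2⟩

open Classical in
/-- The function with value `(a - b) * 2 ^ (-Y x)` at the points `x` of the unit interval, and `0`
elsewhere. It is used for `(a, b) = (1, 0)` and for `(a, b) = (0, 1)`. -/
noncomputable def powFn (a b : M.Dom Ty.nat) (Y : M.Dom (Ty.seq ⇒ Ty.nat)) : M.Dom Ty.fn :=
  mlam fun x => mconst <|
    if MUnit x then mpair a (mpair b (mpred (mpow2 (M.app Y x)))) else mpair 0 (mpair 0 0)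

variable {a b : M.Dom Ty.nat} {Y : M.Dom (Ty.seq ⇒ Ty.nat)}

theorem V_powFn {x : M.Dom Ty.seq} (hx : MUnit x) (n : M.Dom Ty.nat) :
    V (M.app (powFn a b Y) x) n = (ofN a - ofN b) * hh (M.app Y x) := by
  rw [powFn, app_mlam, V_mconst, if_pos hx, val_mpair, mpred_add_one (mpow2_pos _), hh,
    div_eq_mul_inv]

theorem MReal_powFn (x : M.Dom Ty.seq) : MReal (M.app (powFn a b Y) x) := by
  rw [powFn, app_mlam]
  exact MReal_mconst _

theorem powFn_congr (hY : IsInj Y) {x y : M.Dom Ty.seq} (hx : MReal x) (hy : MReal y)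
    (h : MEq x y) : M.app (powFn a b Y) x = M.app (powFn a b Y) y := by
  rw [powFn, app_mlam, app_mlam]
  by_cases hu : MUnit x
  · rw [if_pos hu, if_pos (hu.of_eq hy h), hY.congr x y hu (hu.of_eq hy h) h]
  · rw [if_neg hu, if_neg fun hv => hu (MUnit.of_eq hv hx h.symm)]

theorem isRatInj_powFn (hY : IsInj Y) (hab : a ≠ b) : IsRatInj (powFn a b Y) where
  real x _ := MReal_powFn x
  congr x y hx hy h := by
    rw [powFn_congr hY hx.real hy.real h]
    exact .refl _
  rat x hx := by
    obtain ⟨q, hq⟩ := exists_val_eq ((ofN a - ofN b) * hh (M.app Y x))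
    refine ⟨q, fun n => ?_⟩
    rw [V_powFn hx, hq, sub_self, abs_zero]
    linarith [hh_pos n]
  inj x y hx hy h := by
    have h1 : |(ofN a - ofN b) * hh (M.app Y x) - (ofN a - ofN b) * hh (M.app Y y)| ≤ 0 :=
      nonpos_of_forall_le_hh two_pos fun n => by simpa only [V_powFn hx, V_powFn hy] using h n
    have h2 := sub_eq_zero.1 (abs_nonpos_iff.1 h1)
    have h3 : ofN a - ofN b ≠ 0 := fun h =>
      hab (OrdFrac.of_strictMono.injective (sub_eq_zero.1 h))
    exact hY.inj x y hx hy (hh_injective (mul_left_cancel₀ h3 h2))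

/-- `0 = x 0 < ... < x n = 1`. -/
structure MPartition (x : M.Dom (Ty.nat ⇒ Ty.seq)) (n : M.Dom Ty.nat) : Prop where
  unit : ∀ i, i ≤ n → MUnit (M.app x i)
  zero : MEq (M.app x 0) (rzero M)
  one : MEq (M.app x n) (rone M)
  lt_succ : ∀ i, i < n → ¬ MLe (M.app x (i + 1)) (M.app x i)

theorem MPartition.lt {x : M.Dom (Ty.nat ⇒ Ty.seq)} {n : M.Dom Ty.nat} (h : MPartition x n)
    {i j : M.Dom Ty.nat} (hij : i < j) (hj : j ≤ n) : rv (M.app x i) < rv (M.app x j) := by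
  have := induction_defP (fun j => j ≤ n → i < j → ¬ MLe (M.app x j) (M.app x i))
    (fun _ h => absurd h (Num.not_lt_zero _)) (fun j hj hn h' => ?_) j hj hij
  · exact (not_MLe_iff (h.unit i (hij.le.trans hj)).real (h.unit j hj).real).1 this
  · have hlt : j < n := lt_of_lt_of_le (Num.lt_succ_iff.2 le_rfl) hn
    have hi := (h.unit i (h'.le.trans hn)).real
    rcases (Num.lt_succ_iff.1 h').lt_or_eq with h' | rfl
    · have h1 := hj hlt.le h'
      have h2 := h.lt_succ j hlt
      have hj := (h.unit j hlt.le).real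
      have hj' := (h.unit (j + 1) hn).real
      rw [not_MLe_iff (by assumption) (by assumption)] at *
      exact h1.trans h2
    · exact h.lt_succ i hlt

variable {Γ : Ctx} (ρ : Env M Γ)

theorem holds_isPartition (x : Tm Γ (Ty.nat ⇒ Ty.seq)) (n : Tm Γ Ty.nat) :
    (isPartition x n).Holds M ρ ↔ MPartition (x.eval M ρ) (n.eval M ρ) := by
  simp only [isPartition, Fm.holds_and, Fm.holds_all, Fm.holds_imp, holds_le, holds_inUnit,
    holds_realEq, holds_realLt, Fm.holds_lt, Tm.eval_app, Tm.eval_var, Tm.eval_wk, Env.cons_z,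
    eval_zero, eval_succ, MEq, V_realZero, V_realOne]
  exact ⟨fun h => ⟨h.1, by simpa [MEq] using h.2.1, by simpa [MEq] using h.2.2.1, h.2.2.2⟩,
    fun h => ⟨h.1, by simpa [MEq] using h.2, by simpa [MEq] using h.3, h.4⟩⟩

/-- In a list of distinct points, each power of `2` occurs at most once among the values, so their
sum is bounded; and the variation is at most twice this sum plus the last value. -/
theorem holds_boundedVariation_powFn (hY : IsInj Y) (f : Tm Γ Ty.fn)
    (hf : f.eval M ρ = powFn 1 0 Y) : (boundedVariation f).Holds M ρ := by
  simp only [boundedVariation, Fm.holds_all, Fm.holds_imp, Fm.holds_ex,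
    holds_isPartition, holds_realLe, Tm.eval_var, Env.cons_z, Env.cons_s]
  refine ⟨9, fun n x hx m => ?_⟩
  obtain ⟨W, hW, h⟩ := exists_isSum_realSum (((ρ.cons (9 : M.Dom Ty.nat)).cons n).cons x)
    (.lam (realDist (f.wk.wk.wk.wk ⋄ (v1 ⋄ v0)) (f.wk.wk.wk.wk ⋄ (v1 ⋄ succ v0)))) v1 m
  rw [h]
  simp [hf] at hW ⊢
  obtain ⟨S, hS, hS'⟩ := exists_isSum (M := M) fun p : PUnit.{u+1} × M.Dom Ty.nat =>
    hh (M.app Y (M.app x p.2))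
  have hS' := hS' ⟨⟩
  have hSn : S (⟨⟩, n) ≤ 4 := by
    refine IsSum.le_four (y := mlam fun i => M.app Y (M.app x i)) (by simpa using hS') n
      fun i j hij hj h => ?_
    rw [app_mlam, app_mlam] at h
    have hi := hx.unit i (hij.trans hj).le
    have hj' := hx.unit j hj.le
    exact absurd ((MEq_iff_rv hi.real hj'.real).1 (hY.inj _ _ hi hj' h)) (hx.lt hij hj.le).ne
  have := hW.defQ
  have key := induction_defP
    (fun k => k ≤ n → W k ≤ 2 * S (⟨⟩, k) + hh (M.app Y (M.app x k)))
    (fun _ => by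
      rw [hW.zero, hS'.zero]
      linarith [hh_pos (M.app Y (M.app x 0))])
    (fun k hk hn => by
      have hlt : k < n := lt_of_lt_of_le (Num.lt_succ_iff.2 le_rfl) hn
      have hk := hk hlt.le
      have e := hS'.succ k
      simp only at e
      rw [hW.succ, e, V_powFn (hx.unit k hlt.le), V_powFn (hx.unit (k + 1) hn)]
      simp only [map_one, map_zero, sub_zero, one_mul]
      have h1 := abs_sub (hh (M.app Y (M.app x k))) (hh (M.app Y (M.app x (k + 1))))
      rw [abs_of_pos (hh_pos _), abs_of_pos (hh_pos _)] at h1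
      linarith) n le_rfl
  have h1 := hh_antitone (Num.zero_le (M.app Y (M.app x n)))
  rw [hh_zero] at h1
  have h9 : ofN (9 : M.Dom Ty.nat) = 9 := map_ofNat _ _
  linarith [hh_pos m]

end PowFn

/-! ### Riemann integrability -/

section Riemann

variable {M : Model.{u}} [IsACA M] {Γ : Ctx} (ρ : Env M Γ) {Y : M.Dom (Ty.seq ⇒ Ty.nat)}

@[simp] theorem holds_isPos (t : Tm Γ Ty.seq) :
    (isPos t).Holds M ρ ↔ MReal (t.eval M ρ) ∧ ¬ MLe (t.eval M ρ) (rzero M) := by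
  simp [isPos, MLe]

theorem MReal.exists_hh_le {x : M.Dom Ty.seq} (hx : MReal x) (h : ¬ MLe x (rzero M)) :
    ∃ e, ∀ m, e ≤ m → hh e ≤ V x m := by
  simpa only [V_rzero, zero_add] using MReal.exists_of_not_le (x := rzero M) (MReal_mconst _) hx h

theorem exists_mconst_eq (q : QQ M) : ∃ c : M.Dom Ty.seq, MReal c ∧ ∀ n, V c n = q := by
  obtain ⟨c, rfl⟩ := exists_val_eq q
  exact ⟨mconst c, MReal_mconst c, V_mconst c⟩

theorem not_MLe_rzero {c : M.Dom Ty.seq} {q : QQ M} (hq : 0 < q) (hc : ∀ n, V c n = q) :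
    ¬ MLe c (rzero M) := fun h =>
  hq.not_ge <| nonpos_of_forall_le_hh two_pos fun n => by simpa [hc] using h n

theorem exists_V_realMul (s t : Tm Γ Ty.seq) : ∃ k, ∀ n,
    V ((realMul s t).eval M ρ) n = V (s.eval M ρ) (n + k) * V (t.eval M ρ) (n + k) :=
  ⟨(realMulShift s t).eval M ρ, fun n => by simp [V, realMul, val_ratMul]⟩

/-- A point is the tag of at most two intervals of a partition, which are neighbours. Hence the
powers of `2` that occur in a Riemann sum have sum at most `4`. -/
theorem abs_V_riemannSum_le (hY : IsInj Y) (f : Tm Γ Ty.fn) (hf : f.eval M ρ = powFn 1 0 Y)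
    (x t : Tm Γ (Ty.nat ⇒ Ty.seq)) (n : Tm Γ Ty.nat)
    (hx : MPartition (x.eval M ρ) (n.eval M ρ))
    (ht : ∀ i, i < n.eval M ρ → MUnit (M.app (t.eval M ρ) i) ∧
      MLe (M.app (x.eval M ρ) i) (M.app (t.eval M ρ) i) ∧
      MLe (M.app (t.eval M ρ) i) (M.app (x.eval M ρ) (i + 1)))
    {δ : M.Dom Ty.seq} {q : QQ M} (hq0 : 0 ≤ q) (hδ : MReal δ) (hq : ∀ n, V δ n = q)
    (hd : ∀ i, i < n.eval M ρ →
      ¬ MLe δ (mdiff (M.app (x.eval M ρ) (i + 1)) (M.app (x.eval M ρ) i)))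
    (m : M.Dom Ty.nat) : |V ((riemannSum f x t n).eval M ρ) m| ≤ 4 * (q + 2 * hh m) := by
  obtain ⟨W, hW, h⟩ := exists_isSum_realSum ρ
    (.lam (realMul (f.wk ⋄ (t.wk ⋄ v0)) (realSub (x.wk ⋄ succ v0) (x.wk ⋄ v0)))) n m
  rw [riemannSum, h]
  set n' := n.eval M ρ
  set x' := x.eval M ρ with hx'
  set t' := t.eval M ρ with ht'
  obtain ⟨S, hS, hS'⟩ := exists_isSum (M := M) fun p : PUnit.{u+1} × M.Dom Ty.nat =>
    hh (M.app Y (M.app t' p.2))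
  have hS' := hS' ⟨⟩
  have hSn : S (⟨⟩, n') ≤ 4 := by
    refine IsSum.le_four (y := mlam fun i => M.app Y (M.app t' i)) (by simpa using hS') n'
      fun i j hij hj h => ?_
    rw [app_mlam, app_mlam] at h
    obtain ⟨hi, -, hi'⟩ := ht i (hij.trans hj)
    obtain ⟨hj', hj'', -⟩ := ht j hj
    have e := (MEq_iff_rv hi.real hj'.real).1 (hY.inj _ _ hi hj' h)
    by_contra hne
    have hlt : i + 1 < j := by
      exact (Num.succ_le_of_lt hij).lt_of_ne (Ne.symm hne)
    have hxi := (hx.unit (i + 1) (hlt.trans hj).le).real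
    rw [MLe_iff hi.real hxi] at hi'
    rw [MLe_iff (hx.unit j hj.le).real hj'.real] at hj''
    have := hx.lt hlt hj.le
    linarith
  have hterm (i) (hi : i < n') : |V (M.app ((Tm.lam (realMul (f.wk ⋄ (t.wk ⋄ v0))
      (realSub (x.wk ⋄ succ v0) (x.wk ⋄ v0)))).eval M ρ) i) (m + n')| ≤
        hh (M.app Y (M.app t' i)) * (q + 2 * hh m) := by
    obtain ⟨k, hk⟩ := exists_V_realMul (ρ.cons i) (f.wk ⋄ (t.wk ⋄ v0))
      (realSub (x.wk ⋄ succ v0) (x.wk ⋄ v0))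
    have h0 := hd i hi
    have hxi := (hx.unit i hi.le).real
    have hxi' := (hx.unit (i + 1) (Num.succ_le_of_lt hi)).real
    have hdr := hxi'.sub hxi
    have h1 := (MLe_iff hdr hδ).2 ((not_MLe_iff hdr hδ).1 h0).le (m + n' + k)
    have h2 := (MLe_iff hxi hxi').2 ((not_MLe_iff hxi hxi').1 (hx.lt_succ i hi)).le (m + n' + k + 1)
    have h3 : hh (m + n' + k) ≤ hh m := hh_antitone (by
      rw [add_assoc]; exact le_add_of_nonneg_right (Num.zero_le _))
    have h4 := hh_pos (m + n' + k)
    have h5 : |V (mdiff (M.app x' (i + 1)) (M.app x' i)) (m + n' + k)| ≤ q + 2 * hh m := by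
      rw [hq] at h1
      rw [hh_succ] at h2
      rw [abs_le]
      have := V_mdiff (M.app x' (i + 1)) (M.app x' i) (m + n' + k)
      constructor <;> linarith
    rw [Tm.eval_lam, hk, abs_mul]
    simp only [Tm.eval_app, Tm.eval_wk, Tm.eval_var, Env.cons_z, eval_realSub, eval_succ, hf]
    rw [V_powFn (ht i hi).1, map_one, map_zero, sub_zero, one_mul, abs_of_pos (hh_pos _)]
    exact mul_le_mul_of_nonneg_left h5 (hh_pos _).le
  have := hW.defQ
  have key := induction_defP
    (fun k => k ≤ n' → |W k| ≤ S (⟨⟩, k) * (q + 2 * hh m))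
    (fun _ => by
      rw [hW.zero, hS'.zero]
      simp)
    (fun k hk hn => by
      have hlt : k < n' := lt_of_lt_of_le (Num.lt_succ_iff.2 le_rfl) hn
      have hk := hk hlt.le
      have e := hS'.succ k
      simp only at e
      rw [hW.succ, e, add_mul]
      exact (abs_add_le _ _).trans (add_le_add hk (hterm k hlt))) n' le_rfl
  exact key.trans (mul_le_mul_of_nonneg_right hSn (by linarith [hh_pos m]))

/-- The integral of `powFn 1 0 Y` is `0`. -/
theorem holds_riemannIntegrable_powFn (hY : IsInj Y) (f : Tm Γ Ty.fn)
    (hf : f.eval M ρ = powFn 1 0 Y) : (riemannIntegrable f).Holds M ρ := by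
  simp only [riemannIntegrable, Fm.holds_all, Fm.holds_imp, Fm.holds_ex, Fm.holds_and,
    holds_isPartition, holds_realLe, holds_realLt, holds_isReal, holds_isPos, holds_inUnit,
    Fm.holds_lt, eval_realDist, eval_realSub, Tm.eval_app, eval_succ, Tm.eval_var,
    Env.cons_z, Env.cons_s]
  refine ⟨rzero M, MReal_mconst _, fun ε ⟨hε, hε'⟩ => ?_⟩
  obtain ⟨e, he⟩ := hε.exists_hh_le hε'
  obtain ⟨δ, hδ, hδ'⟩ := exists_mconst_eq (hh (e + 1 + 1 + 1 + 1))
  refine ⟨δ, ⟨hδ, not_MLe_rzero (hh_pos _) hδ'⟩, fun n x t ⟨hx, ht⟩ hle => ?_⟩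
  -- the approximation with index `e + 4` is precise enough:
  -- `4 * (δ + 2 * 2 ^ (-m - 1)) + 2 * 2 ^ (-m)` is less than `2 ^ (-e)` for `m = e + 4` and `δ = 2 ^ (-m)`
  set m := e + 1 + 1 + 1 + 1 with hm
  have hle := hle m
  have hem := he m (by simp only [hm, add_assoc]; exact le_add_of_nonneg_right (Num.zero_le _))
  rw [V_mdist] at hle
  simp only [V_rzero, sub_zero] at hle
  have := abs_V_riemannSum_le ((((((ρ.cons (rzero M)).cons ε).cons δ).cons n).cons x).cons t) hY
    f.wk.wk.wk.wk.wk.wk (by simpa using hf) v1 v0 v2 hx (fun i hi => (ht i hi).2)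
    (hh_pos _).le hδ hδ'
    (fun i hi => (ht i hi).1) (m + 1)
  have := hh_pos e
  simp only [hm, hh_succ] at *
  linarith

end Riemann

/-! ### Canonical names of reals, and the principle `IND0` -/

section Names

variable {M : Model.{u}} [IsACA M]

theorem exists_seq (F : M.Dom Ty.nat → QQ M)
    [h : DefQ fun p : PUnit.{u+1} × M.Dom Ty.nat => F p.2] :
    ∃ x : M.Dom Ty.seq, ∀ n, V x n = F n := by
  obtain ⟨c, hc, hc'⟩ := h.out
  obtain ⟨g, hg⟩ := Def.exists_app (F := fun n => c (⟨⟩, n)) hc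
  exact ⟨g, fun n => by rw [V, hg, hc']⟩

/-- The characteristic function of the set of all (codes of) rational numbers below `x`. It depends
on the real number `x` only. -/
noncomputable def cut (x : M.Dom Ty.seq) : M.Dom Ty.seq := mlam fun q => chi M (¬ MLe x (mconst q))

instance def_cut {X : Type u} [Cx M X] (F : X → M.Dom Ty.seq) [Def F] :
    Def fun x => cut (F x) := by
  have : Def fun p : X × M.Dom Ty.nat => F p.1 := def_comp_fst F
  unfold cut
  infer_instance

theorem app_cut {x : M.Dom Ty.seq} {q : M.Dom Ty.nat} :
    M.app (cut x) q = 0 ↔ ¬ MLe x (mconst q) := by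
  rw [cut, app_mlam, chi_eq_zero]

theorem cut_congr {x y : M.Dom Ty.seq} (hx : MReal x) (hy : MReal y) (h : MEq x y) :
    cut x = cut y := by
  unfold cut
  congr 1
  funext q
  rw [MLe_iff hx (MReal_mconst q), MLe_iff hy (MReal_mconst q), rv_congr hx hy h]

/-- A real number with lower cut `f`: its `n`-th approximation is a rational number `q` such that
`q` belongs to the cut and `q + 2 ^ (-(n + 1))` does not. -/
noncomputable def uncut (f : M.Dom Ty.seq) : M.Dom Ty.seq := mlam fun n => nu fun q =>
  M.app f q = 0 ∧ ∀ q', val q' = val q + hh (n + 1) → M.app f q' ≠ 0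

instance def_uncut {X : Type u} [Cx M X] (F : X → M.Dom Ty.seq) [Def F] :
    Def fun x => uncut (F x) := by
  refine Def.comp (F := uncut) ?_ F
  unfold uncut
  infer_instance

/-- Up to the error of the approximations of `x`, `x - 2 ^ (-(n + 1)) ≤ q ≤ x` where `q` is
the `n`-th approximation of `uncut (cut x)`. -/
theorem uncut_cut_spec {x : M.Dom Ty.seq} (hx : MReal x) (n m : M.Dom Ty.nat) :
    V (uncut (cut x)) n ≤ V x m + 2 * hh m ∧
      V x m ≤ V (uncut (cut x)) n + hh (n + 1) + 2 * hh m := by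
  have h : ∃ q, M.app (cut x) q = 0 ∧ ∀ q', val q' = val q + hh (n + 1) → M.app (cut x) q' ≠ 0 := by
    -- with precision `2 ^ (-k)`, an eighth of `2 ^ (-(n + 1))`, there is room on both sides of `x`
    set k := n + 1 + 1 + 1 + 1 with hk
    obtain ⟨q, hq⟩ := exists_val_eq (V x k - 3 * hh k)
    have hkpos := hh_pos k
    refine ⟨q, ?_, fun q' hq' => ?_⟩
    · rw [app_cut]
      intro h
      have := h (k + 1 + 1)
      rw [V_mconst, hq, hh_succ (k + 1), hh_succ k] at this
      have h1 := abs_le.1 (hx k (1 + 1))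
      rw [← add_assoc] at h1
      linarith
    · rw [Ne, app_cut, not_not]
      intro j
      rw [V_mconst, hq', hq]
      have h1 : |V x j - V x k| ≤ hh j + hh k := by
        have := hh_pos j
        rcases le_total j k with h | h
        · linarith [hx.dist_le h]
        · rw [abs_sub_comm]
          linarith [hx.dist_le h]
      have h2 : hh (n + 1) = 8 * hh k := by
        simp only [hk, hh_succ]
        ring
      linarith [(abs_le.1 h1).2, hh_pos j]
  obtain ⟨h1, h2⟩ := nu_spec h
  have hV : V (uncut (cut x)) n = val (nu fun q => M.app (cut x) q = 0 ∧
      ∀ q', val q' = val q + hh (n + 1) → M.app (cut x) q' ≠ 0) := by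
    rw [V, uncut, app_mlam]
  rw [hV]
  generalize (nu fun q => M.app (cut x) q = 0 ∧
    ∀ q', val q' = val q + hh (n + 1) → M.app (cut x) q' ≠ 0) = q at *
  constructor
  · rw [app_cut, not_MLe_iff (MReal_mconst q) hx] at h1
    simpa using (MLe_iff (MReal_mconst q) hx).2 h1.le m
  · obtain ⟨q', hq'⟩ := exists_val_eq (val q + hh (n + 1))
    have := h2 q' hq'
    rw [Ne, app_cut, not_not] at this
    have := this m
    rwa [V_mconst, hq'] at this

theorem MReal_uncut_cut {x : M.Dom Ty.seq} (hx : MReal x) : MReal (uncut (cut x)) := fun n i => by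
  refine le_of_forall_le_add_hh (c := 4) (by norm_num) fun m => ?_
  have h1 := uncut_cut_spec hx n m
  have h2 := uncut_cut_spec hx (n + i) m
  have h3 : hh (n + i + 1) ≤ hh (n + 1) := hh_antitone (by
    rw [add_assoc, add_comm i, ← add_assoc]; exact le_add_of_nonneg_right (Num.zero_le _))
  have h4 := hh_pos (n + 1)
  have h5 : hh n = 2 * hh (n + 1) := by rw [hh_succ]; ring
  rw [h5, abs_le]
  constructor <;> linarith

theorem MEq_uncut_cut {x : M.Dom Ty.seq} (hx : MReal x) : MEq (uncut (cut x)) x := by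
  have h (n) := uncut_cut_spec hx n n
  simp only [hh_succ] at h
  refine MEq_iff.2 ⟨(MReal_uncut_cut hx).le_of_forall hx (c := 3) (by norm_num) fun n => ?_,
    hx.le_of_forall (MReal_uncut_cut hx) (c := 3) (by norm_num) fun n => ?_⟩
  · linarith [h n, hh_pos n]
  · linarith [h n, hh_pos n]

variable (M) in
/-- The structure `M` satisfies `IND0`. -/
class HasIND0 : Prop where
  holds : IND0.Holds M Env.nil

/-- `IND0` as a statement on the objects of the model. -/
theorem HasIND0.exists_list [HasIND0 M] (Z : M.Dom (Ty.seq ⇒ Ty.nat ⇒ Ty.nat))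
    (hZ : ∀ n f g, (∀ k, M.app f k ≤ 1) → (∀ k, M.app g k ≤ 1) → M.app (M.app Z f) n = 0 →
      M.app (M.app Z g) n = 0 → f = g) (k : M.Dom Ty.nat) :
    ∃ (l : M.Dom Ty.nat) (w : M.Dom (Ty.nat ⇒ Ty.seq)), ∀ m, m ≤ k →
      ∀ f, (∀ k, M.app f k ≤ 1) → M.app (M.app Z f) m = 0 →
        ∃ i, i < l ∧ M.app (M.app Z (M.app w i)) m = 0 := by
  have h := HasIND0.holds (M := M)
  simp only [IND0, isBinary, Fm.holds_all, Fm.holds_imp, Fm.holds_and, Fm.holds_eq, Fm.holds_ex,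
    Fm.holds_iff, Fm.holds_lt, holds_le, Tm.eval_app, Tm.eval_wk, Tm.eval_var, Env.cons_z,
    Env.cons_s, eval_zero, eval_one] at h
  obtain ⟨l, w, hw⟩ := h Z (fun n f g h => hZ n f g h.1 h.2.1 h.2.2.1 h.2.2.2) k
  refine ⟨l, w, fun m hm f hf hfm => ?_⟩
  obtain ⟨i, hi, -, h⟩ := (hw m hm).2 ⟨f, hf, hfm⟩
  exact ⟨i, hi, h⟩

/-- The points of the unit interval at which `Y` takes values at most `k` can be listed. -/
theorem IsInj.exists_list [HasIND0 M] {Y : M.Dom (Ty.seq ⇒ Ty.nat)} (hY : IsInj Y)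
    (k : M.Dom Ty.nat) : ∃ (l : M.Dom Ty.nat) (z : M.Dom (Ty.nat ⇒ Ty.seq)),
      ∀ x, MUnit x → M.app Y x ≤ k → ∃ i, i < l ∧ MUnit (M.app z i) ∧ MEq (M.app z i) x := by
  -- the name `f` of a real number with `Y`-value `m` is unique, being the cut of that real
  have hP (f : M.Dom Ty.seq) (m : M.Dom Ty.nat) :
      M.app (M.app (mlam fun f => mlam fun m => chi M (MUnit (uncut f) ∧
        (∀ q, M.app (cut (uncut f)) q = M.app f q) ∧ M.app Y (uncut f) = m)) f) m = 0 ↔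
      MUnit (uncut f) ∧ (∀ q, M.app (cut (uncut f)) q = M.app f q) ∧ M.app Y (uncut f) = m := by
    rw [app_mlam, app_mlam, chi_eq_zero]
  obtain ⟨l, w, hw⟩ := HasIND0.exists_list (mlam fun f => mlam fun m => chi M (MUnit (uncut f) ∧
    (∀ q, M.app (cut (uncut f)) q = M.app f q) ∧ M.app Y (uncut f) = m)) (fun n f g _ _ hf hg => by
      rw [hP] at hf hg
      rw [← app_ext hf.2.1, ← app_ext hg.2.1]
      exact cut_congr hf.1.real hg.1.real (hY.inj _ _ hf.1 hg.1 (hf.2.2.trans hg.2.2.symm))) k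
  refine ⟨l, mlam fun i => uncut (M.app w i), fun x hx hk => ?_⟩
  have hu := MReal_uncut_cut hx.real
  have he := MEq_uncut_cut hx.real
  have hux := hx.of_eq hu he.symm
  obtain ⟨i, hi, h⟩ := hw (M.app Y x) hk (cut x) (fun q => by
      rw [cut, app_mlam, chi]
      split_ifs
      exacts [le_rfl, Num.zero_le (1 : M.Dom Ty.nat)]) (by
    rw [hP]
    exact ⟨hux, fun q => by rw [cut_congr hu hx.real he], hY.congr _ _ hux hx he⟩)
  rw [hP] at h
  refine ⟨i, hi, ?_⟩
  rw [app_mlam]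
  exact ⟨h.1, hY.inj _ _ h.1 hx h.2.2⟩

/-- Every point of the unit interval has a punctured neighbourhood in which `Y` takes values larger
than `k` only. -/
theorem IsInj.exists_isolated [HasIND0 M] {Y : M.Dom (Ty.seq ⇒ Ty.nat)} (hY : IsInj Y)
    (k : M.Dom Ty.nat) {x : M.Dom Ty.seq} (hx : MUnit x) :
    ∃ d, ∀ y, MUnit y → ¬ MEq y x → M.app Y y ≤ k → tr (hh d) ≤ |rv y - rv x| := by
  obtain ⟨l, z, hz⟩ := hY.exists_list k
  have h : ∃ d, ∀ i, i < l → MUnit (M.app z i) → ¬ MEq (M.app z i) x →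
      ∀ m, d ≤ m → hh d ≤ |V (M.app z i) m - V x m| := by
    refine induction_defP (fun l => ∃ d, ∀ i, i < l → MUnit (M.app z i) → ¬ MEq (M.app z i) x →
      ∀ m, d ≤ m → hh d ≤ |V (M.app z i) m - V x m|)
      ⟨0, fun i hi => absurd hi (Num.not_lt_zero _)⟩ (fun l ⟨d, hd⟩ => ?_) l
    have h1 : ∃ d', MUnit (M.app z l) → ¬ MEq (M.app z l) x →
        ∀ m, d' ≤ m → hh d' ≤ |V (M.app z l) m - V x m| := by
      by_cases hl : MUnit (M.app z l)
      · by_cases hne : MEq (M.app z l) x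
        · exact ⟨0, fun _ h => absurd hne h⟩
        · rw [MEq_iff, not_and_or] at hne
          rcases hne with h | h
          · obtain ⟨e, he⟩ := hx.real.exists_of_not_le hl.real h
            exact ⟨e, fun _ _ m hm => le_trans (by linarith [he m hm]) (le_abs_self _)⟩
          · obtain ⟨e, he⟩ := hl.real.exists_of_not_le hx.real h
            exact ⟨e, fun _ _ m hm => le_trans (by linarith [he m hm]) (neg_le_abs _)⟩
      · exact ⟨0, fun h => absurd h hl⟩
    obtain ⟨d', hd'⟩ := h1
    refine ⟨d + d', fun i hi hu hne m hm => ?_⟩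
    rcases (Num.lt_succ_iff.1 hi).lt_or_eq with h | rfl
    · exact (hh_antitone (le_add_of_nonneg_right (Num.zero_le _))).trans
        (hd i h hu hne m ((le_add_of_nonneg_right (Num.zero_le _)).trans hm))
    · exact (hh_antitone (le_add_of_nonneg_left (Num.zero_le _))).trans
        (hd' hu hne m ((le_add_of_nonneg_left (Num.zero_le _)).trans hm))
  obtain ⟨d, hd⟩ := h
  refine ⟨d + 1, fun y hy hne hk => ?_⟩
  obtain ⟨i, hi, hzi, hzy⟩ := hz y hy hk
  have e := rv_congr hzi.real hy.real hzy
  have h1 := hd i hi hzi (fun h => hne (by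
    rw [MEq_iff_rv (by exact hzi.real) hx.real] at h
    rw [MEq_iff_rv hy.real hx.real, ← e, h])) (d + 1 + 1 + 1)
    (by simp only [add_assoc]; exact le_add_of_nonneg_right (Num.zero_le _))
  have h2 := hzi.real.abs_rv_sub_le (d + 1 + 1 + 1)
  have h3 := hx.real.abs_rv_sub_le (d + 1 + 1 + 1)
  rw [← tr_le, tr_abs, map_sub] at h1
  rw [← e]
  have h4 := abs_sub_abs_le_abs_sub (tr (V (M.app z i) (d + 1 + 1 + 1)) - tr (V x (d + 1 + 1 + 1)))
    (rv (M.app z i) - rv x)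
  have h5 : |tr (V (M.app z i) (d + 1 + 1 + 1)) - tr (V x (d + 1 + 1 + 1)) -
      (rv (M.app z i) - rv x)| ≤ 4 * tr (hh (d + 1 + 1 + 1)) := by
    rw [abs_le] at *
    constructor <;> linarith
  simp only [hh_succ, map_div₀, map_ofNat] at *
  linarith

end Names

/-! ### Semicontinuity and cliquishness -/

section Semicontinuous

variable {M : Model.{u}} [IsACA M]

/-- Beside any point there is a ball in the unit interval, as close as desired, that does not
contain the point. -/
theorem exists_ball_beside {x : M.Dom Ty.seq} (hx : MUnit x) (d : M.Dom Ty.nat) :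
    ∃ c r, MUnit c ∧ MReal r ∧ ¬ MLe r (rzero M) ∧
      ∀ y, (∃ j, |rv y - rv c| + tr (hh j) ≤ rv r) →
      0 < |rv y - rv x| ∧ |rv y - rv x| + tr (hh (d + 1 + 1)) < tr (hh d) := by
  obtain ⟨r, hr, hr'⟩ := exists_mconst_eq (hh (d + 1 + 1 + 1))
  have key : ∃ c, MUnit c ∧ ((∀ n, V c n = V x n + hh (d + 1)) ∨
      (∀ n, V c n = V x n - hh (d + 1))) := by
    have h2 : hh d ≤ 1 := by simpa using hh_antitone (Num.zero_le d)
    obtain ⟨hx1, hx2, hx3⟩ := hx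
    have hdpos := hh_pos d
    rcases le_total (rv x) (tr (1 / 2)) with h | h
    · obtain ⟨c, hc⟩ := exists_seq fun n => V x n + hh (d + 1)
      refine ⟨c, ⟨fun n i => ?_, fun n => ?_, fun n => ?_⟩, .inl hc⟩
      · rw [hc, hc, add_sub_add_right_eq_sub]
        exact hx1 n i
      · rw [hc]
        linarith [hx2 n, hh_pos (d + 1)]
      · have h1 := (abs_le.1 (hx1.abs_rv_sub_le n)).1
        have h4 : V x n ≤ 1 / 2 + 2 * hh n := by
          rw [← tr_le, map_add, map_mul, map_ofNat]
          linarith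
        rw [hc, hh_succ]
        linarith
    · obtain ⟨c, hc⟩ := exists_seq fun n => V x n - hh (d + 1)
      refine ⟨c, ⟨fun n i => ?_, fun n => ?_, fun n => ?_⟩, .inr hc⟩
      · rw [hc, hc, sub_sub_sub_cancel_right]
        exact hx1 n i
      · have h1 := (abs_le.1 (hx1.abs_rv_sub_le n)).2
        have h4 : 1 / 2 ≤ V x n + 2 * hh n := by
          rw [← tr_le, map_add, map_mul, map_ofNat]
          linarith
        rw [hc, hh_succ]
        linarith
      · rw [hc]
        linarith [hx3 n, hh_pos (d + 1)]
  obtain ⟨c, hc, hc'⟩ := key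
  refine ⟨c, r, hc, hr, not_MLe_rzero (hh_pos _) hr', fun y ⟨j, hj⟩ => ?_⟩
  have h1 := abs_le.1 (hr.abs_rv_sub_le (d + 1 + 1 + 1 + 1 + 1 + 1))
  have h2 := abs_le.1 (hc.real.abs_rv_sub_le (d + 1 + 1 + 1 + 1 + 1 + 1))
  have h3 := abs_le.1 (hx.real.abs_rv_sub_le (d + 1 + 1 + 1 + 1 + 1 + 1))
  have h4 := tr_hh_pos j
  have h5 := tr_hh_pos d
  have h6 : |rv y - rv c| < rv r := by linarith
  rw [abs_lt] at h6
  rw [hr'] at h1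
  rcases hc' with hc' | hc' <;> rw [hc'] at h2
  · simp only [hh_succ, map_add, map_div₀, map_ofNat] at *
    rw [abs_of_pos (by linarith)]
    constructor <;> linarith
  · simp only [hh_succ, map_sub, map_div₀, map_ofNat] at *
    rw [abs_of_neg (by linarith)]
    constructor <;> linarith

variable [HasIND0 M] {Γ : Ctx} (ρ : Env M Γ) {Y : M.Dom (Ty.seq ⇒ Ty.nat)}

/-- Near a given point, the values of `Y` are large except at the point itself. The distance of `x`
and `y` is bounded in the form in which `dist_lt_iff` expresses it. -/
theorem IsInj.exists_nhds (hY : IsInj Y) (k : M.Dom Ty.nat) {x : M.Dom Ty.seq} (hx : MUnit x) :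
    ∃ δ, MReal δ ∧ ¬ MLe δ (rzero M) ∧ ∀ y, MUnit y →
      (∃ j, |rv y - rv x| + tr (hh j) ≤ rv δ) → MEq y x ∨ k < M.app Y y := by
  obtain ⟨d, hd⟩ := hY.exists_isolated k hx
  obtain ⟨δ, hδ, hδ'⟩ := exists_mconst_eq (hh (d + 1))
  refine ⟨δ, hδ, not_MLe_rzero (hh_pos _) hδ', fun y hy ⟨j, hj⟩ => ?_⟩
  by_contra! h
  have h1 := hd y hy h.1 h.2
  have h2 := abs_le.1 (hδ.abs_rv_sub_le (d + 1 + 1))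
  have h3 := tr_hh_pos j
  rw [hδ'] at h2
  simp only [hh_succ, map_div₀, map_ofNat] at *
  linarith

theorem holds_upperSemicontinuous_powFn (hY : IsInj Y) (f : Tm Γ Ty.fn)
    (hf : f.eval M ρ = powFn 1 0 Y) : (upperSemicontinuous f).Holds M ρ := by
  simp only [upperSemicontinuous, Fm.holds_all, Fm.holds_imp, Fm.holds_ex, Fm.holds_and,
    holds_isPos, holds_inUnit, holds_realLt, eval_realDist, eval_realAdd, Tm.eval_app, Tm.eval_wk,
    Tm.eval_var, Env.cons_z, Env.cons_s, hf]
  refine fun x ε ⟨hx, hε, hε'⟩ => ?_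
  obtain ⟨e, he⟩ := hε.exists_hh_le hε'
  obtain ⟨δ, hδ, hδ', h⟩ := hY.exists_nhds e hx
  refine ⟨δ, ⟨hδ, hδ'⟩, fun y ⟨hy, hyx⟩ hle => ?_⟩
  rw [dist_lt_iff hy.real hx.real hδ] at hyx
  have h1 := he (e + 1 + 1 + 1 + 1) (by
    simp only [add_assoc]; exact le_add_of_nonneg_right (Num.zero_le _))
  have h2 := hle (e + 1 + 1 + 1)
  rw [V_madd, V_powFn hx, V_powFn hy] at h2
  have h3 := hh_pos e
  have h4 := hh_pos (M.app Y x)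
  have h5 := hh_pos (M.app Y y)
  rcases h y hy hyx with h | h
  · rw [hY.congr y x hy hx h] at h2
    simp only [map_one, map_zero, sub_zero, one_mul, hh_succ] at h2
    linarith
  · have h6 := hh_antitone (Num.succ_le_of_lt h)
    simp only [map_one, map_zero, sub_zero, one_mul, hh_succ] at h2 h6
    linarith

theorem holds_lowerSemicontinuous_powFn (hY : IsInj Y) (f : Tm Γ Ty.fn)
    (hf : f.eval M ρ = powFn 0 1 Y) : (lowerSemicontinuous f).Holds M ρ := by
  simp only [lowerSemicontinuous, Fm.holds_all, Fm.holds_imp, Fm.holds_ex, Fm.holds_and,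
    holds_isPos, holds_inUnit, holds_realLt, eval_realDist, eval_realAdd, Tm.eval_app, Tm.eval_wk,
    Tm.eval_var, Env.cons_z, Env.cons_s, hf]
  refine fun x ε ⟨hx, hε, hε'⟩ => ?_
  obtain ⟨e, he⟩ := hε.exists_hh_le hε'
  obtain ⟨δ, hδ, hδ', h⟩ := hY.exists_nhds e hx
  refine ⟨δ, ⟨hδ, hδ'⟩, fun y ⟨hy, hyx⟩ hle => ?_⟩
  rw [dist_lt_iff hy.real hx.real hδ] at hyx
  have h1 := he (e + 1 + 1 + 1 + 1) (by
    simp only [add_assoc]; exact le_add_of_nonneg_right (Num.zero_le _))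
  have h2 := hle (e + 1 + 1 + 1)
  rw [V_madd, V_powFn hx, V_powFn hy] at h2
  have h3 := hh_pos e
  have h4 := hh_pos (M.app Y x)
  have h5 := hh_pos (M.app Y y)
  rcases h y hy hyx with h | h
  · rw [hY.congr y x hy hx h] at h2
    simp only [map_one, map_zero, zero_sub, hh_succ] at h2
    linarith
  · have h6 := hh_antitone (Num.succ_le_of_lt h)
    simp only [map_one, map_zero, zero_sub, hh_succ] at h2 h6
    linarith

/-- In a small ball beside `x` all values of `powFn 1 0 Y` are small. -/
theorem holds_cliquish_powFn (hY : IsInj Y) (f : Tm Γ Ty.fn)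
    (hf : f.eval M ρ = powFn 1 0 Y) : (cliquish f).Holds M ρ := by
  simp only [cliquish, Fm.holds_all, Fm.holds_imp, Fm.holds_ex, Fm.holds_and,
    holds_isPos, holds_inUnit, holds_realLt, eval_realDist, Tm.eval_app, Tm.eval_wk,
    Tm.eval_var, Env.cons_z, Env.cons_s, hf]
  refine fun x ε δ ⟨hx, ⟨hε, hε'⟩, hδ, hδ'⟩ => ?_
  obtain ⟨e, he⟩ := hε.exists_hh_le hε'
  obtain ⟨e', he'⟩ := hδ.exists_hh_le hδ'
  obtain ⟨d, hd⟩ := hY.exists_isolated (e + 1) hx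
  obtain ⟨c, r, hc, hr, hr', hball⟩ := exists_ball_beside hx (d + (e' + 1))
  have hd1 : tr (hh (d + (e' + 1))) ≤ tr (hh d) :=
    tr_le.2 (hh_antitone (le_add_of_nonneg_right (Num.zero_le _)))
  have hd2 : tr (hh (d + (e' + 1))) ≤ tr (hh (e' + 1)) := tr_le.2 (hh_add_le _ _)
  have hlarge (y) (hy : MUnit y) (h : ∃ j, |rv y - rv c| + tr (hh j) ≤ rv r) :
      hh (M.app Y y) ≤ hh (e + 1 + 1) := by
    obtain ⟨h1, h2⟩ := hball y h
    have h3 := tr_hh_pos (d + (e' + 1) + 1 + 1)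
    rcases lt_or_ge (e + 1) (M.app Y y) with h | h
    · exact hh_antitone (Num.succ_le_of_lt h)
    · have := hd y hy (fun h => by
        rw [MEq_iff_rv hy.real hx.real] at h
        simp [h] at h1) h
      linarith
  refine ⟨c, r, ⟨hc, ⟨hr, hr'⟩, fun y ⟨hy, hyc⟩ => ?_, fun y z ⟨hy, hz, hyc, hzc⟩ => ?_⟩⟩
  · rw [dist_lt_iff hy.real hc.real hr] at hyc
    rw [dist_lt_iff hy.real hx.real hδ]
    obtain ⟨h1, h2⟩ := hball y hyc
    refine ⟨d + (e' + 1) + 1 + 1, h2.le.trans (hd2.trans ?_)⟩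
    have h3 := abs_le.1 (hδ.abs_rv_sub_le (e' + 1 + 1))
    have h4 := he' (e' + 1 + 1) (by
      simp only [add_assoc]; exact le_add_of_nonneg_right (Num.zero_le _))
    rw [← tr_le] at h4
    simp only [hh_succ, map_div₀, map_ofNat] at *
    linarith
  · rw [dist_lt_iff hy.real hc.real hr] at hyc
    rw [dist_lt_iff hz.real hc.real hr] at hzc
    have h1 := hlarge y hy hyc
    have h2 := hlarge z hz hzc
    intro hle
    have hle := hle (e + 1 + 1 + 1)
    have := he (e + 1 + 1 + 1) (by
      simp only [add_assoc]; exact le_add_of_nonneg_right (Num.zero_le _))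
    rw [V_mdist, V_powFn hy, V_powFn hz] at hle
    simp only [map_one, map_zero, sub_zero, one_mul] at hle
    have h3 := hh_pos (M.app Y y)
    have h4 := hh_pos (M.app Y z)
    have h5 : |hh (M.app Y y) - hh (M.app Y z)| ≤ hh (e + 1 + 1) :=
      abs_le.2 ⟨by linarith, by linarith⟩
    have h6 := hh_pos e
    simp only [hh_succ] at hle h5
    linarith

end Semicontinuous

/-! ### Borel functions -/

section Borel

variable {M : Model.{u}} [IsACA M]

theorem chi_eq_one {p : Prop} : chi M p = 1 ↔ ¬ p := by
  unfold chi
  split_ifs with h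
  · simp [h]
  · simp [h]

theorem chi_le_one (p : Prop) : chi M p ≤ 1 := by
  unfold chi
  split_ifs
  exacts [Num.zero_le (1 : M.Dom Ty.nat), le_rfl]

section

variable {Γ : Ctx} (ρ : Env M Γ)

@[simp] theorem eval_realOfRat (q : Tm Γ Ty.nat) :
    (realOfRat q).eval M ρ = mconst (q.eval M ρ) :=
  app_ext fun n => by simp [realOfRat, mconst]

/-- A sufficient condition for the sets `{x | P n x}` to be a Borel construction. -/
theorem holds_isBorelConstruction {P : M.Dom Ty.nat → M.Dom Ty.seq → Prop}
    [hP : DefP M fun p : (PUnit.{u+1} × M.Dom Ty.nat) × M.Dom Ty.seq => P p.1.2 p.2]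
    (congr : ∀ n x y, MUnit x → MUnit y → MEq x y → P n x → P n y)
    {D : Tm Γ (Ty.nat ⇒ Ty.seq ⇒ Ty.nat)} {r : Tm Γ (Ty.nat ⇒ Ty.nat ⇒ Ty.nat)}
    (hD : D.eval M ρ = mlam fun n => mlam fun x => chi M (¬ P n x))
    (wf : ¬ ∃ g : M.Dom Ty.seq, ∀ n : M.Dom Ty.nat,
      M.app (M.app (r.eval M ρ) (M.app g (n + 1))) (M.app g n) = 0)
    (cases : ∀ n,
      (∃ p q, ∀ x, MUnit x → (P n x ↔ ¬ MLe x (mconst p) ∧ ¬ MLe (mconst q) x)) ∨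
      (∃ m, M.app (M.app (r.eval M ρ) m) n = 0 ∧ ∀ x, MUnit x → (P n x ↔ ¬ P m x)) ∨
      ∃ s : M.Dom Ty.seq, (∀ k, M.app (M.app (r.eval M ρ) (M.app s k)) n = 0) ∧
        ∀ x, MUnit x → (P n x ↔ ∃ k, P (M.app s k) x)) :
    (isBorelConstruction D r).Holds M ρ := by
  have hPs (n) : Def fun p : PUnit.{u+1} × M.Dom Ty.seq => chi M (¬ P n p.2) := by
    have := DefP.section (P := fun (q : PUnit.{u+1} × M.Dom Ty.nat) x => P q.2 x) hP (⟨⟩, n)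
    infer_instance
  have hval (n x) : M.app (M.app (D.eval M ρ) n) x = chi M (¬ P n x) := by
    rw [hD, app_mlam, app_mlam]
  simp only [isBorelConstruction, isUnitSet, isWellFounded, Fm.holds_all, Fm.holds_imp,
    Fm.holds_and, Fm.holds_or, Fm.holds_not, Fm.holds_eq, Fm.holds_ex, Fm.holds_iff, holds_le,
    holds_inUnit, holds_realEq, holds_realLt, eval_realOfRat, Tm.eval_app, Tm.eval_wk, Tm.eval_var,
    Env.cons_z, Env.cons_s, eval_zero, eval_one, eval_succ, hval, chi_eq_one, not_not]
  refine ⟨wf, fun n => ⟨⟨fun x _ => chi_le_one _, fun x y ⟨hx, hy, h⟩ => ?_⟩, cases n⟩⟩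
  congr 2
  exact propext ⟨congr n x y hx hy h, congr n y x hy hx h.symm⟩

end

/-- Membership of `x` in the rational open interval with code `j`. -/
def InInt (j : M.Dom Ty.nat) (x : M.Dom Ty.seq) : Prop :=
  ¬ MLe x (mconst (mfst j)) ∧ ¬ MLe (mconst (msnd j)) x

theorem InInt.congr {j : M.Dom Ty.nat} {x y : M.Dom Ty.seq} (hx : MReal x) (hy : MReal y)
    (h : MEq x y) (hj : InInt j x) : InInt j y := by
  have := MReal_mconst (mfst j)
  have := MReal_mconst (msnd j)
  unfold InInt at *
  rw [MLe_iff (by assumption) (by assumption), MLe_iff (by assumption) (by assumption)] at *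
  rwa [← rv_congr hx hy h]

/-- The relation `r` with `r 1 0 = 0`, and `r n 1 = 0` for `n ≥ 2`, is well-founded: in the
construction below, set `0` is the complement of set `1`, which is a union of later sets. -/
theorem not_exists_descending {R : M.Dom Ty.nat → M.Dom Ty.nat → Prop}
    (hR : ∀ m n, R m n ↔ n = 0 ∧ m = 1 ∨ n = 1 ∧ 1 + 1 ≤ m) (g : M.Dom Ty.nat → M.Dom Ty.nat) :
    ¬ ∀ n, R (g (n + 1)) (g n) := by
  intro h
  have a1 := (hR _ _).1 (h 0)
  have a2 := (hR _ _).1 (h (0 + 1))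
  have a3 := (hR _ _).1 (h (0 + 1 + 1))
  have e1 : ¬ ((1 + 1 : M.Dom Ty.nat) ≤ 0) := not_le.2 (Num.zero_lt_succ _)
  have e2 : ¬ ((1 + 1 : M.Dom Ty.nat) ≤ 1) := not_le.2 (Num.lt_succ_iff.2 le_rfl)
  have e3 := num_zero_ne_one (M := M)
  grind

/-- The empty set and the whole unit interval are Borel, since they are rational intervals. -/
theorem exists_borel_const {Γ : Ctx} (ρ : Env M Γ) (c : Prop) :
    ∃ D r, (isBorelConstruction v1 v0).Holds M ((ρ.cons D).cons r) ∧
      ∃ n, ∀ x, MUnit x → (M.app (M.app D n) x = 1 ↔ c) := by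
  refine ⟨mlam fun n => mlam fun x => chi M (¬ c), mlam fun _ => mlam fun _ => 1,
    holds_isBorelConstruction _ (P := fun _ _ => c) (fun _ _ _ _ _ _ h => h) rfl ?_
      (fun n => .inl ?_), 0, fun x _ => by rw [app_mlam, app_mlam, chi_eq_one, not_not]⟩
  · rintro ⟨g, hg⟩
    have := hg 0
    simp only [Tm.eval_var, Env.cons_z, app_mlam] at this
    exact num_zero_ne_one this.symm
  · by_cases h : c
    · obtain ⟨p, hp⟩ := exists_val_eq (-1 : QQ M)
      obtain ⟨q, hq⟩ := exists_val_eq (2 : QQ M)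
      refine ⟨p, q, fun x hx => iff_of_true h ⟨fun h => ?_, fun h => ?_⟩⟩
      · have := h (0 + 1 + 1 + 1 + 1)
        have := hx.2.1 (0 + 1 + 1 + 1 + 1)
        simp only [V_mconst, hp, hh_succ, hh_zero] at *
        linarith
      · have := h (0 + 1 + 1 + 1 + 1)
        have := hx.2.2 (0 + 1 + 1 + 1 + 1)
        simp only [V_mconst, hq, hh_succ, hh_zero] at *
        linarith
    · refine ⟨0, 0, fun x hx => iff_of_false h fun h' => ?_⟩
      have h0 := MReal_mconst (0 : M.Dom Ty.nat)
      rw [not_MLe_iff h0 hx.real, not_MLe_iff hx.real h0] at h'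
      exact absurd h'.2 h'.1.not_gt

variable [HasIND0 M] {Y : M.Dom (Ty.seq ⇒ Ty.nat)} {Γ : Ctx} (ρ : Env M Γ)

/-- A point with a value of `Y` larger than `k` has a rational interval around it in which `Y` takes
such values only. -/
theorem IsInj.exists_interval (hY : IsInj Y) (k : M.Dom Ty.nat) {x : M.Dom Ty.seq} (hx : MUnit x)
    (hk : k < M.app Y x) : ∃ j, InInt j x ∧ ∀ y, MUnit y → InInt j y → k < M.app Y y := by
  obtain ⟨d, hd⟩ := hY.exists_isolated k hx
  set m := d + 1 + 1 + 1 + 1 + 1 with hm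
  obtain ⟨p, hp⟩ := exists_val_eq (V x m - 3 * hh m)
  obtain ⟨q, hq⟩ := exists_val_eq (V x m + 3 * hh m)
  have hp' := MReal_mconst p
  have hq' := MReal_mconst q
  have h1 := abs_le.1 (hx.real.abs_rv_sub_le m)
  have h2 := abs_le.1 (hp'.abs_rv_sub_le (m + 1 + 1))
  have h3 := abs_le.1 (hq'.abs_rv_sub_le (m + 1 + 1))
  have h4 := tr_hh_pos d
  have h5 := tr_hh_pos m
  rw [V_mconst, hp] at h2
  rw [V_mconst, hq] at h3
  refine ⟨mpair p q, ?_, fun y hy hj => ?_⟩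
  · unfold InInt
    rw [mfst_mpair, msnd_mpair, not_MLe_iff hp' hx.real, not_MLe_iff hx.real hq']
    simp only [hh_succ m, hh_succ (m + 1), map_div₀, map_ofNat, map_add, map_sub, map_mul] at *
    constructor <;> linarith
  · unfold InInt at hj
    rw [mfst_mpair, msnd_mpair, not_MLe_iff hp' hy.real, not_MLe_iff hy.real hq'] at hj
    by_contra! hle
    have := hd y hy (fun h => by
      rw [hY.congr y x hy hx h] at hle
      exact absurd hk hle.not_gt) hle
    have h6 : |rv y - rv x| < tr (hh d) := by
      simp only [hm, hh_succ, map_div₀, map_ofNat, map_add, map_sub, map_mul] at *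
      rw [abs_lt]
      constructor <;> linarith
    linarith

/-- For every `K`, the set of all `x` with `Y x ≤ K` is Borel: it is listed, hence closed, so that
its complement is the union of the rational intervals disjoint from it. -/
theorem IsInj.exists_borel (hY : IsInj Y) (K : M.Dom Ty.nat) :
    ∃ D r, (isBorelConstruction v1 v0).Holds M ((ρ.cons D).cons r) ∧
      ∃ n, ∀ x, MUnit x → (M.app (M.app D n) x = 1 ↔ M.app Y x ≤ K) := by
  obtain ⟨l, z, hz⟩ := hY.exists_list K
  -- set `0` is the one in question, set `1` its complement, and set `j + 2` the interval with code
  -- `j` if it is disjoint from set `0`, and empty otherwise; disjointness is definable by the list `z`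
  let P (n : M.Dom Ty.nat) (x : M.Dom Ty.seq) : Prop :=
    (n = 0 ∧ M.app Y x ≤ K) ∨ (n = 1 ∧ ¬ M.app Y x ≤ K) ∨
      ∃ j, n = j + 1 + 1 ∧ (InInt j x ∧ ∀ i, i < l → MUnit (M.app z i) → M.app Y (M.app z i) ≤ K →
        ¬ InInt j (M.app z i))
  have hP : DefP M fun p : (PUnit.{u+1} × M.Dom Ty.nat) × M.Dom Ty.seq => P p.1.2 p.2 := by
    simp only [P, InInt]
    infer_instance
  let R (m n : M.Dom Ty.nat) : Prop := n = 0 ∧ m = 1 ∨ n = 1 ∧ 1 + 1 ≤ m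
  have hR (m n : M.Dom Ty.nat) : M.app (M.app (mlam fun m => mlam fun n => chi M (R m n)) m) n = 0 ↔
      R m n := by
    simp only [R]
    rw [app_mlam, app_mlam, chi_eq_zero]
  have e01 := num_zero_ne_one (M := M)
  have e0 (j : M.Dom Ty.nat) : 0 ≠ j + 1 + 1 := (Num.succ_ne_zero _).symm
  have e1 (j : M.Dom Ty.nat) : 1 ≠ j + 1 + 1 := fun h =>
    Num.succ_ne_zero j (Num.succ_inj (by rw [← h, zero_add]))
  have P0 (x) : P 0 x ↔ M.app Y x ≤ K := by simp [P, e01, e0]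
  have P1 (x) : P 1 x ↔ ¬ M.app Y x ≤ K := by simp [P, e01.symm, e1]
  have P2 (j x) : P (j + 1 + 1) x ↔ InInt j x ∧ ∀ i, i < l → MUnit (M.app z i) →
      M.app Y (M.app z i) ≤ K → ¬ InInt j (M.app z i) := by
    simp only [P, (e0 j).symm, (e1 j).symm, false_and, false_or]
    constructor
    · rintro ⟨j', h, h'⟩
      rwa [Num.succ_inj (Num.succ_inj h)]
    · exact fun h => ⟨j, rfl, h⟩
  refine ⟨mlam fun n => mlam fun x => chi M (¬ P n x), mlam fun m => mlam fun n => chi M (R m n),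
    holds_isBorelConstruction _ (P := P) (fun n x y hx hy h hP => ?_) rfl ?_ ?_, 0, fun x hx => ?_⟩
  · simp only [P] at hP ⊢
    rw [← hY.congr x y hx hy h]
    exact hP.imp_right (Or.imp_right fun ⟨j, h1, h2, h3⟩ => ⟨j, h1, h2.congr hx.real hy.real h, h3⟩)
  · rintro ⟨g, hg⟩
    simp only [Tm.eval_var, Env.cons_z, hR] at hg
    exact not_exists_descending (fun _ _ => Iff.rfl) _ hg
  · intro n
    simp only [Tm.eval_var, Env.cons_z, hR]
    obtain rfl | ⟨n, rfl⟩ := eq_zero_or_succ n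
    · refine .inr (.inl ⟨1, .inl ⟨rfl, rfl⟩, fun x _ => by rw [P0, P1, not_not]⟩)
    obtain rfl | ⟨j, rfl⟩ := eq_zero_or_succ n
    · refine .inr (.inr ⟨mlam fun j => j + 1 + 1, fun k => ?_, fun x hx => ?_⟩)
      · rw [app_mlam, zero_add]
        exact .inr ⟨rfl, add_le_add_left (le_add_of_nonneg_left (Num.zero_le k)) 1⟩
      · rw [zero_add, P1]
        simp only [app_mlam, P2]
        constructor
        · intro h
          obtain ⟨j, hj, hj'⟩ := hY.exists_interval K hx (not_le.1 h)
          exact ⟨j, hj, fun i _ hi hk hij => absurd (hj' _ hi hij) hk.not_gt⟩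
        · rintro ⟨j, hj, h⟩ hk
          obtain ⟨i, hi, hiu, he⟩ := hz x hx hk
          refine h i hi hiu ?_ (hj.congr hx.real hiu.real he.symm)
          rwa [hY.congr _ _ hiu hx he]
    · left
      by_cases h : ∀ i, i < l → MUnit (M.app z i) → M.app Y (M.app z i) ≤ K → ¬ InInt j (M.app z i)
      · exact ⟨mfst j, msnd j, fun x _ => by rw [P2, and_iff_left h]; rfl⟩
      · refine ⟨0, 0, fun x hx => ?_⟩
        rw [P2]
        refine ⟨fun h' => absurd h'.2 h, fun h' => ?_⟩
        have h0 := MReal_mconst (0 : M.Dom Ty.nat)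
        rw [not_MLe_iff h0 hx.real, not_MLe_iff hx.real h0] at h'
        exact absurd h'.2 h'.1.not_gt
  · have h1 : Def fun p : PUnit.{u+1} × M.Dom Ty.seq => chi M (¬ P 0 p.2) := by
      simp only [P0]
      infer_instance
    rw [app_mlam, app_mlam, chi_eq_one, not_not, P0]

/-- The set `{x | 2 ^ (-Y x) > a}` is the whole interval if no power of `2` is at most `a`, and
otherwise `{x | Y x < K}` for the least `K` with `2 ^ (-K) ≤ a`. -/
theorem holds_isBorelFunction_powFn (hY : IsInj Y) (f : Tm Γ Ty.fn)
    (hf : f.eval M ρ = powFn 1 0 Y) : (isBorelFunction f).Holds M ρ := by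
  simp only [isBorelFunction, Fm.holds_all, Fm.holds_imp, Fm.holds_ex, Fm.holds_and,
    Fm.holds_iff, Fm.holds_eq, holds_isReal, holds_inUnit, holds_realLt, Tm.eval_app, Tm.eval_wk,
    Tm.eval_var, Env.cons_z, Env.cons_s, eval_one, hf]
  intro a ha
  have hfa (x) (hx : MUnit x) : MLe (M.app (powFn 1 0 Y) x) a ↔
      ∀ n, hh (M.app Y x) ≤ V a n + 2 * hh n := by
    simp only [MLe, V_powFn hx, map_one, map_zero, sub_zero, one_mul]
  have key : ∃ D r, (isBorelConstruction v1 v0).Holds M (((ρ.cons a).cons D).cons r) ∧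
      ∃ n, ∀ x, MUnit x → (M.app (M.app D n) x = 1 ↔
        ¬ ∀ n, hh (M.app Y x) ≤ V a n + 2 * hh n) := by
    by_cases h : ∃ k, ∀ n, hh k ≤ V a n + 2 * hh n
    · obtain ⟨K, hK, hK'⟩ := exists_least (fun k => ∀ n, hh k ≤ V a n + 2 * hh n) h
      have hiff (k) : (∀ n, hh k ≤ V a n + 2 * hh n) ↔ K ≤ k :=
        ⟨fun h => not_lt.1 fun hk => hK' k hk h, fun h n => (hh_antitone h).trans (hK n)⟩
      simp only [hiff, not_le]
      obtain rfl | ⟨K, rfl⟩ := eq_zero_or_succ K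
      · simpa only [Num.not_lt_zero] using exists_borel_const (ρ.cons a) False
      · simpa only [Num.lt_succ_iff] using hY.exists_borel (ρ.cons a) K
    · simp only [fun k => iff_false_intro (not_exists.1 h k)]
      exact exists_borel_const (ρ.cons a) _
  obtain ⟨D, r, hDr, n, hn⟩ := key
  refine ⟨D, r, hDr, n, fun x hx => ?_⟩
  rw [hn x hx, hfa x hx]

end Borel

/-! ### The equivalences -/

section Equivalences

variable {M : Model.{u}} [IsACA M] {Γ : Ctx} (ρ : Env M Γ)

/-- If an injection `f` into the rational numbers with the property `P` can be found for every
injection `Y` into the natural numbers, then `NIN` is equivalent to `NINwith P`. -/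
theorem holds_NIN_iff_NINwith (P : Fm (Ty.fn :: Γ)) (a b : M.Dom Ty.nat) (hab : a ≠ b)
    (h : ∀ Y, IsInj Y → P.Holds M (ρ.cons (powFn a b Y))) : (NIN ⇚⇛ NINwith P).Holds M ρ := by
  rw [Fm.holds_iff]
  refine ⟨holds_NINwith_of_NIN ρ P, fun hP => ?_⟩
  rw [holds_NINwith] at hP
  rw [holds_NIN]
  exact fun ⟨Y, hY⟩ => hP ⟨powFn a b Y, isRatInj_powFn hY hab, h Y hY⟩

theorem holds_isRealFunction_powFn {Y : M.Dom (Ty.seq ⇒ Ty.nat)} (hY : IsInj Y) (f : Tm Γ Ty.fn)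
    (hf : f.eval M ρ = powFn 1 0 Y) : (isRealFunction f).Holds M ρ := by
  simp only [isRealFunction, Fm.holds_all, Fm.holds_imp, Fm.holds_and, holds_isReal, holds_realEq,
    Tm.eval_app, Tm.eval_wk, Tm.eval_var, Env.cons_z, Env.cons_s, hf]
  refine ⟨fun x _ => MReal_powFn x, fun x y ⟨hx, hy, h⟩ => ?_⟩
  rw [powFn_congr hY hx hy h]
  exact .refl _

theorem holds_boundedVariation_imp (P : Fm (Ty.fn :: Γ))
    (hP : Entails.{u} RCA0ω (isRealFunction v0 ⩓ boundedVariation v0 ⇛ P)) :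
    (NIN ⇚⇛ NINwith P).Holds M ρ :=
  holds_NIN_iff_NINwith ρ P 1 0 num_zero_ne_one.symm fun Y hY => by
    have h := hP M (fun Γ φ hφ => IsACA.sat Γ φ (.base hφ)) (ρ.cons (powFn 1 0 Y))
    rw [Fm.holds_imp, Fm.holds_and] at h
    exact h ⟨holds_isRealFunction_powFn _ hY v0 rfl, holds_boundedVariation_powFn _ hY v0 rfl⟩

end Equivalences

end HigherOrderArith

theorem mainTheorem1 :
    Entails.{u} ACA0ω (NIN ⇚⇛ NINbv) ∧
    (∀ (Γ : Ctx) (Y : Fm (Ty.fn :: Γ)),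
      Entails.{u} RCA0ω (isRealFunction v0 ⩓ boundedVariation v0 ⇛ Y) →
      Entails.{u} ACA0ω (NIN ⇚⇛ NINwith Y)) ∧
    Entails.{u} ACA0ω (NIN ⇚⇛ NINRiemann) ∧
    Entails.{u} ACA0ωIND0 (NIN ⇚⇛ NINBorel) ∧
    Entails.{u} ACA0ωIND0 (NIN ⇚⇛ NINcliq) ∧
    Entails.{u} ACA0ωIND0 (NIN ⇚⇛ NINusc) ∧
    Entails.{u} ACA0ωIND0 (NIN ⇚⇛ NINlsc) := by
  have aca {M : Model.{u}} (h : M.Satisfies ACA0ωIND0) : IsACA M :=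
    ⟨fun Γ φ hφ => h Γ φ (.base hφ)⟩
  have ind {M : Model.{u}} (h : M.Satisfies ACA0ωIND0) : HasIND0 M := ⟨h _ _ .IND0 _⟩
  refine ⟨fun M hM ρ => ?_, fun Γ Y hY M hM ρ => ?_, fun M hM ρ => ?_, fun M hM ρ => ?_,
    fun M hM ρ => ?_, fun M hM ρ => ?_, fun M hM ρ => ?_⟩
  · have : IsACA M := ⟨hM⟩
    exact holds_NIN_iff_NINwith ρ _ 1 0 num_zero_ne_one.symm
      fun Y hY => holds_boundedVariation_powFn _ hY _ rfl
  · have : IsACA M := ⟨hM⟩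
    exact holds_boundedVariation_imp ρ Y hY
  · have : IsACA M := ⟨hM⟩
    exact holds_NIN_iff_NINwith ρ _ 1 0 num_zero_ne_one.symm
      fun Y hY => holds_riemannIntegrable_powFn _ hY _ rfl
  all_goals have := aca hM
  all_goals have := ind hM
  · exact holds_NIN_iff_NINwith ρ _ 1 0 num_zero_ne_one.symm
      fun Y hY => holds_isBorelFunction_powFn _ hY _ rfl
  · exact holds_NIN_iff_NINwith ρ _ 1 0 num_zero_ne_one.symm
      fun Y hY => holds_cliquish_powFn _ hY _ rfl
  · exact holds_NIN_iff_NINwith ρ _ 1 0 num_zero_ne_one.symm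
      fun Y hY => holds_upperSemicontinuous_powFn _ hY _ rfl
  · exact holds_NIN_iff_NINwith ρ _ 0 1 num_zero_ne_one
      fun Y hY => holds_lowerSemicontinuous_powFn _ hY _ rfl
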